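/- Let $Q=(0,\infty)^2$ with points $(x,t)$, $\overline Q=[0,\infty)^2$, $\mathbb N=\{1,2,\dots\}$. All functions are complex valued; derivatives at boundary points are one-sided (equivalently, limits of the derivatives from the interior). **Spaces.** $\mathcal S([0,\infty))$ is the space of $u\in C^\infty([0,\infty))$ with $\rho_N(u)=\sup\{(1+x)^N|u^{(k)}(x)|: k\le N,\ x\ge 0\}<\infty$ for all $N\ge 0$, with the topology of the norms $\rho_N$. $C^\infty([0,\infty))$ has the topology of the seminorms $\sup_{0\le t\le n}|g^{(l)}(t)|$ ($l\ge0$, $n\in\mathbb N$). $\mathcal S_1(\overline Q)$ is the space of $f\in C^\infty(\overline Q)$ with $\lambda_n^*(f)=\sup\{(1+x)^n|\partial_x^k\partial_t^l f(x,t)|:(x,t)\in\overline Q,\ t\le n,\ k+l\le n\}<\infty$ for all $n\in\mathbb N$, with the topology of the $\lambda_n^*$. $\mathcal S_1(\overline Q-\{(0,0)\})$ is the space of $h\in C^\infty(\overline Q-\{(0,0)\})$ with $\lambda_n(h)=\sup\{(1+x)^n|\partial_x^k\partial_t^l h(x,t)|:(x,t)\in\Lambda_n,\ k+l\le n\}<\infty$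 for all $n\in\mathbb N$, where $\Lambda_n=\{(x,t)\in\overline Q: \tfrac1n\le t\le n\}\cup\{(x,t)\in\overline Q: x\ge\tfrac1n,\ t\le\tfrac1n\}$, with the topology of the $\lambda_n$. $C^{(k,l)}([0,1]^2)$ is the space of functions $h$ on $[0,1]^2$ whose derivatives $\partial_x^i h$ ($0\le i\le k$) and $\partial_t^j h$ ($0\le j\le l$) exist and are continuous on $[0,1]^2$, with the topology of uniform convergence of these derivatives. **The solution operator.** Let $\mathcal D=\mathcal S([0,\infty))\times C^\infty([0,\infty))\times\mathcal S_1(\overline Q)$, with the product topology. Put $\hat u(\lambda)=\int_0^\infty e^{-i\lambda y}u(y)\,dy$, $\tilde g(\omega,t)=\int_0^t e^{\omega\tau}g(\tau)\,d\tau$, $\tilde f(\lambda,\omega,t)=\int_0^t e^{\omega\tau}\int_0^\infty e^{-i\lambda y}f(y,\tau)\,dy\,d\tau$, and let $\gamma$ be the contour running along the ray $\arg\lambda=3\pi/4$ from $\infty$ to $0$ and then along the ray $\arg\lambda=\pi/4$ from $0$ to $\infty$. For $(u,g,f)\in\mathcal D$ and $(x,t)\in Q$ define $$2\pi\,\Phi(u,g,f)(x,t)=\int_{-\infty}^{\infty}e^{i\lambda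 x-\lambda^2t}\hat u(\lambda)\,d\lambda-\int_\gamma e^{i\lambda x-\lambda^2t}\hat u(-\lambda)\,d\lambda-2i\int_\gamma e^{i\lambda x-\lambda^2t}\tilde g(\lambda^2,t)\,\lambda\,d\lambda+\int_{-\infty}^{\infty}e^{i\lambda x-\lambda^2t}\tilde f(\lambda,\lambda^2,t)\,d\lambda-\int_\gamma e^{i\lambda x-\lambda^2t}\tilde f(-\lambda,\lambda^2,t)\,d\lambda ;$$ at points of the boundary of $Q$, $\Phi(u,g,f)$ is given by its limit from within $Q$. **Claims.** 1. $\mathcal D_0=\{(u,g,f)\in\mathcal D: u(0)=g(0)\}$ is a closed subspace of $\mathcal D$. The restriction of $\Phi$ to $\mathcal D_0$ maps $\mathcal D_0$ into $\mathcal S_1(\overline Q-\{(0,0)\})\cap C^{(1,0)}([0,1]^2)$, and it is continuous both as a map to $\mathcal S_1(\overline Q-\{(0,0)\})$ and as a map to $C^{(1,0)}([0,1]^2)$. 2. $\mathcal D_1=\{(u,g,f)\in\mathcal D: u(0)=g(0)\text{ and }g'(0)=u''(0)+f(0,0)\}$ is a closed subspace of $\mathcal D$. The restriction of $\Phi$ to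 $\mathcal D_1$ maps $\mathcal D_1$ into $\mathcal S_1(\overline Q-\{(0,0)\})\cap C^{(2,1)}([0,1]^2)$, it takes values in $C^{(3,1)}([0,1]^2)$ as well, and it is continuous both as a map to $\mathcal S_1(\overline Q-\{(0,0)\})$ and as a map to $C^{(3,1)}([0,1]^2)$. -/

import Mathlib

open Set Filter Topology MeasureTheory
open scoped ContDiff

noncomputable section

namespace HalfLineHeat

/-! ### Spaces defined by families of seminorms `h ↦ sup_a |L a h|` -/

section SupSpaces

variable {E : Type*} [AddCommGroup E] [Module ℂ E] {κ : Type*} {ι : κ → Type*}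

/-- The subspace of all `h` for which every `sup_a |L n a h|` is finite. -/
def boundedSubmodule (L : ∀ n : κ, ι n → E →ₗ[ℂ] ℂ) : Submodule ℂ E where
  carrier := {h | ∀ n, BddAbove (range fun a : ι n => ‖L n a h‖)}
  zero_mem' := by
    intro n
    refine ⟨0, ?_⟩
    rintro _ ⟨a, rfl⟩
    simp
  add_mem' := by
    intro h₁ h₂ H₁ H₂ n
    obtain ⟨C₁, hC₁⟩ := H₁ n
    obtain ⟨C₂, hC₂⟩ := H₂ n
    refine ⟨C₁ + C₂, ?_⟩
    rintro _ ⟨a, rfl⟩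
    simp only [map_add]
    exact (norm_add_le _ _).trans (add_le_add (hC₁ ⟨a, rfl⟩) (hC₂ ⟨a, rfl⟩))
  smul_mem' := by
    intro c h H n
    obtain ⟨C, hC⟩ := H n
    refine ⟨‖c‖ * C, ?_⟩
    rintro _ ⟨a, rfl⟩
    simp only [map_smul, smul_eq_mul, norm_mul]
    exact mul_le_mul_of_nonneg_left (hC ⟨a, rfl⟩) (norm_nonneg _)

/-- The subspace `boundedSubmodule L` as a type of its own (so that it carries the seminorm
topology below and not a subspace topology). -/
def SupSpace (L : ∀ n : κ, ι n → E →ₗ[ℂ] ℂ) : Type _ := ↥(boundedSubmodule L)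

variable (L : ∀ n : κ, ι n → E →ₗ[ℂ] ℂ)

instance : AddCommGroup (SupSpace L) := inferInstanceAs (AddCommGroup ↥(boundedSubmodule L))

instance : Module ℂ (SupSpace L) := inferInstanceAs (Module ℂ ↥(boundedSubmodule L))

/-- The inclusion. -/
def SupSpace.val : SupSpace L →ₗ[ℂ] E := (boundedSubmodule L).subtype

theorem SupSpace.bdd (h : SupSpace L) (n : κ) :
    BddAbove (range fun a : ι n => ‖L n a (SupSpace.val L h)‖) := Subtype.property h n

/-- The seminorm `h ↦ sup_a |L n a h|`. -/
def supSeminorm (n : κ) : Seminorm ℂ (SupSpace L) :=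
  Seminorm.of (fun h => ⨆ a : ι n, ‖L n a (SupSpace.val L h)‖)
    (by
      intro h₁ h₂
      rcases isEmpty_or_nonempty (ι n) with hι | hι
      · simp
      · refine ciSup_le fun a => ?_
        simp only [map_add]
        exact (norm_add_le _ _).trans
          (add_le_add (le_ciSup (SupSpace.bdd L h₁ n) a) (le_ciSup (SupSpace.bdd L h₂ n) a)))
    (by
      intro c h
      simp only [map_smul, smul_eq_mul, norm_mul]
      exact (Real.mul_iSup_of_nonneg (norm_nonneg c) _).symm)

/-- The locally convex topology defined by the seminorms `supSeminorm L n`. -/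
instance [Nonempty κ] : TopologicalSpace (SupSpace L) :=
  (SeminormFamily.moduleFilterBasis (𝕜 := ℂ) (supSeminorm L)).topology

theorem withSeminorms_supSeminorm [Nonempty κ] : WithSeminorms (supSeminorm L) := ⟨rfl⟩

end SupSpaces

/-! ### Functions on `[0, ∞)` -/

/-- `C^∞([0, ∞))`: functions smooth up to the endpoint. A function on `[0, ∞)` is represented by
its extension by zero to `ℝ`. -/
def smoothHalfLine : Submodule ℂ (ℝ → ℂ) where
  carrier := {u | ContDiffOn ℝ ∞ u (Ici 0) ∧ ∀ x, x ∉ Ici (0 : ℝ) → u x = 0}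
  zero_mem' := ⟨contDiffOn_const, fun _ _ => rfl⟩
  add_mem' := fun ha hb => ⟨ha.1.add hb.1, fun x hx => by simp [ha.2 x hx, hb.2 x hx]⟩
  smul_mem' := fun c _ ha => ⟨contDiffOn_const.smul ha.1, fun x hx => by simp [ha.2 x hx]⟩

/-- `u ↦ u^(k)(x)`, for `x ≥ 0` (one-sided derivatives at `0`). -/
def halfDeriv (k : ℕ) (x : ℝ) (hx : 0 ≤ x) : smoothHalfLine →ₗ[ℂ] ℂ where
  toFun u := iteratedDerivWithin k (u : ℝ → ℂ) (Ici 0) x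
  map_add' u v :=
    iteratedDerivWithin_add hx (uniqueDiffOn_Ici 0)
      ((u.2.1.of_le (by exact_mod_cast le_top)) x hx)
      ((v.2.1.of_le (by exact_mod_cast le_top)) x hx)
  map_smul' c u :=
    iteratedDerivWithin_const_smul hx (uniqueDiffOn_Ici 0) c
      ((u.2.1.of_le (by exact_mod_cast le_top)) x hx)

/-- The functionals `(1 + x)^N u^(k)(x)`, `k ≤ N`, `x ≥ 0`. -/
def schwartzFunctional (N : ℕ) (a : {q : ℕ × ℝ // q.1 ≤ N ∧ 0 ≤ q.2}) :
    smoothHalfLine →ₗ[ℂ] ℂ :=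
  (((1 + a.1.2) ^ N : ℝ) : ℂ) • halfDeriv a.1.1 a.1.2 a.2.2

/-- The Schwartz space `𝒮([0, ∞))`, topologized by
`ρ_N(u) = sup {(1 + x)^N |u^(k)(x)| : k ≤ N, x ≥ 0}`, `N = 0, 1, 2, …`. -/
abbrev SchwartzHalfLine : Type := SupSpace schwartzFunctional

/-- The functionals `g^(l)(t)`, `0 ≤ t ≤ n`, indexed by the pair `(n, l)`. -/
def smoothFunctional (m : ℕ+ × ℕ) (a : {t : ℝ // 0 ≤ t ∧ t ≤ (m.1 : ℕ)}) :
    smoothHalfLine →ₗ[ℂ] ℂ :=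
  halfDeriv m.2 a.1 a.2.1

/-- The space `C^∞([0, ∞))`, topologized by the seminorms `sup {|g^(l)(t)| : 0 ≤ t ≤ n}`. -/
abbrev SmoothHalfLine : Type := SupSpace smoothFunctional

/-- The seminorms of `C^∞([0, ∞))` are finite on all smooth functions. -/
theorem boundedSubmodule_smoothFunctional : boundedSubmodule smoothFunctional = ⊤ := by
  rw [eq_top_iff]
  intro u _ m
  have hc : ContinuousOn (fun t => ‖iteratedDerivWithin m.2 (u : ℝ → ℂ) (Ici 0) t‖)
      (Icc 0 ((m.1 : ℕ) : ℝ)) :=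
    ((u.2.1.continuousOn_iteratedDerivWithin (by exact_mod_cast le_top)
      (uniqueDiffOn_Ici 0)).mono Icc_subset_Ici_self).norm
  obtain ⟨C, hC⟩ := isCompact_Icc.bddAbove_image hc
  refine ⟨C, ?_⟩
  rintro _ ⟨a, rfl⟩
  exact hC ⟨a.1, ⟨a.2.1, a.2.2⟩, rfl⟩

/-! ### Functions on the quarter-plane; points are `p = (x, t)` -/

/-- `Q = {x > 0, t > 0}`. -/
def Q : Set (ℝ × ℝ) := Ioi 0 ×ˢ Ioi 0

/-- `Q̄ = {x ≥ 0, t ≥ 0}`. -/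
def Qbar : Set (ℝ × ℝ) := Ici 0 ×ˢ Ici 0

/-- `Q̄ − {(0,0)}`. -/
def Qpunct : Set (ℝ × ℝ) := Qbar \ {(0, 0)}

theorem uniqueDiffOn_Qbar : UniqueDiffOn ℝ Qbar :=
  (uniqueDiffOn_Ici 0).prod (uniqueDiffOn_Ici 0)

theorem uniqueDiffOn_Qpunct : UniqueDiffOn ℝ Qpunct :=
  uniqueDiffOn_Qbar.inter isOpen_compl_singleton

/-- First order derivative of `h`, within `S`, in the direction `v`. -/
def dirDeriv (S : Set (ℝ × ℝ)) (v : ℝ × ℝ) (h : ℝ × ℝ → ℂ) : ℝ × ℝ → ℂ :=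
  fun p => fderivWithin ℝ h S p v

/-- `∂^{k+l} h / ∂x^k ∂t^l`, within `S`. -/
def mixedPartial (S : Set (ℝ × ℝ)) (k l : ℕ) (h : ℝ × ℝ → ℂ) : ℝ × ℝ → ℂ :=
  (dirDeriv S (1, 0))^[k] ((dirDeriv S (0, 1))^[l] h)

section MixedPartial

variable {S : Set (ℝ × ℝ)}

theorem contDiffOn_dirDeriv (hS : UniqueDiffOn ℝ S) (v : ℝ × ℝ) {h : ℝ × ℝ → ℂ}
    (hh : ContDiffOn ℝ ∞ h S) : ContDiffOn ℝ ∞ (dirDeriv S v h) S :=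
  (hh.fderivWithin hS (by simp)).clm_apply contDiffOn_const

theorem contDiffOn_iterate_dirDeriv (hS : UniqueDiffOn ℝ S) (v : ℝ × ℝ) (k : ℕ) {h : ℝ × ℝ → ℂ}
    (hh : ContDiffOn ℝ ∞ h S) : ContDiffOn ℝ ∞ ((dirDeriv S v)^[k] h) S := by
  induction k with
  | zero => exact hh
  | succ k ih =>
    rw [Function.iterate_succ_apply']
    exact contDiffOn_dirDeriv hS v ih

theorem iterate_dirDeriv_congr (v : ℝ × ℝ) (k : ℕ) {h₁ h₂ : ℝ × ℝ → ℂ} (he : EqOn h₁ h₂ S) :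
    EqOn ((dirDeriv S v)^[k] h₁) ((dirDeriv S v)^[k] h₂) S := by
  induction k with
  | zero => exact he
  | succ k ih =>
    intro p hp
    rw [Function.iterate_succ_apply', Function.iterate_succ_apply']
    simp only [dirDeriv]
    rw [fderivWithin_congr ih (ih hp)]

theorem iterate_dirDeriv_add (hS : UniqueDiffOn ℝ S) (v : ℝ × ℝ) (k : ℕ) {h₁ h₂ : ℝ × ℝ → ℂ}
    (hh₁ : ContDiffOn ℝ ∞ h₁ S) (hh₂ : ContDiffOn ℝ ∞ h₂ S) :
    EqOn ((dirDeriv S v)^[k] (h₁ + h₂)) ((dirDeriv S v)^[k] h₁ + (dirDeriv S v)^[k] h₂) S := by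
  induction k with
  | zero => exact fun p _ => rfl
  | succ k ih =>
    intro p hp
    have d₁ := ((contDiffOn_iterate_dirDeriv hS v k hh₁).differentiableOn (by simp)) p hp
    have d₂ := ((contDiffOn_iterate_dirDeriv hS v k hh₂).differentiableOn (by simp)) p hp
    simp only [Function.iterate_succ_apply', Pi.add_apply]
    simp only [dirDeriv]
    rw [fderivWithin_congr ih (ih hp), fderivWithin_add (hS p hp) d₁ d₂]
    rfl

theorem iterate_dirDeriv_smul (hS : UniqueDiffOn ℝ S) (v : ℝ × ℝ) (k : ℕ) (c : ℂ)
    {h : ℝ × ℝ → ℂ} (hh : ContDiffOn ℝ ∞ h S) :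
    EqOn ((dirDeriv S v)^[k] (c • h)) (c • (dirDeriv S v)^[k] h) S := by
  induction k with
  | zero => exact fun p _ => rfl
  | succ k ih =>
    intro p hp
    have d := ((contDiffOn_iterate_dirDeriv hS v k hh).differentiableOn (by simp)) p hp
    simp only [Function.iterate_succ_apply', Pi.smul_apply]
    simp only [dirDeriv]
    rw [fderivWithin_congr ih (ih hp), fderivWithin_const_smul (hS p hp)]
    · rfl
    · exact d

end MixedPartial

/-- `C^∞(S)`, for a set `S` with unique derivatives (here `Q̄` or `Q̄ − {(0,0)}`): functions smooth
on `S`, up to those boundary points that belong to `S`. A function on `S` is represented by its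
extension by zero. -/
def smoothOn (S : Set (ℝ × ℝ)) : Submodule ℂ (ℝ × ℝ → ℂ) where
  carrier := {h | ContDiffOn ℝ ∞ h S ∧ ∀ p, p ∉ S → h p = 0}
  zero_mem' := ⟨contDiffOn_const, fun _ _ => rfl⟩
  add_mem' := fun ha hb => ⟨ha.1.add hb.1, fun x hx => by simp [ha.2 x hx, hb.2 x hx]⟩
  smul_mem' := fun c _ ha => ⟨contDiffOn_const.smul ha.1, fun x hx => by simp [ha.2 x hx]⟩

/-- `h ↦ ∂^{k+l} h / ∂x^k ∂t^l (p)`, for `p ∈ S`. -/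
def mixedPartialAt {S : Set (ℝ × ℝ)} (hS : UniqueDiffOn ℝ S) (k l : ℕ) (p : ℝ × ℝ) (hp : p ∈ S) :
    smoothOn S →ₗ[ℂ] ℂ where
  toFun h := mixedPartial S k l (h : ℝ × ℝ → ℂ) p
  map_add' h₁ h₂ :=
    (iterate_dirDeriv_congr _ k (iterate_dirDeriv_add hS (0, 1) l h₁.2.1 h₂.2.1) hp).trans
      (iterate_dirDeriv_add hS (1, 0) k (contDiffOn_iterate_dirDeriv hS _ l h₁.2.1)
        (contDiffOn_iterate_dirDeriv hS _ l h₂.2.1) hp)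
  map_smul' c h :=
    (iterate_dirDeriv_congr _ k (iterate_dirDeriv_smul hS (0, 1) l c h.2.1) hp).trans
      (iterate_dirDeriv_smul hS (1, 0) k c (contDiffOn_iterate_dirDeriv hS _ l h.2.1) hp)

/-- `Λ*_n = {(x,t) ∈ Q̄ : t ≤ n}`. -/
def stripBar (n : ℕ+) : Set (ℝ × ℝ) := {p | p ∈ Qbar ∧ p.2 ≤ (n : ℕ)}

/-- `Λ_n = {(x,t) ∈ Q̄ : 1/n ≤ t ≤ n} ∪ {(x,t) ∈ Q̄ : x ≥ 1/n, t ≤ 1/n}`. -/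
def stripPunct (n : ℕ+) : Set (ℝ × ℝ) :=
  {p | p ∈ Qbar ∧ 1 / ((n : ℕ) : ℝ) ≤ p.2 ∧ p.2 ≤ (n : ℕ)} ∪
    {p | p ∈ Qbar ∧ 1 / ((n : ℕ) : ℝ) ≤ p.1 ∧ p.2 ≤ 1 / ((n : ℕ) : ℝ)}

theorem stripPunct_subset (n : ℕ+) : stripPunct n ⊆ Qpunct := by
  have hn : (0 : ℝ) < 1 / ((n : ℕ) : ℝ) := by
    have : (0 : ℝ) < ((n : ℕ) : ℝ) := by exact_mod_cast n.pos
    positivity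
  rintro p (⟨h, h1, -⟩ | ⟨h, h1, -⟩)
  · refine ⟨h, ?_⟩
    rintro rfl
    exact absurd h1 (not_le.2 hn)
  · refine ⟨h, ?_⟩
    rintro rfl
    exact absurd h1 (not_le.2 hn)

/-- The functionals `(1 + x)^n ∂^{k+l} f/∂x^k∂t^l (x,t)`, `(x,t) ∈ Λ*_n`, `k + l ≤ n`. -/
def stripBarFunctional (n : ℕ+)
    (a : {q : (ℕ × ℕ) × (ℝ × ℝ) // q.1.1 + q.1.2 ≤ (n : ℕ) ∧ q.2 ∈ stripBar n}) :
    smoothOn Qbar →ₗ[ℂ] ℂ :=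
  (((1 + a.1.2.1) ^ (n : ℕ) : ℝ) : ℂ) •
    mixedPartialAt uniqueDiffOn_Qbar a.1.1.1 a.1.1.2 a.1.2 a.2.2.1

/-- The functionals `(1 + x)^n ∂^{k+l} h/∂x^k∂t^l (x,t)`, `(x,t) ∈ Λ_n`, `k + l ≤ n`. -/
def stripPunctFunctional (n : ℕ+)
    (a : {q : (ℕ × ℕ) × (ℝ × ℝ) // q.1.1 + q.1.2 ≤ (n : ℕ) ∧ q.2 ∈ stripPunct n}) :
    smoothOn Qpunct →ₗ[ℂ] ℂ :=
  (((1 + a.1.2.1) ^ (n : ℕ) : ℝ) : ℂ) •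
    mixedPartialAt uniqueDiffOn_Qpunct a.1.1.1 a.1.1.2 a.1.2 (stripPunct_subset n a.2.2)

/-- The space `𝒮₁(Q̄)` with the topology of the seminorms `λ*_n`, `n = 1, 2, …`. -/
abbrev S1Qbar : Type := SupSpace stripBarFunctional

/-- The space `𝒮₁(Q̄ − {(0,0)})` with the topology of the seminorms `λ_n`, `n = 1, 2, …`. -/
abbrev S1Qpunct : Type := SupSpace stripPunctFunctional

/-- The function `Q̄ − {(0,0)} → ℂ`, extended by zero. -/
def S1Qpunct.toFun (h : S1Qpunct) : ℝ × ℝ → ℂ := SupSpace.val stripPunctFunctional h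

/-! ### The spaces `C^{(k,l)}([0,1] × [0,1])` -/

/-- `[0,1] × [0,1]`. -/
def unitSquare : Set (ℝ × ℝ) := Icc 0 1 ×ˢ Icc 0 1

/-- `∂^i h / ∂x^i (x,t)` on the unit square (one-sided at the edges). -/
def squareDx (i : ℕ) (h : ℝ × ℝ → ℂ) (p : ℝ × ℝ) : ℂ :=
  iteratedDerivWithin i (fun x => h (x, p.2)) (Icc 0 1) p.1

/-- `∂^j h / ∂t^j (x,t)` on the unit square (one-sided at the edges). -/
def squareDt (j : ℕ) (h : ℝ × ℝ → ℂ) (p : ℝ × ℝ) : ℂ :=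
  iteratedDerivWithin j (fun t => h (p.1, t)) (Icc 0 1) p.2

theorem uniqueDiffOn_unitInterval : UniqueDiffOn ℝ (Icc (0 : ℝ) 1) := uniqueDiffOn_Icc one_pos

section Square

variable {k : ℕ} {h h₁ h₂ : ℝ × ℝ → ℂ}

theorem squareDx_add (hh₁ : ∀ t ∈ Icc (0 : ℝ) 1, ContDiffOn ℝ k (fun x => h₁ (x, t)) (Icc 0 1))
    (hh₂ : ∀ t ∈ Icc (0 : ℝ) 1, ContDiffOn ℝ k (fun x => h₂ (x, t)) (Icc 0 1))
    {i : ℕ} (hi : i ≤ k) {p : ℝ × ℝ} (hp : p ∈ unitSquare) :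
    squareDx i (h₁ + h₂) p = squareDx i h₁ p + squareDx i h₂ p :=
  iteratedDerivWithin_add hp.1 uniqueDiffOn_unitInterval
    (((hh₁ p.2 hp.2).of_le (by exact_mod_cast hi)) p.1 hp.1)
    (((hh₂ p.2 hp.2).of_le (by exact_mod_cast hi)) p.1 hp.1)

theorem squareDt_add (hh₁ : ∀ x ∈ Icc (0 : ℝ) 1, ContDiffOn ℝ k (fun t => h₁ (x, t)) (Icc 0 1))
    (hh₂ : ∀ x ∈ Icc (0 : ℝ) 1, ContDiffOn ℝ k (fun t => h₂ (x, t)) (Icc 0 1))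
    {i : ℕ} (hi : i ≤ k) {p : ℝ × ℝ} (hp : p ∈ unitSquare) :
    squareDt i (h₁ + h₂) p = squareDt i h₁ p + squareDt i h₂ p :=
  iteratedDerivWithin_add hp.2 uniqueDiffOn_unitInterval
    (((hh₁ p.1 hp.1).of_le (by exact_mod_cast hi)) p.2 hp.2)
    (((hh₂ p.1 hp.1).of_le (by exact_mod_cast hi)) p.2 hp.2)

theorem squareDx_smul (c : ℂ)
    (hh : ∀ t ∈ Icc (0 : ℝ) 1, ContDiffOn ℝ k (fun x => h (x, t)) (Icc 0 1))
    {i : ℕ} (hi : i ≤ k) {p : ℝ × ℝ} (hp : p ∈ unitSquare) :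
    squareDx i (c • h) p = c • squareDx i h p :=
  iteratedDerivWithin_const_smul hp.1 uniqueDiffOn_unitInterval c
    (((hh p.2 hp.2).of_le (by exact_mod_cast hi)) p.1 hp.1)

theorem squareDt_smul (c : ℂ)
    (hh : ∀ x ∈ Icc (0 : ℝ) 1, ContDiffOn ℝ k (fun t => h (x, t)) (Icc 0 1))
    {i : ℕ} (hi : i ≤ k) {p : ℝ × ℝ} (hp : p ∈ unitSquare) :
    squareDt i (c • h) p = c • squareDt i h p :=
  iteratedDerivWithin_const_smul hp.2 uniqueDiffOn_unitInterval c
    (((hh p.1 hp.1).of_le (by exact_mod_cast hi)) p.2 hp.2)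

end Square

/-- `C^{(k,l)}([0,1] × [0,1])`: the partial derivatives `∂^i h/∂x^i`, `i ≤ k`, and `∂^j h/∂t^j`,
`j ≤ l`, exist and are continuous on the closed square. A function on the square is represented by
its extension by zero. -/
def ckl (k l : ℕ) : Submodule ℂ (ℝ × ℝ → ℂ) where
  carrier := {h |
    (∀ t ∈ Icc (0 : ℝ) 1, ContDiffOn ℝ k (fun x => h (x, t)) (Icc 0 1)) ∧
    (∀ x ∈ Icc (0 : ℝ) 1, ContDiffOn ℝ l (fun t => h (x, t)) (Icc 0 1)) ∧
    (∀ i ≤ k, ContinuousOn (squareDx i h) unitSquare) ∧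
    (∀ j ≤ l, ContinuousOn (squareDt j h) unitSquare) ∧
    ∀ p, p ∉ unitSquare → h p = 0}
  zero_mem' := by
    refine ⟨fun _ _ => contDiffOn_const, fun _ _ => contDiffOn_const, fun i _ => ?_, fun j _ => ?_,
      fun _ _ => rfl⟩
    · refine (continuousOn_const (c := (0 : ℂ))).congr fun p hp => ?_
      simp [squareDx]
    · refine (continuousOn_const (c := (0 : ℂ))).congr fun p hp => ?_
      simp [squareDt]
  add_mem' := by
    rintro h₁ h₂ ⟨a₁, b₁, c₁, d₁, e₁⟩ ⟨a₂, b₂, c₂, d₂, e₂⟩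
    exact ⟨fun t ht => (a₁ t ht).add (a₂ t ht), fun x hx => (b₁ x hx).add (b₂ x hx),
      fun i hi => ((c₁ i hi).add (c₂ i hi)).congr fun p hp => squareDx_add a₁ a₂ hi hp,
      fun j hj => ((d₁ j hj).add (d₂ j hj)).congr fun p hp => squareDt_add b₁ b₂ hj hp,
      fun p hp => by simp [e₁ p hp, e₂ p hp]⟩
  smul_mem' := by
    rintro s h ⟨a, b, c, d, e⟩
    exact ⟨fun t ht => contDiffOn_const.smul (a t ht), fun x hx => contDiffOn_const.smul (b x hx),
      fun i hi => ((c i hi).const_smul s).congr fun p hp => squareDx_smul s a hi hp,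
      fun j hj => ((d j hj).const_smul s).congr fun p hp => squareDt_smul s b hj hp,
      fun p hp => by simp [e p hp]⟩

/-- The functionals `∂^i h/∂x^i (x,t)`, `i ≤ k`, and `∂^j h/∂t^j (x,t)`, `j ≤ l`, with `(x,t)` in
the unit square. -/
def cklFunctional (k l : ℕ) (m : Fin (k + 1) ⊕ Fin (l + 1)) (p : unitSquare) :
    ckl k l →ₗ[ℂ] ℂ :=
  match m with
  | Sum.inl i =>
    { toFun := fun h => squareDx i (h : ℝ × ℝ → ℂ) p
      map_add' := fun h₁ h₂ => squareDx_add h₁.2.1 h₂.2.1 (Nat.lt_succ_iff.1 i.2) p.2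
      map_smul' := fun c h => squareDx_smul c h.2.1 (Nat.lt_succ_iff.1 i.2) p.2 }
  | Sum.inr j =>
    { toFun := fun h => squareDt j (h : ℝ × ℝ → ℂ) p
      map_add' := fun h₁ h₂ => squareDt_add h₁.2.2.1 h₂.2.2.1 (Nat.lt_succ_iff.1 j.2) p.2
      map_smul' := fun c h => squareDt_smul c h.2.2.1 (Nat.lt_succ_iff.1 j.2) p.2 }

/-- The space `C^{(k,l)}([0,1] × [0,1])` with the topology of uniform convergence, on the closed
square, of the derivatives `∂^i/∂x^i`, `i ≤ k`, and `∂^j/∂t^j`, `j ≤ l`. -/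
abbrev Ckl (k l : ℕ) : Type := SupSpace (cklFunctional k l)

/-- The function `[0,1] × [0,1] → ℂ`, extended by zero. -/
def Ckl.toFun {k l : ℕ} (h : Ckl k l) : ℝ × ℝ → ℂ := SupSpace.val (cklFunctional k l) h

/-- The seminorms of `C^{(k,l)}([0,1] × [0,1])` are finite on the whole space. -/
theorem boundedSubmodule_cklFunctional (k l : ℕ) : boundedSubmodule (cklFunctional k l) = ⊤ := by
  rw [eq_top_iff]
  rintro h - (i | j)
  · obtain ⟨C, hC⟩ := (isCompact_Icc.prod isCompact_Icc).bddAbove_image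
      (h.2.2.2.1 i (Nat.lt_succ_iff.1 i.2)).norm
    refine ⟨C, ?_⟩
    rintro _ ⟨p, rfl⟩
    exact hC ⟨p.1, p.2, rfl⟩
  · obtain ⟨C, hC⟩ := (isCompact_Icc.prod isCompact_Icc).bddAbove_image
      (h.2.2.2.2.1 j (Nat.lt_succ_iff.1 j.2)).norm
    refine ⟨C, ?_⟩
    rintro _ ⟨p, rfl⟩
    exact hC ⟨p.1, p.2, rfl⟩

/-! ### The solution operator of the unified transform method -/

/-- `û(z) = ∫_0^∞ e^{-izy} u(y) dy`. -/
def hatTransform (u : ℝ → ℂ) (z : ℂ) : ℂ :=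
  ∫ y in Ioi (0 : ℝ), Complex.exp (-Complex.I * z * y) * u y

/-- `g̃(w,t) = ∫_0^t e^{wτ} g(τ) dτ`. -/
def tildeTransform (g : ℝ → ℂ) (w : ℂ) (t : ℝ) : ℂ :=
  ∫ τ in (0 : ℝ)..t, Complex.exp (w * τ) * g τ

/-- `f̃(z,w,t) = ∫_0^t e^{wτ} ∫_0^∞ e^{-izy} f(y,τ) dy dτ`. -/
def forcingTransform (f : ℝ × ℝ → ℂ) (z w : ℂ) (t : ℝ) : ℂ :=
  ∫ τ in (0 : ℝ)..t, Complex.exp (w * τ) * hatTransform (fun y => f (y, τ)) z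

/-- `∫_γ F(z) dz`, where `γ` is the contour made of the rays `arg z = 3π/4` and `arg z = π/4`,
run through from `∞ e^{3πi/4}` to `0` and then to `∞ e^{πi/4}`. -/
def gammaIntegral (F : ℂ → ℂ) : ℂ :=
  (∫ r in Ioi (0 : ℝ), F (r * Complex.exp (Complex.I * (Real.pi / 4 : ℝ))) *
      Complex.exp (Complex.I * (Real.pi / 4 : ℝ))) -
    ∫ r in Ioi (0 : ℝ), F (r * Complex.exp (Complex.I * (3 * Real.pi / 4 : ℝ))) *
      Complex.exp (Complex.I * (3 * Real.pi / 4 : ℝ))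

/-- `e^{izx - z²t}`. -/
def heatExp (x t : ℝ) (z : ℂ) : ℂ := Complex.exp (Complex.I * z * x - z ^ 2 * t)

/-- `(𝕀₀⁺ u)(x,t)`, `(x,t) ∈ Q`. -/
def opI0plus (u : ℝ → ℂ) (x t : ℝ) : ℂ :=
  ∫ z : ℝ, heatExp x t z * hatTransform u z

/-- `(𝕀₀⁻ u)(x,t)`, `(x,t) ∈ Q`. -/
def opI0minus (u : ℝ → ℂ) (x t : ℝ) : ℂ :=
  gammaIntegral fun z => heatExp x t z * hatTransform u (-z)

/-- `(𝕀₁ g)(x,t)`, `(x,t) ∈ Q`. -/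
def opI1 (g : ℝ → ℂ) (x t : ℝ) : ℂ :=
  gammaIntegral fun z => heatExp x t z * tildeTransform g (z ^ 2) t * z

/-- `(𝕀₂⁺ f)(x,t)`, `(x,t) ∈ Q`. -/
def opI2plus (f : ℝ × ℝ → ℂ) (x t : ℝ) : ℂ :=
  ∫ z : ℝ, heatExp x t z * forcingTransform f z ((z : ℂ) ^ 2) t

/-- `(𝕀₂⁻ f)(x,t)`, `(x,t) ∈ Q`. -/
def opI2minus (f : ℝ × ℝ → ℂ) (x t : ℝ) : ℂ :=
  gammaIntegral fun z => heatExp x t z * forcingTransform f (-z) (z ^ 2) t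

/-- The space of data `𝒟 = 𝒮([0,∞)) × C^∞([0,∞)) × 𝒮₁(Q̄)`, with the product topology. -/
abbrev Data : Type := SchwartzHalfLine × SmoothHalfLine × S1Qbar

/-- The initial datum `u`. -/
def uData : Data →ₗ[ℂ] smoothHalfLine := SupSpace.val _ ∘ₗ LinearMap.fst ℂ _ _

/-- The boundary datum `g`. -/
def gData : Data →ₗ[ℂ] smoothHalfLine :=
  SupSpace.val _ ∘ₗ LinearMap.fst ℂ _ _ ∘ₗ LinearMap.snd ℂ _ _

/-- The forcing `f`. -/
def fData : Data →ₗ[ℂ] smoothOn Qbar :=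
  SupSpace.val _ ∘ₗ LinearMap.snd ℂ _ _ ∘ₗ LinearMap.snd ℂ _ _

/-- The function `Φ(u,g,f)` on the open quarter-plane `Q` (only its values there are used):
`2πΦ(u,g,f) = 𝕀₀⁺u − 𝕀₀⁻u − 2i𝕀₁g + 𝕀₂⁺f − 𝕀₂⁻f`. -/
def Phi (d : Data) (p : ℝ × ℝ) : ℂ :=
  (1 / (2 * Real.pi) : ℂ) *
    (opI0plus (uData d) p.1 p.2 - opI0minus (uData d) p.1 p.2
      - 2 * Complex.I * opI1 (gData d) p.1 p.2
      + opI2plus (fData d) p.1 p.2 - opI2minus (fData d) p.1 p.2)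

open Classical in
/-- A function `F` on `Q`, regarded as a function on `S ⊆ Q̄`: it is `F` on `S ∩ Q`, at the other
points of `S` (boundary points of `Q`) it is the limit of `F` from within `Q`, and outside `S` it
is zero. -/
def extendTo (S : Set (ℝ × ℝ)) (F : ℝ × ℝ → ℂ) : ℝ × ℝ → ℂ :=
  S.indicator fun p => if p ∈ Q then F p else limUnder (𝓝[Q] p) F

/-- `𝒟₀ = {(u,g,f) ∈ 𝒟 : u(0) = g(0)}`. -/
def D0 : Submodule ℂ Data where
  carrier := {d | (uData d : ℝ → ℂ) 0 = (gData d : ℝ → ℂ) 0}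
  zero_mem' := by simp
  add_mem' := by
    intro a b ha hb
    simp only [mem_ofPred_eq, map_add, Submodule.coe_add, Pi.add_apply] at *
    rw [ha, hb]
  smul_mem' := by
    intro c a ha
    simp only [mem_ofPred_eq, map_smul, Submodule.coe_smul, Pi.smul_apply] at *
    rw [ha]

/-- `𝒟₁ = {(u,g,f) ∈ 𝒟 : u(0) = g(0) and g'(0) = u''(0) + f(0,0)}`. -/
def D1 : Submodule ℂ Data where
  carrier := {d | (uData d : ℝ → ℂ) 0 = (gData d : ℝ → ℂ) 0 ∧
    halfDeriv 1 0 le_rfl (gData d) =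
      halfDeriv 2 0 le_rfl (uData d) + (fData d : ℝ × ℝ → ℂ) (0, 0)}
  zero_mem' := by simp
  add_mem' := by
    intro a b ha hb
    simp only [mem_ofPred_eq, map_add, Submodule.coe_add, Pi.add_apply] at *
    refine ⟨by rw [ha.1, hb.1], ?_⟩
    rw [ha.2, hb.2]
    ring
  smul_mem' := by
    intro c a ha
    simp only [mem_ofPred_eq, map_smul, Submodule.coe_smul, Pi.smul_apply] at *
    refine ⟨by rw [ha.1], ?_⟩
    rw [ha.2, smul_add]

end HalfLineHeat

end

/-!
`Φ` is the solution operator of the Dirichlet problem `h_t = h_xx + f`, `h(x, 0) = u`, `h(0, t) = g`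
on the quarter-plane. The proof replaces the contour integrals by heat potentials and reads all the
claims off from these.

*From contour integrals to potentials.* The contour `γ` can be rotated to the real line
(`integral_heatExp_rotate`), so that the integral over `γ` of the heat exponential `e^{iλz - λ²s}` is a
multiple of the heat kernel (`gammaIntegral_heatExp`), and that of `λ e^{iλz - λ²s}` is a multiple of
the space derivative of the kernel (`gammaIntegral_heatExp_mul`). With Fubini, the integrals in the
definition of `Φ` become the heat semigroup with odd reflection `heatP (-1) u`, the double layer
potential `layer1 g` and the Duhamel integral `heatW (-1) f` (`opI0_eq_heatP`, `opI1_eq_layer1`,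
`opI2_eq_heatW`), and `√(4π) Φ(u, g, f)` is their sum on `Q` (`Phi_eq_solutionOp`).

*Away from the corner.* `IsHeatOp` is the class of operators generated by such potentials and by heat
kernels with pole at the origin. It is closed under both partial derivatives
(`IsHeatOp.exists_deriv`), its members are continuous up to the boundary away from the origin
(`IsHeatOp.continuousOn`), and they satisfy weighted bounds on the sets `Λ_n`
(`IsHeatOp.exists_bound`). Hence they map continuously into `𝒮₁(Q̄ − {(0,0)})`
(`IsHeatOp.exists_S1Qpunct_map`); no compatibility condition is needed for this.

*At the corner.* If `u(0) = g(0)`, then the jump of the odd extension of `u` is compensated by the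
double layer potential, and `Φ(u, g, f)` is continuous on `Q̄` (`continuousWithinAt_heatP_add_layer1`).
Moreover the heat kernels that arise from differentiation cancel: the space derivative of the solution
of the Dirichlet problem solves a Neumann problem, whose solution is always continuous on `Q̄`, the
space derivative of the latter solves a Dirichlet problem again, and the time derivative solves a
Dirichlet problem (`hasDerivAt_dirichletOp_space`, `hasDerivAt_neumannOp_space`,
`hasDerivAt_dirichletOp_time`). The condition `g'(0) = u''(0) + f(0, 0)` is just the compatibility of
the data of the Dirichlet problems for `h_xx` and for `h_t`. This gives continuity of `h`, `h_x`, and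
under the second condition of `h_xx`, `h_xxx` and `h_t`, on the closed quarter-plane
(`exists_Ckl_one_zero_map`, `exists_Ckl_three_one_map`). By the fundamental theorem of calculus these
are derivatives up to the boundary (`hasDerivWithinAt_of_continuousOn_Qbar`).

*Continuity of the operators.* All the data are treated as families that depend linearly on a point `d`
of a topological vector space and are bounded by continuous seminorms of `d` (`SchwartzJet`,
`SmoothJet`, `StripJet`). Every bound on a potential is then a bound by a continuous seminorm, which for
linear maps is continuity. The same bounds show that the compatibility conditions are closed.
-/


noncomputable section

namespace HalfLineHeat

/-! ### Gaussian bounds -/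

/-- The Gaussian `exp (-z² / 4)`, without its normalizing constant. -/
def gker (z : ℝ) : ℝ := Real.exp (-(z ^ 2 / 4))

theorem gker_pos (z : ℝ) : 0 < gker z := Real.exp_pos _

theorem continuous_gker : Continuous gker := by unfold gker; fun_prop

theorem exists_pow_mul_gker_le (q : ℕ) : ∃ C > 0, ∀ z : ℝ, (1 + |z|) ^ q * gker z ≤ C := by
  refine ⟨(q.factorial : ℝ) * Real.exp 2, by positivity, fun z => ?_⟩
  have h3 := Real.pow_div_factorial_le_exp (1 + |z|) (by positivity) q
  rw [div_le_iff₀ (by positivity)] at h3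
  calc (1 + |z|) ^ q * gker z ≤ (Real.exp (1 + |z|) * q.factorial) * gker z := by
        gcongr
        exact (gker_pos z).le
    _ = q.factorial * Real.exp (1 + |z| - z ^ 2 / 4) := by
        rw [gker, sub_eq_add_neg, Real.exp_add _ (-(z ^ 2 / 4))]; ring
    _ ≤ q.factorial * Real.exp 2 := by
        gcongr
        nlinarith [sq_nonneg (|z| / 2 - 1), sq_abs z]

theorem integrable_pow_mul_gker (q : ℕ) : Integrable fun z : ℝ => (1 + |z|) ^ q * gker z := by
  obtain ⟨C, -, hC⟩ := exists_pow_mul_gker_le (q + 2)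
  refine (integrable_inv_one_add_sq.const_mul C).mono'
    (((continuous_const.add continuous_abs).pow q).mul continuous_gker).aestronglyMeasurable
    (ae_of_all _ fun z => ?_)
  rw [Real.norm_of_nonneg (mul_nonneg (by positivity) (gker_pos z).le), ← div_eq_mul_inv,
    le_div_iff₀ (by positivity)]
  refine le_trans ?_ (hC z)
  have : 1 + z ^ 2 ≤ (1 + |z|) ^ 2 := by nlinarith [sq_abs z, abs_nonneg z]
  calc (1 + |z|) ^ q * gker z * (1 + z ^ 2) ≤ (1 + |z|) ^ q * gker z * (1 + |z|) ^ 2 :=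
        mul_le_mul_of_nonneg_left this (mul_nonneg (by positivity) (gker_pos z).le)
    _ = _ := by ring

theorem integrable_gker : Integrable gker := by
  simpa using integrable_pow_mul_gker 0

/-! ### Functions of heat kernel type -/

/-- `x^b t^{-m/2} exp (-x² / (4t))`; the value at `t = 0` is `0` if `m ≥ 1`. The family is closed
under differentiation, and `hk 0 1` is the heat kernel without its normalizing constant. -/
def hk (b m : ℕ) (x t : ℝ) : ℝ := x ^ b * (√t)⁻¹ ^ m * Real.exp (-(x ^ 2 / (4 * t)))

theorem hk_zero_right (b m : ℕ) (x : ℝ) : hk b (m + 1) x 0 = 0 := by simp [hk]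

theorem hk_eq_gker {t : ℝ} (ht : 0 < t) (b m : ℕ) (x : ℝ) :
    hk b m x t = x ^ b * (√t)⁻¹ ^ m * gker (x / √t) := by
  rw [hk, gker, div_pow, Real.sq_sqrt ht.le]
  congr 3
  field_simp

/-- Away from the origin the functions `hk b m` decrease rapidly, uniformly in `t ≤ T`. -/
theorem exists_hk_le (b m n : ℕ) {δ : ℝ} (hδ : 0 < δ) (T : ℝ) : ∃ C > 0, ∀ x t : ℝ, 0 < t → t ≤ T →
    (δ ≤ |x| ∨ δ ≤ t) → (1 + |x|) ^ n * |hk b m x t| ≤ C := by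
  obtain ⟨G, hG, hGz⟩ := exists_pow_mul_gker_le (n + b + m)
  set A : ℝ := (1 + 1 / δ) ^ (n + b) * (√T) ^ (n + b) * δ⁻¹ ^ m * G with hA
  set B : ℝ := (1 + √T) ^ (n + b) * (√δ)⁻¹ ^ m * G with hB
  have hA0 : 0 ≤ A := by positivity
  have hB0 : 0 ≤ B := by positivity
  refine ⟨A + B + 1, by positivity, fun x t ht htT hx => ?_⟩
  have hs : 0 < √t := Real.sqrt_pos.2 ht
  have hsT : √t ≤ √T := Real.sqrt_le_sqrt htT
  set z := x / √t with hz
  have hxz : |x| = √t * |z| := by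
    rw [hz, abs_div, abs_of_pos hs]; field_simp
  have hgk := (gker_pos z).le
  have key : (1 + |x|) ^ n * |hk b m x t| ≤ (1 + |x|) ^ (n + b) * (√t)⁻¹ ^ m * gker z := by
    rw [hk_eq_gker ht, abs_mul, abs_mul, abs_of_nonneg hgk, abs_pow, abs_pow,
      abs_of_pos (inv_pos.2 hs), pow_add]
    have : |x| ^ b ≤ (1 + |x|) ^ b := by gcongr; linarith
    calc (1 + |x|) ^ n * (|x| ^ b * (√t)⁻¹ ^ m * gker z)
        = |x| ^ b * ((1 + |x|) ^ n * ((√t)⁻¹ ^ m * gker z)) := by ring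
      _ ≤ (1 + |x|) ^ b * ((1 + |x|) ^ n * ((√t)⁻¹ ^ m * gker z)) :=
        mul_le_mul_of_nonneg_right this (by positivity)
      _ = _ := by ring
  refine key.trans ?_
  -- with `z = x / √t`: if `δ ≤ |x|` then `1 / √t ≤ |z| / δ`, and if `δ ≤ t` then `1 / √t ≤ 1 / √δ`;
  -- the powers of `1 + |z|` are absorbed by the Gaussian
  rcases hx with hx | hx
  · have hx0 : 0 < |x| := hδ.trans_le hx
    have h1 : 1 + |x| ≤ (1 + 1 / δ) * √T * (1 + |z|) := by
      have : 1 + |x| ≤ (1 + 1 / δ) * |x| := by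
        have : 1 ≤ 1 / δ * |x| := by rw [one_div_mul_eq_div, one_le_div hδ]; exact hx
        linarith
      refine this.trans ?_
      rw [hxz, mul_assoc]
      gcongr
      linarith
    have h2 : (√t)⁻¹ ≤ δ⁻¹ * (1 + |z|) := by
      have : (√t)⁻¹ = |z| / |x| := by rw [hxz]; field_simp [(abs_pos.2 (by
        rintro h; rw [h] at hxz; simp at hxz; exact hx0.ne' (by simp [hxz])) : (0:ℝ) < |z|).ne']
      rw [this, div_le_iff₀ hx0]
      have h3 : 1 ≤ δ⁻¹ * |x| := by rw [inv_mul_eq_div, one_le_div hδ]; exact hx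
      calc |z| ≤ 1 * (1 + |z|) := by linarith
        _ ≤ δ⁻¹ * |x| * (1 + |z|) := by gcongr
        _ = _ := by ring
    have : (1 + |x|) ^ (n + b) * (√t)⁻¹ ^ m * gker z ≤ A := by
      calc (1 + |x|) ^ (n + b) * (√t)⁻¹ ^ m * gker z
          ≤ ((1 + 1 / δ) * √T * (1 + |z|)) ^ (n + b) * (δ⁻¹ * (1 + |z|)) ^ m * gker z := by
            gcongr
        _ = (1 + 1 / δ) ^ (n + b) * (√T) ^ (n + b) * δ⁻¹ ^ m *
            ((1 + |z|) ^ (n + b + m) * gker z) := by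
          rw [mul_pow, mul_pow, mul_pow, pow_add (1 + |z|) (n + b) m]; ring
        _ ≤ A := by rw [hA]; gcongr; exact hGz z
    linarith
  · have h1 : 1 + |x| ≤ (1 + √T) * (1 + |z|) := by
      rw [hxz]
      nlinarith [mul_le_mul_of_nonneg_right hsT (abs_nonneg z), abs_nonneg z, Real.sqrt_nonneg T]
    have h2 : (√t)⁻¹ ≤ (√δ)⁻¹ := by
      have := Real.sqrt_pos.2 hδ
      gcongr
    have h3 : (1 + |z|) ^ (n + b) ≤ (1 + |z|) ^ (n + b + m) :=
      pow_le_pow_right₀ (by linarith [abs_nonneg z]) (by omega)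
    have : (1 + |x|) ^ (n + b) * (√t)⁻¹ ^ m * gker z ≤ B := by
      calc (1 + |x|) ^ (n + b) * (√t)⁻¹ ^ m * gker z
          ≤ ((1 + √T) * (1 + |z|)) ^ (n + b) * (√δ)⁻¹ ^ m * gker z := by gcongr
        _ = (1 + √T) ^ (n + b) * (√δ)⁻¹ ^ m * ((1 + |z|) ^ (n + b) * gker z) := by
          rw [mul_pow]; ring
        _ ≤ (1 + √T) ^ (n + b) * (√δ)⁻¹ ^ m * ((1 + |z|) ^ (n + b + m) * gker z) := by gcongr
        _ ≤ B := by rw [hB]; gcongr; exact hGz z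
    linarith

theorem exists_abs_hk_le (b m : ℕ) {δ : ℝ} (hδ : 0 < δ) (T : ℝ) : ∃ C > 0, ∀ x t : ℝ, 0 < t →
    t ≤ T → (δ ≤ |x| ∨ δ ≤ t) → |hk b m x t| ≤ C := by
  simpa using exists_hk_le b m 0 hδ T

theorem continuousAt_hk_of_pos (b m : ℕ) {p : ℝ × ℝ} (hp : 0 < p.2) :
    ContinuousAt (fun q : ℝ × ℝ => hk b m q.1 q.2) p := by
  unfold hk
  have h1 : √p.2 ≠ 0 := (Real.sqrt_pos.2 hp).ne'
  have h2 : (4 * p.2) ≠ 0 := by positivity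
  have h3 : ContinuousAt (fun q : ℝ × ℝ => √q.2) p := by fun_prop
  exact ((continuousAt_fst.pow b).mul ((h3.inv₀ h1).pow m)).mul
    (Real.continuous_exp.continuousAt.comp
      ((continuousAt_fst.pow 2).div (continuousAt_const.mul continuousAt_snd) h2).neg)

/-- The heat kernels vanish continuously at `t = 0`, `x ≠ 0`. -/
theorem continuousWithinAt_hk (b m : ℕ) {p : ℝ × ℝ} (hp : p ∈ {q : ℝ × ℝ | 0 ≤ q.2})
    (h0 : p.1 ≠ 0 ∨ p.2 ≠ 0) :
    ContinuousWithinAt (fun q : ℝ × ℝ => hk b (m + 1) q.1 q.2) {q | 0 ≤ q.2} p := by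
  rcases (show 0 ≤ p.2 from hp).lt_or_eq with h | h
  · exact (continuousAt_hk_of_pos b _ h).continuousWithinAt
  have hx : p.1 ≠ 0 := by
    rcases h0 with h0 | h0
    · exact h0
    · exact absurd h.symm h0
  obtain ⟨C, hC, hb⟩ := exists_abs_hk_le b (m + 2) (half_pos (abs_pos.2 hx)) 1
  rw [ContinuousWithinAt, ← h, hk_zero_right]
  -- `|hk b (m + 1)| = √t |hk b (m + 2)|`, and the second factor is bounded.
  have h1 : ∀ᶠ q : ℝ × ℝ in 𝓝[{q | 0 ≤ q.2}] p, ‖hk b (m + 1) q.1 q.2‖ ≤ √q.2 * C := by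
    have e1 : ∀ᶠ q : ℝ × ℝ in 𝓝 p, |p.1| / 2 < |q.1| :=
      (continuous_fst.abs.tendsto p).eventually (lt_mem_nhds (half_lt_self (abs_pos.2 hx)))
    have e2 : ∀ᶠ q : ℝ × ℝ in 𝓝 p, q.2 < 1 :=
      (continuous_snd.tendsto p).eventually (gt_mem_nhds (by rw [← h]; exact one_pos))
    filter_upwards [nhdsWithin_le_nhds e1, nhdsWithin_le_nhds e2, self_mem_nhdsWithin]
      with q q1 q2 q3
    rcases (show 0 ≤ q.2 from q3).lt_or_eq with hq | hq
    · have hs : 0 < √q.2 := Real.sqrt_pos.2 hq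
      have : hk b (m + 1) q.1 q.2 = √q.2 * hk b (m + 2) q.1 q.2 := by
        rw [hk, hk, pow_succ _ (m + 1)]; field_simp
      rw [this, norm_mul, Real.norm_of_nonneg hs.le]
      gcongr
      exact hb _ _ hq q2.le (Or.inl q1.le)
    · rw [← hq, hk_zero_right]; simp
  refine squeeze_zero_norm' h1 ?_
  have : Tendsto (fun q : ℝ × ℝ => √q.2 * C) (𝓝 p) (𝓝 (√p.2 * C)) :=
    ((Real.continuous_sqrt.comp continuous_snd).mul continuous_const).tendsto p
  rw [← h] at this
  simpa using this.mono_left nhdsWithin_le_nhds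

theorem hasDerivAt_hk_space (b m : ℕ) {x t : ℝ} (ht : 0 < t) :
    HasDerivAt (fun y => hk b m y t) (b * hk (b - 1) m x t - hk (b + 1) (m + 2) x t / 2) x := by
  have h1 : HasDerivAt (fun y : ℝ => Real.exp (-(y ^ 2 / (4 * t))))
      (Real.exp (-(x ^ 2 / (4 * t))) * -((2 * x) / (4 * t))) x := by
    simpa using (((hasDerivAt_pow 2 x).div_const (4 * t)).neg).exp
  have h2 := ((hasDerivAt_pow b x).mul_const ((√t)⁻¹ ^ m)).mul h1
  refine h2.congr_deriv ?_
  rw [hk, hk, pow_succ _ (m + 1), pow_succ _ m]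
  have : (√t)⁻¹ * (√t)⁻¹ = t⁻¹ := by rw [← mul_inv, Real.mul_self_sqrt ht.le]
  rw [mul_assoc _ (√t)⁻¹ (√t)⁻¹, this]
  field_simp
  ring

theorem hasDerivAt_hk_time (b m : ℕ) {x t : ℝ} (ht : 0 < t) :
    HasDerivAt (fun s => hk b m x s) (-(m / 2 * hk b (m + 2) x t) + hk (b + 2) (m + 4) x t / 4) t := by
  have hs : 0 < √t := Real.sqrt_pos.2 ht
  have h1 : HasDerivAt (fun s : ℝ => Real.exp (-(x ^ 2 / (4 * s))))
      (Real.exp (-(x ^ 2 / (4 * t))) * (x ^ 2 / (4 * t ^ 2))) t := by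
    have h0 : HasDerivAt (fun s : ℝ => -(x ^ 2 / (4 * s))) (x ^ 2 / (4 * t ^ 2)) t := by
      have := ((hasDerivAt_const t (x ^ 2)).fun_div ((hasDerivAt_id' t).const_mul 4)
        (by positivity)).fun_neg
      refine this.congr_deriv ?_
      field_simp
      ring
    exact h0.exp
  have h2 : HasDerivAt (fun s : ℝ => (√s)⁻¹ ^ m) (-(m / 2 * (√t)⁻¹ ^ (m + 2))) t := by
    have := ((Real.hasDerivAt_sqrt ht.ne').inv hs.ne').pow m
    refine this.congr_deriv ?_
    rcases m with _ | m
    · simp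
    · simp only [Nat.add_sub_cancel]
      push_cast
      simp only [inv_pow, pow_succ, Pi.inv_apply]
      field_simp
  have h3 := (h2.const_mul (x ^ b)).mul h1
  refine h3.congr_deriv ?_
  have : t = √t ^ 2 := (Real.sq_sqrt ht.le).symm
  simp only [hk]
  have e4 : (√t)⁻¹ ^ (m + 4) = (√t)⁻¹ ^ m / t ^ 2 := by
    rw [pow_add, div_eq_mul_inv]
    congr 1
    rw [inv_pow]
    congr 1
    conv_rhs => rw [this]
    ring
  rw [e4]
  field_simp
  ring

theorem hasDerivAt_hk01 {x t : ℝ} (ht : 0 < t) : HasDerivAt (fun y => hk 0 1 y t) (-(hk 1 3 x t / 2)) x := by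
  simpa using hasDerivAt_hk_space 0 1 (x := x) ht

/-! ### The heat semigroup on the half-line -/

/-- Continuous functions on `[0, ∞)` that are `O((1 + y)⁻²)`. -/
structure Decaying (φ : ℝ → ℂ) : Prop where
  cont : ContinuousOn φ (Ici 0)
  bound : ∃ M, ∀ y, 0 ≤ y → (1 + y) ^ 2 * ‖φ y‖ ≤ M

theorem continuous_comp_abs {φ : ℝ → ℂ} (hφ : ContinuousOn φ (Ici 0)) :
    Continuous fun y => φ |y| :=
  hφ.comp_continuous continuous_abs abs_nonneg

namespace Decaying

variable {φ : ℝ → ℂ}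

theorem exists_norm_le (h : Decaying φ) : ∃ M, ∀ y, 0 ≤ y → ‖φ y‖ ≤ M := by
  obtain ⟨M, hM⟩ := h.bound
  refine ⟨M, fun y hy => le_trans ?_ (hM y hy)⟩
  exact le_mul_of_one_le_left (norm_nonneg _) (one_le_pow₀ (by linarith))

theorem exists_norm_le_inv (h : Decaying φ) : ∃ M, ∀ y, 0 ≤ y → ‖φ y‖ ≤ M * (1 + y ^ 2)⁻¹ := by
  obtain ⟨M, hM⟩ := h.bound
  refine ⟨M, fun y hy => ?_⟩
  rw [← div_eq_mul_inv, le_div_iff₀ (by positivity), mul_comm]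
  refine le_trans ?_ (hM y hy)
  gcongr
  nlinarith

theorem integrableOn (h : Decaying φ) : IntegrableOn φ (Ioi 0) := by
  obtain ⟨M, hM⟩ := h.exists_norm_le_inv
  refine Integrable.mono' (integrable_inv_one_add_sq.const_mul M).integrableOn
    ((h.cont.mono Ioi_subset_Ici_self).aestronglyMeasurable measurableSet_Ioi) ?_
  filter_upwards [ae_restrict_mem measurableSet_Ioi] with y hy using hM y (le_of_lt hy)

theorem tendsto_atTop (h : Decaying φ) : Tendsto φ atTop (𝓝 0) := by
  obtain ⟨M, hM⟩ := h.bound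
  have h1 : Tendsto (fun y : ℝ => M / (1 + y)) atTop (𝓝 0) :=
    tendsto_const_nhds.div_atTop (tendsto_atTop_add_const_left _ _ tendsto_id)
  refine squeeze_zero_norm' ?_ h1
  filter_upwards [eventually_ge_atTop 0] with y hy
  rw [le_div_iff₀ (by positivity), mul_comm]
  refine le_trans ?_ (hM y hy)
  gcongr
  nlinarith

end Decaying

/-- The weight `1` on `[0, ∞)` and `σ` on `(-∞, 0)`; `σ = 1` and `σ = -1` give the even and the odd
extension of a function on `[0, ∞)`. -/
def sgf (σ y : ℝ) : ℝ := if 0 ≤ y then 1 else σ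

theorem abs_sgf_le {σ : ℝ} (hσ : |σ| ≤ 1) (y : ℝ) : |sgf σ y| ≤ 1 := by
  unfold sgf; split_ifs <;> simp [hσ]

theorem measurable_sgf (σ : ℝ) : Measurable (sgf σ) :=
  Measurable.ite measurableSet_Ici measurable_const measurable_const

theorem continuousAt_sgf {σ y : ℝ} (h : y ≠ 0 ∨ σ = 1) : ContinuousAt (sgf σ) y := by
  by_cases hσ : σ = 1
  · have : sgf σ = fun _ => 1 := by ext z; simp [sgf, hσ]
    rw [this]; exact continuousAt_const
  rcases (h.resolve_right hσ).lt_or_gt with h | h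
  · refine (continuousAt_const (y := σ)).congr ?_
    filter_upwards [gt_mem_nhds h] with z hz
    simp [sgf, not_le.2 hz]
  · refine (continuousAt_const (y := (1 : ℝ))).congr ?_
    filter_upwards [lt_mem_nhds h] with z hz
    simp [sgf, le_of_lt hz]

/-- The solution at time `t` of the heat equation on the half-line with initial values `φ`, for the
Neumann (`σ = 1`) or Dirichlet (`σ = -1`) boundary condition, times `√(4π)`. Scaling the variable of
integration makes the formula meaningful up to `t = 0`. -/
def heatP (σ : ℝ) (φ : ℝ → ℂ) (x t : ℝ) : ℂ :=
  ∫ z, (gker z * sgf σ (x - √t * z)) • φ |x - √t * z|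

theorem aestronglyMeasurable_heatP (σ : ℝ) {φ : ℝ → ℂ} (hφ : ContinuousOn φ (Ici 0)) (x t : ℝ) :
    AEStronglyMeasurable fun z => (gker z * sgf σ (x - √t * z)) • φ |x - √t * z| := by
  have h1 : Continuous fun z => x - √t * z := by fun_prop
  exact (continuous_gker.measurable.mul ((measurable_sgf σ).comp h1.measurable)).aestronglyMeasurable.smul
    ((continuous_comp_abs hφ).comp h1).aestronglyMeasurable

theorem norm_heatP_integrand_le {σ : ℝ} (hσ : |σ| ≤ 1) (φ : ℝ → ℂ) (y z : ℝ) :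
    ‖(gker z * sgf σ y) • φ |y|‖ ≤ gker z * ‖φ |y|‖ := by
  rw [norm_smul, norm_mul, Real.norm_of_nonneg (gker_pos z).le, Real.norm_eq_abs]
  have := abs_sgf_le hσ y
  have := (gker_pos z).le
  gcongr
  exact mul_le_of_le_one_right this (abs_sgf_le hσ y)

theorem integrable_heatP {σ : ℝ} (hσ : |σ| ≤ 1) {φ : ℝ → ℂ} (hφ : ContinuousOn φ (Ici 0))
    (hb : ∃ M, ∀ y, 0 ≤ y → ‖φ y‖ ≤ M) (x t : ℝ) :
    Integrable fun z => (gker z * sgf σ (x - √t * z)) • φ |x - √t * z| := by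
  obtain ⟨M, hM⟩ := hb
  refine (integrable_gker.mul_const M).mono' (aestronglyMeasurable_heatP σ hφ x t)
    (ae_of_all _ fun z => (norm_heatP_integrand_le hσ φ _ z).trans ?_)
  exact mul_le_mul_of_nonneg_left (hM _ (abs_nonneg _)) (gker_pos z).le

/-- Weighted bounds for the heat semigroup. -/
theorem exists_heatP_le (n : ℕ) (T : ℝ) : ∃ C > 0, ∀ {σ : ℝ}, |σ| ≤ 1 → ∀ {φ : ℝ → ℂ} {M : ℝ},
    (∀ y, 0 ≤ y → (1 + y) ^ n * ‖φ y‖ ≤ M) → ∀ x t : ℝ, t ≤ T →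
    (1 + |x|) ^ n * ‖heatP σ φ x t‖ ≤ C * M := by
  have hI := (integrable_pow_mul_gker n).const_mul ((1 + √T) ^ n)
  refine ⟨(∫ z, (1 + √T) ^ n * ((1 + |z|) ^ n * gker z)) + 1, ?_, ?_⟩
  · have : 0 ≤ ∫ z, (1 + √T) ^ n * ((1 + |z|) ^ n * gker z) :=
      integral_nonneg fun z => by have := (gker_pos z).le; positivity
    linarith
  intro σ hσ φ M hM x t htT
  have hM0 : 0 ≤ M := le_trans (by positivity) (hM 0 le_rfl)
  have hsT : √t ≤ √T := Real.sqrt_le_sqrt htT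
  -- `1 + |x| ≤ (1 + √T) (1 + |z|) (1 + |x - √t z|)`
  have key : ∀ z, (1 + |x|) ^ n * ‖(gker z * sgf σ (x - √t * z)) • φ |x - √t * z|‖ ≤
      (1 + √T) ^ n * ((1 + |z|) ^ n * gker z) * M := by
    intro z
    have hg := (gker_pos z).le
    have h1 : 1 + |x| ≤ (1 + √T) * (1 + |z|) * (1 + |x - √t * z|) := by
      have a1 : |x| ≤ |x - √t * z| + √t * |z| := by
        calc |x| = |(x - √t * z) + √t * z| := by ring_nf
          _ ≤ _ := (abs_add_le _ _).trans (by rw [abs_mul, abs_of_nonneg (Real.sqrt_nonneg t)])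
      have a2 : √t * |z| ≤ √T * |z| := by gcongr
      have := abs_nonneg (x - √t * z)
      have := abs_nonneg z
      have := Real.sqrt_nonneg T
      have a3 : 1 + √T * |z| ≤ (1 + √T) * (1 + |z|) := by nlinarith
      have a4 : 1 ≤ (1 + √T) * (1 + |z|) := by nlinarith [mul_nonneg (Real.sqrt_nonneg T) (abs_nonneg z)]
      nlinarith
    calc (1 + |x|) ^ n * ‖(gker z * sgf σ (x - √t * z)) • φ |x - √t * z|‖
        ≤ ((1 + √T) * (1 + |z|) * (1 + |x - √t * z|)) ^ n * (gker z * ‖φ |x - √t * z|‖) := by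
          gcongr
          exact norm_heatP_integrand_le hσ φ _ z
      _ = (1 + √T) ^ n * ((1 + |z|) ^ n * gker z) * ((1 + |x - √t * z|) ^ n * ‖φ |x - √t * z|‖) := by
          rw [mul_pow, mul_pow]; ring
      _ ≤ _ := by
          gcongr
          exact hM _ (abs_nonneg _)
  have hx : (0 : ℝ) < (1 + |x|) ^ n := by positivity
  have h2 : ‖heatP σ φ x t‖ ≤ ∫ z, ((1 + |x|) ^ n)⁻¹ * ((1 + √T) ^ n * ((1 + |z|) ^ n * gker z) * M) := by
    refine norm_integral_le_of_norm_le ((hI.mul_const M).const_mul _) (ae_of_all _ fun z => ?_)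
    rw [← div_eq_inv_mul, le_div_iff₀ hx, mul_comm]
    exact key z
  rw [integral_const_mul, integral_mul_const] at h2
  calc (1 + |x|) ^ n * ‖heatP σ φ x t‖ ≤ (1 + |x|) ^ n * _ := mul_le_mul_of_nonneg_left h2 hx.le
    _ = (∫ z, (1 + √T) ^ n * ((1 + |z|) ^ n * gker z)) * M := by field_simp
    _ ≤ _ := by linarith

theorem exists_norm_heatP_le (T : ℝ) : ∃ C > 0, ∀ {σ : ℝ}, |σ| ≤ 1 → ∀ {φ : ℝ → ℂ} {M : ℝ},
    (∀ y, 0 ≤ y → ‖φ y‖ ≤ M) → ∀ x t : ℝ, t ≤ T → ‖heatP σ φ x t‖ ≤ C * M := by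
  simpa using exists_heatP_le 0 T

theorem heatP_add {σ : ℝ} (hσ : |σ| ≤ 1) {φ ψ : ℝ → ℂ} (hφ : ContinuousOn φ (Ici 0))
    (hψ : ContinuousOn ψ (Ici 0)) (hφb : ∃ M, ∀ y, 0 ≤ y → ‖φ y‖ ≤ M)
    (hψb : ∃ M, ∀ y, 0 ≤ y → ‖ψ y‖ ≤ M) (x t : ℝ) :
    heatP σ (fun y => φ y + ψ y) x t = heatP σ φ x t + heatP σ ψ x t := by
  unfold heatP
  rw [← integral_add (integrable_heatP hσ hφ hφb x t) (integrable_heatP hσ hψ hψb x t)]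
  simp only [smul_add]

theorem heatP_const_mul (σ : ℝ) (c : ℂ) (φ : ℝ → ℂ) (x t : ℝ) :
    heatP σ (fun y => c * φ y) x t = c * heatP σ φ x t := by
  unfold heatP
  rw [← integral_const_mul]
  simp only [mul_smul_comm]

/-- Almost no `z` lies on the characteristic `x = s z`, where the reflected initial values jump. -/
theorem ae_sub_mul_ne_zero {x s : ℝ} (h : x ≠ 0 ∨ s ≠ 0) : ∀ᵐ z : ℝ, x - s * z ≠ 0 := by
  have : {z : ℝ | ¬ (x - s * z ≠ 0)} ⊆ {x / s} := by
    intro z hz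
    simp only [ne_eq, not_not, mem_ofPred_eq] at hz
    have hs : s ≠ 0 := by
      rcases h with h | h
      · rintro rfl; exact h (by simpa using hz)
      · exact h
    rw [mem_singleton_iff, eq_div_iff hs]
    linarith
  exact measure_mono_null this (measure_singleton _)

/-- Joint continuity of `heatP` for initial values that depend on a parameter `r ≥ 0`. -/
theorem continuousWithinAt_heatP_param {σ : ℝ} (hσ : |σ| ≤ 1) {h : ℝ → ℝ → ℂ}
    (hc : ContinuousOn (fun p : ℝ × ℝ => h p.1 p.2) (Ici 0 ×ˢ Ici 0))
    (hb : ∀ T, ∃ M, ∀ y, 0 ≤ y → ∀ r, 0 ≤ r → r ≤ T → ‖h y r‖ ≤ M) {q : ℝ × ℝ × ℝ}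
    (hq : 0 ≤ q.2.2) (h0 : q.1 ≠ 0 ∨ √q.2.1 ≠ 0 ∨ σ = 1) :
    ContinuousWithinAt (fun q : ℝ × ℝ × ℝ => heatP σ (fun y => h y q.2.2) q.1 q.2.1)
      {q | 0 ≤ q.2.2} q := by
  obtain ⟨M, hM⟩ := hb (q.2.2 + 1)
  have hr : ∀ᶠ p : ℝ × ℝ × ℝ in 𝓝[{q | 0 ≤ q.2.2}] q, p.2.2 ≤ q.2.2 + 1 := by
    have : Continuous fun p : ℝ × ℝ × ℝ => p.2.2 := by fun_prop
    exact nhdsWithin_le_nhds ((this.tendsto q).eventually (Iic_mem_nhds (lt_add_one _)))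
  refine continuousWithinAt_of_dominated (bound := fun z => gker z * M) ?_ ?_
    (integrable_gker.mul_const M) ?_
  · filter_upwards [self_mem_nhdsWithin] with p hp
    exact aestronglyMeasurable_heatP σ
      (hc.comp (f := fun y => (y, p.2.2)) (s := Ici 0) (by fun_prop) fun y hy => ⟨hy, hp⟩) _ _
  · filter_upwards [self_mem_nhdsWithin, hr] with p hp hp'
    refine ae_of_all _ fun z => (norm_heatP_integrand_le hσ (fun y => h y p.2.2) _ z).trans ?_
    exact mul_le_mul_of_nonneg_left (hM _ (abs_nonneg _) _ hp hp') (gker_pos z).le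
  · have hae : ∀ᵐ z : ℝ, q.1 - √q.2.1 * z ≠ 0 ∨ σ = 1 := by
      by_cases hσ1 : σ = 1
      · exact ae_of_all _ fun _ => Or.inr hσ1
      · have : q.1 ≠ 0 ∨ √q.2.1 ≠ 0 := by tauto
        exact (ae_sub_mul_ne_zero this).mono fun z hz => Or.inl hz
    filter_upwards [hae] with z hz
    have e1 : ContinuousAt (fun p : ℝ × ℝ × ℝ => p.1 - √p.2.1 * z) q := by fun_prop
    have e2 : ContinuousAt (fun p : ℝ × ℝ × ℝ => sgf σ (p.1 - √p.2.1 * z)) q :=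
      ContinuousAt.comp (f := fun p : ℝ × ℝ × ℝ => p.1 - √p.2.1 * z) (continuousAt_sgf hz) e1
    have e3 : ContinuousWithinAt (fun p : ℝ × ℝ × ℝ => h |p.1 - √p.2.1 * z| p.2.2)
        {q | 0 ≤ q.2.2} q := by
      refine ContinuousWithinAt.comp (t := Ici 0 ×ˢ Ici 0)
        (f := fun p : ℝ × ℝ × ℝ => (|p.1 - √p.2.1 * z|, p.2.2))
        (hc _ ⟨abs_nonneg (_ : ℝ), hq⟩) ?_ fun p hp => ⟨abs_nonneg (_ : ℝ), hp⟩
      · exact (ContinuousAt.prodMk e1.abs (by fun_prop)).continuousWithinAt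
    exact (continuousAt_const.mul e2).continuousWithinAt.smul e3

theorem continuousAt_heatP {σ : ℝ} (hσ : |σ| ≤ 1) {φ : ℝ → ℂ} (hφ : ContinuousOn φ (Ici 0))
    (hb : ∃ M, ∀ y, 0 ≤ y → ‖φ y‖ ≤ M) {p : ℝ × ℝ} (h0 : p.1 ≠ 0 ∨ √p.2 ≠ 0 ∨ σ = 1) :
    ContinuousAt (fun p : ℝ × ℝ => heatP σ φ p.1 p.2) p := by
  have := continuousWithinAt_heatP_param hσ (h := fun y _ => φ y) (q := (p.1, p.2, 0))
    (hφ.comp (by fun_prop) fun q hq => hq.1) (fun T => hb.imp fun M hM y hy _ _ _ => hM y hy)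
    le_rfl h0
  have h2 : ContinuousWithinAt (fun p : ℝ × ℝ => (p.1, p.2, (0 : ℝ))) univ p := by fun_prop
  exact continuousWithinAt_univ _ _ |>.1
    (ContinuousWithinAt.comp (f := fun p : ℝ × ℝ => (p.1, p.2, (0 : ℝ))) this h2
      fun _ _ => le_refl (0 : ℝ))

/-- The integral over `[0, ∞)` of `φ` against an even or odd reflection of the kernel `κ`. -/
def foldInt (σ : ℝ) (κ : ℝ → ℝ) (φ : ℝ → ℂ) (x : ℝ) : ℂ :=
  ∫ y in Ioi (0 : ℝ), (κ (x - y) + σ * κ (x + y)) • φ y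

/-- The substitution `y = x - √t z` gives the heat kernel; then the negative half-line is folded onto the
positive one. -/
theorem heatP_eq_foldInt {σ : ℝ} (hσ : |σ| ≤ 1) {φ : ℝ → ℂ} (hφ : Decaying φ) (x : ℝ) {t : ℝ}
    (ht : 0 < t) : heatP σ φ x t = foldInt σ (fun z => hk 0 1 z t) φ x := by
  have hs : 0 < √t := Real.sqrt_pos.2 ht
  set G : ℝ → ℂ := fun y => (hk 0 1 (x - y) t * sgf σ y) • φ |y| with hG
  have hG1 : ∀ z, (gker z * sgf σ (x - √t * z)) • φ |x - √t * z| = √t • G (x - √t * z) := by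
    intro z
    rw [hG]
    simp only
    rw [smul_smul, hk_eq_gker ht]
    congr 1
    have : (x - (x - √t * z)) / √t = z := by field_simp; ring
    rw [this]
    field_simp
  obtain ⟨C, hC, hCb⟩ := exists_abs_hk_le 0 1 ht t
  obtain ⟨M, hM⟩ := hφ.exists_norm_le_inv
  have hGi : Integrable G := by
    have hk : Continuous fun y => hk 0 1 (x - y) t := by unfold hk; fun_prop
    refine (integrable_inv_one_add_sq.const_mul (C * M)).mono'
      ((hk.measurable.mul (measurable_sgf σ)).aestronglyMeasurable.smul
      (continuous_comp_abs hφ.cont).aestronglyMeasurable) (ae_of_all _ fun y => ?_)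
    have := hM |y| (abs_nonneg y)
    rw [sq_abs] at this
    rw [hG]
    simp only [norm_smul, norm_mul, Real.norm_eq_abs]
    calc _ ≤ (C * 1) * (M * (1 + y ^ 2)⁻¹) := by
          refine mul_le_mul (mul_le_mul (hCb _ _ ht le_rfl (Or.inr le_rfl)) (abs_sgf_le hσ y)
            (abs_nonneg _) hC.le) this (norm_nonneg _) (by linarith)
      _ = _ := by ring
  have hneg := integral_comp_neg_Ioi 0 G
  rw [neg_zero] at hneg
  unfold heatP foldInt
  simp_rw [hG1]
  rw [integral_smul, Measure.integral_comp_mul_left (fun w => G (x - w)) (√t),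
    integral_sub_left_eq_self G volume x, smul_smul, abs_of_pos (inv_pos.2 hs),
    mul_inv_cancel₀ hs.ne', one_smul, ← intervalIntegral.integral_Iic_add_Ioi (b := 0)
    hGi.integrableOn hGi.integrableOn, ← hneg, add_comm,
    ← integral_add hGi.integrableOn (hGi.comp_neg.integrableOn)]
  refine setIntegral_congr_fun measurableSet_Ioi fun y hy => ?_
  have hy : 0 < y := hy
  simp only [hG, abs_neg, abs_of_pos hy, sgf, hy.le, if_true, sub_neg_eq_add]
  rw [if_neg (by linarith), add_smul, mul_one, mul_comm σ]

section FoldInt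

variable {σ : ℝ} {κ κ' : ℝ → ℝ} {φ φ' : ℝ → ℂ}

theorem norm_foldInt_integrand_le (hσ : |σ| ≤ 1) {C : ℝ} (hC : ∀ z, |κ z| ≤ C) (x y : ℝ) (w : ℂ) :
    ‖(κ (x - y) + σ * κ (x + y)) • w‖ ≤ 2 * C * ‖w‖ := by
  rw [norm_smul]
  gcongr
  have h0 : 0 ≤ C := (abs_nonneg _).trans (hC 0)
  calc ‖κ (x - y) + σ * κ (x + y)‖ ≤ |κ (x - y)| + |σ| * |κ (x + y)| := by
        rw [← abs_mul]; exact abs_add_le _ _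
    _ ≤ C + 1 * C := add_le_add (hC _) (mul_le_mul hσ (hC _) (abs_nonneg _) zero_le_one)
    _ = _ := by ring

theorem aestronglyMeasurable_foldInt (hκ : Continuous κ) (hi : IntegrableOn φ (Ioi 0)) (x : ℝ) :
    AEStronglyMeasurable (fun y => (κ (x - y) + σ * κ (x + y)) • φ y)
      (volume.restrict (Ioi 0)) := by
  have : Continuous fun y => κ (x - y) + σ * κ (x + y) := by fun_prop
  exact this.aestronglyMeasurable.smul hi.aestronglyMeasurable

theorem integrableOn_foldInt (hσ : |σ| ≤ 1) (hκ : Continuous κ) {C : ℝ} (hC : ∀ z, |κ z| ≤ C)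
    (hi : IntegrableOn φ (Ioi 0)) (x : ℝ) :
    IntegrableOn (fun y => (κ (x - y) + σ * κ (x + y)) • φ y) (Ioi 0) :=
  (hi.norm.const_mul (2 * C)).mono' (aestronglyMeasurable_foldInt hκ hi x)
    (ae_of_all _ fun y => norm_foldInt_integrand_le hσ hC x y _)

theorem hasDerivAt_foldInt_space (hσ : |σ| ≤ 1) (hκ : ∀ z, HasDerivAt κ (κ' z) z)
    (hκ' : Continuous κ') {C : ℝ} (hC : ∀ z, |κ z| ≤ C) {C' : ℝ} (hC' : ∀ z, |κ' z| ≤ C')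
    (hi : IntegrableOn φ (Ioi 0)) (x : ℝ) :
    HasDerivAt (foldInt σ κ φ) (foldInt σ κ' φ x) x := by
  have hκc : Continuous κ := continuous_iff_continuousAt.2 fun z => (hκ z).continuousAt
  refine (hasDerivAt_integral_of_dominated_loc_of_deriv_le (μ := volume.restrict (Ioi (0 : ℝ)))
    (F := fun x y => (κ (x - y) + σ * κ (x + y)) • φ y)
    (F' := fun x y => (κ' (x - y) + σ * κ' (x + y)) • φ y) (bound := fun y => 2 * C' * ‖φ y‖)
    univ_mem (Eventually.of_forall fun z => aestronglyMeasurable_foldInt hκc hi z)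
    (integrableOn_foldInt hσ hκc hC hi x) (aestronglyMeasurable_foldInt hκ' hi x)
    (ae_of_all _ fun y z _ => norm_foldInt_integrand_le hσ hC' z y _) (hi.norm.const_mul _)
    (ae_of_all _ fun y z _ => ?_)).2
  have h1 : HasDerivAt (fun z => κ (z - y)) (κ' (z - y)) z := (hκ _).comp_sub_const z y
  have h2 : HasDerivAt (fun z => κ (z + y)) (κ' (z + y)) z := (hκ _).comp_add_const z y
  exact (h1.add (h2.const_mul σ)).smul_const (φ y)

/-- Integration by parts: a derivative of the kernel is moved to `φ`, and the parity changes. -/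
theorem foldInt_deriv (hσ : |σ| ≤ 1) (hκ : ∀ z, HasDerivAt κ (κ' z) z) (hκ' : Continuous κ') {C : ℝ}
    (hC : ∀ z, |κ z| ≤ C) {C' : ℝ} (hC' : ∀ z, |κ' z| ≤ C') (hφ : Decaying φ) (hφ' : Decaying φ')
    (hd : ∀ y, 0 ≤ y → HasDerivWithinAt φ (φ' y) (Ici 0) y) (x : ℝ) :
    foldInt σ κ' φ x = ((1 - σ) * κ x) • φ 0 + foldInt (-σ) κ φ' x := by
  have hκc : Continuous κ := continuous_iff_continuousAt.2 fun z => (hκ z).continuousAt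
  have hσ' : |(-σ)| ≤ 1 := by rwa [abs_neg]
  have i1 := integrableOn_foldInt hσ hκ' hC' hφ.integrableOn x
  have i2 := integrableOn_foldInt hσ' hκc hC hφ'.integrableOn x
  have hft := integral_Ioi_of_hasDerivAt_of_tendsto (a := (0 : ℝ)) (m := 0)
    (f := fun y => (κ (x - y) + -σ * κ (x + y)) • φ y)
    (f' := fun y => (κ (x - y) + -σ * κ (x + y)) • φ' y - (κ' (x - y) + σ * κ' (x + y)) • φ y)
    ?_ ?_ (i2.sub i1) ?_
  · rw [integral_sub i2 i1] at hft
    simp only [sub_zero, add_zero, zero_sub] at hft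
    unfold foldInt
    rw [← sub_eq_iff_eq_add, ← neg_sub, hft, neg_neg]
    congr 1; ring
  · have : ContinuousWithinAt φ (Ici 0) 0 := hφ.cont 0 self_mem_Ici
    have h1 : Continuous fun y => κ (x - y) + -σ * κ (x + y) := by fun_prop
    exact h1.continuousWithinAt.smul this
  · intro y hy
    have h1 : HasDerivAt (fun y => κ (x - y)) (-κ' (x - y)) y := (hκ _).comp_const_sub x y
    have h2 : HasDerivAt (fun y => κ (x + y)) (κ' (x + y)) y := (hκ _).comp_const_add x y
    have h3 : HasDerivAt φ (φ' y) y := (hd y (le_of_lt hy)).hasDerivAt (Ici_mem_nhds hy)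
    refine ((h1.add (h2.const_mul (-σ))).smul h3).congr_deriv ?_
    simp only [Pi.add_apply]
    module
  · have := (hφ.tendsto_atTop.norm).const_mul (2 * C)
    rw [norm_zero, mul_zero] at this
    exact squeeze_zero_norm (fun y => norm_foldInt_integrand_le hσ' hC x y _) this

end FoldInt

theorem continuous_hk (b m : ℕ) (t : ℝ) : Continuous fun z => hk b m z t := by
  unfold hk; fun_prop

/-- The second space derivative of `hk 0 1`. -/
def hk01xx (z t : ℝ) : ℝ := -(hk 0 3 z t / 2) + hk 2 5 z t / 4

theorem hasDerivAt_neg_half_hk13 {z t : ℝ} (ht : 0 < t) :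
    HasDerivAt (fun z => -(hk 1 3 z t / 2)) (hk01xx z t) z := by
  refine ((hasDerivAt_hk_space 1 3 ht).div_const 2).neg.congr_deriv ?_
  simp only [hk01xx]
  norm_num
  ring

/-- The heat equation for `hk 0 1`. -/
theorem hasDerivAt_hk01_time {z t : ℝ} (ht : 0 < t) :
    HasDerivAt (fun s => hk 0 1 z s) (hk01xx z t) t := by
  refine (hasDerivAt_hk_time 0 1 ht).congr_deriv ?_
  simp only [hk01xx]
  norm_num
  ring

theorem exists_abs_hk01xx_le {δ : ℝ} (hδ : 0 < δ) (T : ℝ) : ∃ C > 0, ∀ x t : ℝ, 0 < t → t ≤ T →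
    (δ ≤ |x| ∨ δ ≤ t) → |hk01xx x t| ≤ C := by
  obtain ⟨A, hA, hA'⟩ := exists_abs_hk_le 0 3 hδ T
  obtain ⟨B, hB, hB'⟩ := exists_abs_hk_le 2 5 hδ T
  refine ⟨A + B, by positivity, fun x t h1 h2 h3 => ?_⟩
  have ha := abs_le.1 (hA' x t h1 h2 h3)
  have hb := abs_le.1 (hB' x t h1 h2 h3)
  rw [hk01xx, abs_le]
  constructor <;> linarith

section HeatDeriv

variable {σ : ℝ} {φ φ' φ'' : ℝ → ℂ}

/-- Differentiation in space exchanges the odd and the even extension; the odd one contributes the jump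
of the extended initial values at the boundary. -/
theorem hasDerivAt_heatP_space (hσ : |σ| ≤ 1) (hφ : Decaying φ) (hφ' : Decaying φ')
    (hd : ∀ y, 0 ≤ y → HasDerivWithinAt φ (φ' y) (Ici 0) y) (x : ℝ) {t : ℝ} (ht : 0 < t) :
    HasDerivAt (fun x => heatP σ φ x t)
      (((1 - σ) * hk 0 1 x t) • φ 0 + heatP (-σ) φ' x t) x := by
  obtain ⟨A, -, hA⟩ := exists_abs_hk_le 0 1 ht t
  obtain ⟨B, -, hB⟩ := exists_abs_hk_le 1 3 ht t
  have hA' : ∀ z, |hk 0 1 z t| ≤ A := fun z => hA z t ht le_rfl (Or.inr le_rfl)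
  have hB' : ∀ z, |(-(hk 1 3 z t / 2))| ≤ B := fun z => by
    have := abs_le.1 (hB z t ht le_rfl (Or.inr le_rfl))
    rw [abs_le]; constructor <;> linarith
  have hc : Continuous fun z => -(hk 1 3 z t / 2) := ((continuous_hk 1 3 t).div_const 2).neg
  have h := hasDerivAt_foldInt_space hσ (fun z => hasDerivAt_hk01 ht) hc hA' hB' hφ.integrableOn x
  rw [foldInt_deriv hσ (fun z => hasDerivAt_hk01 ht) hc hA' hB' hφ hφ' hd,
    ← heatP_eq_foldInt (by rwa [abs_neg]) hφ' x ht] at h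
  exact h.congr_of_eventuallyEq (Eventually.of_forall fun z => heatP_eq_foldInt hσ hφ z ht)

/-- The time derivative of the kernel is its second space derivative, and two integrations by parts move
it to the initial values. -/
theorem hasDerivAt_heatP_time (hσ : |σ| ≤ 1) (hφ : Decaying φ) (hφ' : Decaying φ')
    (hφ'' : Decaying φ'') (hd : ∀ y, 0 ≤ y → HasDerivWithinAt φ (φ' y) (Ici 0) y)
    (hd' : ∀ y, 0 ≤ y → HasDerivWithinAt φ' (φ'' y) (Ici 0) y) (x : ℝ) {t : ℝ} (ht : 0 < t) :
    HasDerivAt (fun t => heatP σ φ x t)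
      (((1 - σ) * -(hk 1 3 x t / 2)) • φ 0 + ((1 + σ) * hk 0 1 x t) • φ' 0 + heatP σ φ'' x t) t := by
  have hσ' : |(-σ)| ≤ 1 := by rwa [abs_neg]
  obtain ⟨A, -, hA⟩ := exists_abs_hk_le 0 1 (half_pos ht) (2 * t)
  obtain ⟨B, -, hB⟩ := exists_abs_hk_le 1 3 ht t
  obtain ⟨C, -, hC⟩ := exists_abs_hk01xx_le (half_pos ht) (2 * t)
  have hA' : ∀ z, |hk 0 1 z t| ≤ A := fun z => hA z t ht (by linarith) (Or.inr (by linarith))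
  have hB' : ∀ z, |(-(hk 1 3 z t / 2))| ≤ B := fun z => by
    have := abs_le.1 (hB z t ht le_rfl (Or.inr le_rfl))
    rw [abs_le]; constructor <;> linarith
  have hC' : ∀ z, |hk01xx z t| ≤ C := fun z => hC z t ht (by linarith) (Or.inr (by linarith))
  have hc : Continuous fun z => -(hk 1 3 z t / 2) := ((continuous_hk 1 3 t).div_const 2).neg
  have hcc : Continuous fun z => hk01xx z t := by
    unfold hk01xx; have := continuous_hk 0 3 t; have := continuous_hk 2 5 t; fun_prop
  have hmem : Ioo (t / 2) (2 * t) ∈ 𝓝 t := Ioo_mem_nhds (by linarith) (by linarith)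
  have key : HasDerivAt (fun s => foldInt σ (fun z => hk 0 1 z s) φ x)
      (foldInt σ (fun z => hk01xx z t) φ x) t := by
    refine (hasDerivAt_integral_of_dominated_loc_of_deriv_le (μ := volume.restrict (Ioi (0 : ℝ)))
      (F := fun s y => (hk 0 1 (x - y) s + σ * hk 0 1 (x + y) s) • φ y)
      (F' := fun s y => (hk01xx (x - y) s + σ * hk01xx (x + y) s) • φ y)
      (bound := fun y => 2 * C * ‖φ y‖) hmem
      (Eventually.of_forall fun s => aestronglyMeasurable_foldInt (continuous_hk 0 1 s)
        hφ.integrableOn x)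
      (integrableOn_foldInt hσ (continuous_hk 0 1 t) hA' hφ.integrableOn x)
      (aestronglyMeasurable_foldInt hcc hφ.integrableOn x)
      (ae_of_all _ fun y s hs => norm_foldInt_integrand_le hσ (κ := fun z => hk01xx z s)
        (fun z => hC z s (by linarith [hs.1]) hs.2.le (Or.inr hs.1.le)) x y _)
      (hφ.integrableOn.norm.const_mul _) (ae_of_all _ fun y s hs => ?_)).2
    have hs0 : 0 < s := by linarith [hs.1]
    exact ((hasDerivAt_hk01_time hs0).add ((hasDerivAt_hk01_time hs0).const_mul σ)).smul_const (φ y)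
  rw [foldInt_deriv hσ (fun z => hasDerivAt_neg_half_hk13 ht) hcc hB' hC' hφ hφ' hd,
    foldInt_deriv hσ' (fun z => hasDerivAt_hk01 ht) hc hA' hB' hφ' hφ'' hd', neg_neg,
    sub_neg_eq_add, ← heatP_eq_foldInt hσ hφ'' x ht, ← add_assoc] at key
  refine key.congr_of_eventuallyEq ?_
  filter_upwards [lt_mem_nhds ht] with s hs using heatP_eq_foldInt hσ hφ x hs

end HeatDeriv

/-! ### Differentiation of Volterra integrals -/

/-- The Leibniz rule for `t ↦ ∫₀ᵗ U(s, t - s) ds`, where `V = ∂U/∂r`. -/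
theorem hasDerivAt_integral_volterra {U V : ℝ → ℝ → ℂ} {t : ℝ} (ht : 0 < t)
    (hU : ContinuousOn (fun p : ℝ × ℝ => U p.1 p.2) (Ioi 0 ×ˢ Ici 0))
    (hV : ContinuousOn (fun p : ℝ × ℝ => V p.1 p.2) (Ioi 0 ×ˢ Ici 0))
    (hd : ∀ s, 0 < s → ∀ r, 0 ≤ r → HasDerivWithinAt (U s) (V s r) (Ici 0) r) {C : ℝ}
    (hUb : ∀ s r, 0 < s → s ≤ t + 1 → 0 ≤ r → r ≤ t + 1 → ‖U s r‖ ≤ C)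
    (hVb : ∀ s r, 0 < s → s ≤ t + 1 → 0 ≤ r → r ≤ t + 1 → ‖V s r‖ ≤ C) :
    HasDerivAt (fun t => ∫ s in (0 : ℝ)..t, U s (t - s))
      ((∫ s in (0 : ℝ)..t, V s (t - s)) + U t 0) t := by
  have hC : 0 ≤ C := (norm_nonneg _).trans (hUb t 0 ht (by linarith) le_rfl (by linarith))
  -- `U s` is extended to negative arguments by the constant `U s 0`, which makes the domain of
  -- integration independent of `t`; the extension is Lipschitz, and smooth except at one point.
  set F : ℝ → ℝ → ℂ := fun t' s => U s (max 0 (t' - s)) with hF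
  have hcont : ∀ t' : ℝ, ContinuousOn (F t') (Ioi 0) := fun t' =>
    hU.comp (f := fun s => (s, max 0 (t' - s))) (by fun_prop) fun s hs => ⟨hs, le_max_left (0 : ℝ) _⟩
  have hIoc : uIoc 0 (t + 1) = Ioc 0 (t + 1) := uIoc_of_le (by linarith)
  have hFm : ∀ t', AEStronglyMeasurable (F t') (volume.restrict (uIoc 0 (t + 1))) := fun t' => by
    rw [hIoc]
    exact ((hcont t').mono Ioc_subset_Ioi_self).aestronglyMeasurable measurableSet_Ioc
  have hFb : ∀ t' ≤ t + 1, ∀ s ∈ Ioc 0 (t + 1), ‖F t' s‖ ≤ C := fun t' h s hs =>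
    hUb s _ hs.1 hs.2 (le_max_left _ _) (max_le (by linarith) (by linarith [hs.1]))
  have hFi : ∀ t' ≤ t + 1, IntegrableOn (F t') (Ioc 0 (t + 1)) := fun t' h => by
    have := hFm t'
    rw [hIoc] at this
    refine (integrableOn_const (C := C) (by simp)).mono' this ?_
    filter_upwards [ae_restrict_mem measurableSet_Ioc] with s hs using hFb t' h s hs
  have hFii : ∀ t' ≤ t + 1, IntervalIntegrable (F t') volume 0 (t + 1) := fun t' h =>
    (intervalIntegrable_iff_integrableOn_Ioc_of_le (by linarith)).2 (hFi t' h)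
  set F' : ℝ → ℂ := (Iio t).indicator fun s => V s (t - s) with hF'
  have hVc : ContinuousOn (fun s => V s (t - s)) (Ioc 0 t) :=
    hV.comp (f := fun s => (s, t - s)) (by fun_prop) fun s hs => ⟨hs.1, sub_nonneg.2 hs.2⟩
  have h1 : IntervalIntegrable F' volume 0 (t + 1) ∧
      HasDerivAt (fun t' => ∫ s in (0 : ℝ)..(t + 1), F t' s) (∫ s in (0 : ℝ)..(t + 1), F' s) t := by
    refine intervalIntegral.hasDerivAt_integral_of_dominated_loc_of_lip (s := Iio (t + 1))
      (bound := fun _ => C) (Iio_mem_nhds (lt_add_one t)) (Eventually.of_forall hFm)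
      (hFii t (by linarith)) ?_ (ae_of_all _ fun s hs => ?_) (by simp) ?_
    · rw [hIoc, hF', aestronglyMeasurable_indicator_iff measurableSet_Iio,
        Measure.restrict_restrict measurableSet_Iio]
      refine (hVc.mono fun s hs => ⟨hs.2.1, le_of_lt hs.1⟩).aestronglyMeasurable
        (measurableSet_Iio.inter measurableSet_Ioc)
    · rw [hIoc] at hs
      refine LipschitzOnWith.of_dist_le_mul fun a ha b hb => ?_
      have ha : a < t + 1 := ha
      have hb : b < t + 1 := hb
      have hm : ∀ c < t + 1, max 0 (c - s) ∈ Icc 0 (t + 1) := fun c hc =>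
        ⟨le_max_left _ _, max_le (by linarith) (by linarith [hs.1])⟩
      have := (convex_Icc (0 : ℝ) (t + 1)).norm_image_sub_le_of_norm_hasDerivWithin_le
        (f := U s) (f' := V s) (C := C)
        (fun r hr => (hd s hs.1 r hr.1).mono Icc_subset_Ici_self)
        (fun r hr => hVb s r hs.1 hs.2 hr.1 hr.2) (hm b hb) (hm a ha)
      rw [dist_eq_norm, Real.coe_nnabs, abs_of_nonneg hC, Real.dist_eq]
      refine this.trans ?_
      gcongr
      have := abs_max_sub_max_le_abs (a - s) (b - s) 0
      rw [max_comm, max_comm 0 (b - s)]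
      simpa using this
    · have hne : ∀ᵐ s : ℝ, s ≠ t := by simp [ae_iff, measure_singleton]
      filter_upwards [hne] with s hst hs
      rw [hIoc] at hs
      rcases hst.lt_or_gt with h | h
      · simp only [hF', indicator_of_mem (show s ∈ Iio t from h)]
        have h2 : HasDerivAt (U s) (V s (t - s)) (t - s) :=
          (hd s hs.1 _ (by linarith)).hasDerivAt (Ici_mem_nhds (by linarith))
        refine (h2.comp_sub_const t s).congr_of_eventuallyEq ?_
        filter_upwards [lt_mem_nhds h] with t' ht'
        simp only [hF, max_eq_right (sub_nonneg.2 ht'.le)]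
      · simp only [hF', indicator_of_notMem (show s ∉ Iio t from not_lt.2 h.le)]
        refine (hasDerivAt_const t (U s 0)).congr_of_eventuallyEq ?_
        filter_upwards [gt_mem_nhds h] with t' ht'
        simp only [hF, max_eq_left (show t' - s ≤ 0 by linarith)]
  have hU0 : ContinuousOn (fun s => U s 0) (Ioi 0) :=
    hU.comp (f := fun s => (s, (0 : ℝ))) (by fun_prop) fun s hs => ⟨hs, le_refl (0 : ℝ)⟩
  have hUt : ContinuousAt (fun s => U s 0) t := hU0.continuousAt (Ioi_mem_nhds ht)
  have h2 : HasDerivAt (fun t' => ∫ s in t'..(t + 1), U s 0) (-U t 0) t := by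
    refine intervalIntegral.integral_hasDerivAt_left ?_ ?_ hUt
    · refine (hU0.mono ?_).intervalIntegrable
      rw [uIcc_of_le (by linarith)]
      exact fun s hs => ht.trans_le hs.1
    · exact hU0.stronglyMeasurableAtFilter isOpen_Ioi t ht
  have h3 := h1.2.sub h2
  have e1 : ∫ s in (0 : ℝ)..(t + 1), F' s = ∫ s in (0 : ℝ)..t, V s (t - s) := by
    rw [← intervalIntegral.integral_add_adjacent_intervals (b := t)
      (h1.1.mono_set (by rw [uIcc_of_le ht.le, uIcc_of_le (by linarith)]; exact Icc_subset_Icc_right (by linarith)))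
      (h1.1.mono_set (by rw [uIcc_of_le (by linarith), uIcc_of_le (by linarith)]; exact Icc_subset_Icc_left ht.le))]
    have z : ∫ s in t..(t + 1), F' s = 0 := by
      rw [intervalIntegral.integral_of_le (by linarith)]
      refine setIntegral_eq_zero_of_forall_eq_zero fun s hs => ?_
      exact indicator_of_notMem (show s ∉ Iio t from not_lt.2 hs.1.le) _
    rw [z, add_zero]
    refine intervalIntegral.integral_congr_ae ?_
    have hne : ∀ᵐ s : ℝ, s ≠ t := by simp [ae_iff, measure_singleton]
    filter_upwards [hne] with s hst hs
    rw [uIoc_of_le ht.le] at hs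
    exact indicator_of_mem (show s ∈ Iio t from lt_of_le_of_ne hs.2 hst) _
  rw [e1, sub_neg_eq_add] at h3
  refine h3.congr_of_eventuallyEq ?_
  filter_upwards [Ioo_mem_nhds ht (lt_add_one t)] with t' ht'
  have hi := hFii t' ht'.2.le
  have e2 : ∫ s in (0 : ℝ)..(t + 1), F t' s =
      (∫ s in (0 : ℝ)..t', U s (t' - s)) + ∫ s in t'..(t + 1), U s 0 := by
    rw [← intervalIntegral.integral_add_adjacent_intervals (b := t')
      (hi.mono_set (by rw [uIcc_of_le ht'.1.le, uIcc_of_le (by linarith)]; exact Icc_subset_Icc_right ht'.2.le))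
      (hi.mono_set (by rw [uIcc_of_le ht'.2.le, uIcc_of_le (by linarith)]; exact Icc_subset_Icc_left ht'.1.le))]
    congr 1
    · refine intervalIntegral.integral_congr fun s hs => ?_
      rw [uIcc_of_le ht'.1.le] at hs
      simp only [hF, max_eq_right (sub_nonneg.2 hs.2)]
    · refine intervalIntegral.integral_congr fun s hs => ?_
      rw [uIcc_of_le ht'.2.le] at hs
      simp only [hF, max_eq_left (sub_nonpos.2 hs.1)]
  simp only [Pi.sub_apply, e2, add_sub_cancel_right]

/-! ### Layer potentials -/

theorem integrable_inv_sqrt (a b : ℝ) : IntervalIntegrable (fun s : ℝ => s ^ (-(1 / 2) : ℝ)) volume a b :=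
  intervalIntegral.intervalIntegrable_rpow' (by norm_num)

theorem integral_inv_sqrt (t : ℝ) : ∫ s in (0 : ℝ)..t, s ^ (-(1 / 2) : ℝ) = 2 * t ^ (1 / 2 : ℝ) := by
  rw [integral_rpow (Or.inl (by norm_num))]
  norm_num
  ring

/-- The heat kernel is `O(s^(-1/2))`, uniformly in `x`; in particular it is integrable in time. -/
theorem exists_hk01_le (n : ℕ) (T : ℝ) : ∃ C > 0, ∀ x s : ℝ, 0 < s → s ≤ T →
    (1 + |x|) ^ n * |hk 0 1 x s| ≤ C * s ^ (-(1 / 2) : ℝ) := by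
  obtain ⟨G, hG, hGz⟩ := exists_pow_mul_gker_le n
  refine ⟨(1 + √T) ^ n * G, by positivity, fun x s hs hsT => ?_⟩
  have hs' : 0 < √s := Real.sqrt_pos.2 hs
  have hsT' : √s ≤ √T := Real.sqrt_le_sqrt hsT
  have hg := (gker_pos (x / √s)).le
  have e : s ^ (-(1 / 2) : ℝ) = (√s)⁻¹ := by rw [Real.rpow_neg hs.le, Real.sqrt_eq_rpow]
  rw [e, hk_eq_gker hs, pow_zero, one_mul, pow_one, abs_mul, abs_of_pos (inv_pos.2 hs'),
    abs_of_nonneg hg]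
  have hx : |x| = √s * |x / √s| := by rw [abs_div, abs_of_pos hs']; field_simp
  have h1 : 1 + |x| ≤ (1 + √T) * (1 + |x / √s|) := by
    have := mul_le_mul_of_nonneg_right hsT' (abs_nonneg (x / √s))
    nlinarith [abs_nonneg (x / √s), Real.sqrt_nonneg T]
  calc (1 + |x|) ^ n * ((√s)⁻¹ * gker (x / √s))
      ≤ ((1 + √T) * (1 + |x / √s|)) ^ n * ((√s)⁻¹ * gker (x / √s)) := by gcongr
    _ = (1 + √T) ^ n * ((1 + |x / √s|) ^ n * gker (x / √s)) * (√s)⁻¹ := by rw [mul_pow]; ring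
    _ ≤ (1 + √T) ^ n * G * (√s)⁻¹ := by gcongr; exact hGz _

/-- The single layer potential at the boundary `x = 0` with density `a`, times `√(4π)`. -/
def layer0 (a : ℝ → ℂ) (x t : ℝ) : ℂ := ∫ s in (0 : ℝ)..t, hk 0 1 x s • a (t - s)

/-- The double layer potential, `-2` times the space derivative of `layer0 a` for `x > 0`, in a form
that is meaningful up to the boundary: the variable of integration is `z = |x| / √s`. -/
def layer1 (a : ℝ → ℂ) (x t : ℝ) : ℂ :=
  2 * ∫ z, {z | |x| < √t * z}.indicator (fun z => gker z • a |t - x ^ 2 / z ^ 2|) z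

section Layer

variable {a a' : ℝ → ℂ}

theorem continuousOn_reflect (ha : ContinuousOn a (Ici 0)) (t : ℝ) :
    ContinuousOn (fun s => a (t - s)) (Iic t) :=
  ha.comp (by fun_prop) fun s hs => sub_nonneg.2 (show s ≤ t from hs)

theorem measurable_hk (b m : ℕ) (x : ℝ) : Measurable fun s => hk b m x s := by
  unfold hk; fun_prop

theorem aestronglyMeasurable_layer (ha : ContinuousOn a (Ici 0)) (b m : ℕ) (x : ℝ) {t : ℝ}
    (ht : 0 ≤ t) : AEStronglyMeasurable (fun s => hk b m x s • a (t - s))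
      (volume.restrict (uIoc 0 t)) := by
  rw [uIoc_of_le ht]
  exact (measurable_hk b m x).aestronglyMeasurable.smul
    (((continuousOn_reflect ha t).mono Ioc_subset_Iic_self).aestronglyMeasurable measurableSet_Ioc)

theorem intervalIntegrable_layer0 (ha : ContinuousOn a (Ici 0)) (x : ℝ) {t : ℝ}
    (ht : 0 ≤ t) : IntervalIntegrable (fun s => hk 0 1 x s • a (t - s)) volume 0 t := by
  obtain ⟨C, hC, hCb⟩ := exists_hk01_le 0 t
  obtain ⟨M, hM⟩ := isCompact_Icc.exists_bound_of_continuousOn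
    (ha.mono (Icc_subset_Ici_self : Icc 0 t ⊆ _))
  refine ((integrable_inv_sqrt 0 t).mul_const (C * M)).mono_fun'
    (aestronglyMeasurable_layer ha 0 1 x ht) ?_
  rw [uIoc_of_le ht]
  filter_upwards [ae_restrict_mem measurableSet_Ioc] with s hs
  rw [norm_smul, Real.norm_eq_abs]
  have h1 := hCb x s hs.1 hs.2
  rw [pow_zero, one_mul] at h1
  calc _ ≤ C * s ^ (-(1 / 2) : ℝ) * M :=
        mul_le_mul h1 (hM _ ⟨by linarith [hs.2], by linarith [hs.1]⟩) (norm_nonneg _)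
          (mul_nonneg hC.le (Real.rpow_nonneg hs.1.le _))
    _ = _ := by ring

theorem exists_layer0_le (n : ℕ) (T : ℝ) : ∃ C > 0, ∀ {a : ℝ → ℂ} {M : ℝ},
    (∀ r, 0 ≤ r → r ≤ T → ‖a r‖ ≤ M) → ∀ x t : ℝ, 0 ≤ t → t ≤ T →
    (1 + |x|) ^ n * ‖layer0 a x t‖ ≤ C * t ^ (1 / 2 : ℝ) * M := by
  obtain ⟨C, hC, hCb⟩ := exists_hk01_le n T
  refine ⟨2 * C, by positivity, fun {a M} hM x t ht htT => ?_⟩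
  have hM0 : 0 ≤ M := (norm_nonneg _).trans (hM 0 le_rfl (ht.trans htT))
  have hx : (0 : ℝ) < (1 + |x|) ^ n := by positivity
  have h1 : ‖layer0 a x t‖ ≤ ∫ s in (0 : ℝ)..t, s ^ (-(1 / 2) : ℝ) * (((1 + |x|) ^ n)⁻¹ * C * M) := by
    refine intervalIntegral.norm_integral_le_of_norm_le ht (ae_of_all _ fun s hs => ?_)
      ((integrable_inv_sqrt 0 t).mul_const _)
    rw [norm_smul, Real.norm_eq_abs]
    have h1 := hCb x s hs.1 (hs.2.trans htT)
    rw [← le_div_iff₀' hx] at h1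
    calc _ ≤ C * s ^ (-(1 / 2) : ℝ) / (1 + |x|) ^ n * M :=
          mul_le_mul h1 (hM _ (by linarith [hs.2]) (by linarith [hs.1])) (norm_nonneg _)
            (div_nonneg (mul_nonneg hC.le (Real.rpow_nonneg hs.1.le _)) hx.le)
      _ = _ := by ring
  rw [intervalIntegral.integral_mul_const, integral_inv_sqrt] at h1
  calc (1 + |x|) ^ n * ‖layer0 a x t‖ ≤ (1 + |x|) ^ n * _ := mul_le_mul_of_nonneg_left h1 hx.le
    _ = _ := by field_simp

theorem layer0_add {b : ℝ → ℂ} (ha : ContinuousOn a (Ici 0)) (hb : ContinuousOn b (Ici 0)) (x : ℝ)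
    {t : ℝ} (ht : 0 ≤ t) : layer0 (fun r => a r + b r) x t = layer0 a x t + layer0 b x t := by
  unfold layer0
  rw [← intervalIntegral.integral_add (intervalIntegrable_layer0 ha x ht)
    (intervalIntegrable_layer0 hb x ht)]
  simp only [smul_add]

theorem layer0_const_mul (c : ℂ) (a : ℝ → ℂ) (x t : ℝ) :
    layer0 (fun r => c * a r) x t = c * layer0 a x t := by
  unfold layer0
  rw [← intervalIntegral.integral_const_mul]
  simp only [mul_smul_comm]

/-- The scaling `s = tθ` makes the interval of integration independent of `t`. -/
theorem layer0_eq_smul (a : ℝ → ℂ) (x t : ℝ) :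
    layer0 a x t = t • ∫ θ in (0 : ℝ)..1, hk 0 1 x (t * θ) • a (t - t * θ) := by
  have := intervalIntegral.smul_integral_comp_mul_left (a := 0) (b := 1)
    (fun s => hk 0 1 x s • a (t - s)) t
  rw [this, mul_zero, mul_one, layer0]

theorem continuousWithinAt_layer0 (ha : ContinuousOn a (Ici 0)) {p : ℝ × ℝ} (hp : 0 ≤ p.2) :
    ContinuousWithinAt (fun p : ℝ × ℝ => layer0 a p.1 p.2) {q | 0 ≤ q.2} p := by
  obtain ⟨M, hM⟩ := isCompact_Icc.exists_bound_of_continuousOn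
    (ha.mono (Icc_subset_Ici_self : Icc 0 (p.2 + 1) ⊆ _))
  have hlt : ∀ᶠ q : ℝ × ℝ in 𝓝 p, q.2 < p.2 + 1 :=
    (continuous_snd.tendsto p).eventually (gt_mem_nhds (lt_add_one _))
  rcases hp.lt_or_eq with h | h
  · obtain ⟨C, hC, hCb⟩ := exists_hk01_le 0 (p.2 + 1)
    have hgt : ∀ᶠ q : ℝ × ℝ in 𝓝 p, p.2 / 2 < q.2 :=
      (continuous_snd.tendsto p).eventually (lt_mem_nhds (half_lt_self h))
    -- after the scaling `s = tθ` the interval of integration is fixed and the integrand is dominated by a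
    -- multiple of `θ^(-1/2)`
    refine ContinuousAt.continuousWithinAt ?_
    simp only [layer0_eq_smul]
    refine continuous_snd.continuousAt.smul
      (intervalIntegral.continuousAt_of_dominated_interval
        (bound := fun θ => C * ((p.2 / 2) ^ (-(1 / 2) : ℝ) * θ ^ (-(1 / 2) : ℝ)) * M) ?_ ?_ ?_ ?_)
    · filter_upwards [hgt] with q hq
      rw [uIoc_of_le zero_le_one]
      refine ((measurable_hk 0 1 q.1).comp (measurable_const_mul q.2)).aestronglyMeasurable.smul
        (ContinuousOn.aestronglyMeasurable (ha.comp (by fun_prop) fun θ hθ => ?_) measurableSet_Ioc)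
      have : 0 < q.2 := by linarith
      show 0 ≤ q.2 - q.2 * θ
      nlinarith [hθ.1, hθ.2]
    · filter_upwards [hgt, hlt] with q hq hq'
      refine ae_of_all _ fun θ hθ => ?_
      rw [uIoc_of_le zero_le_one] at hθ
      have hq0 : 0 < q.2 := by linarith
      have h0 : 0 < q.2 * θ := mul_pos hq0 hθ.1
      have h2 : q.2 * θ ≤ q.2 := mul_le_of_le_one_right hq0.le hθ.2
      have h1 := hCb q.1 (q.2 * θ) h0 (by linarith)
      rw [pow_zero, one_mul] at h1
      rw [norm_smul, Real.norm_eq_abs]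
      have hθ0 := hθ.1
      have h3 : (q.2 * θ) ^ (-(1 / 2) : ℝ) ≤ (p.2 / 2) ^ (-(1 / 2) : ℝ) * θ ^ (-(1 / 2) : ℝ) := by
        rw [← Real.mul_rpow (by positivity) hθ.1.le]
        refine Real.rpow_le_rpow_of_nonpos (by positivity) ?_ (by norm_num)
        gcongr
      refine mul_le_mul (h1.trans (mul_le_mul_of_nonneg_left h3 hC.le))
        (hM _ ⟨by linarith, by linarith⟩) (norm_nonneg _) ?_
      have := Real.rpow_nonneg (half_pos h).le (-(1 / 2))
      have := Real.rpow_nonneg hθ.1.le (-(1 / 2))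
      positivity
    · exact (((integrable_inv_sqrt 0 1).const_mul _).const_mul C).mul_const M
    · have hne : ∀ᵐ θ : ℝ, θ ≠ 1 := by simp [ae_iff, measure_singleton]
      filter_upwards [hne] with θ hθ1 hθ
      rw [uIoc_of_le zero_le_one] at hθ
      have hθ1 : θ < 1 := lt_of_le_of_ne hθ.2 hθ1
      have e1 : ContinuousAt (fun q : ℝ × ℝ => hk 0 1 q.1 (q.2 * θ)) p :=
        ContinuousAt.comp (f := fun q : ℝ × ℝ => (q.1, q.2 * θ))
          (continuousAt_hk_of_pos 0 1 (p := (p.1, p.2 * θ)) (mul_pos h hθ.1)) (by fun_prop)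
      have e2 : ContinuousAt (fun q : ℝ × ℝ => a (q.2 - q.2 * θ)) p := by
        refine ContinuousAt.comp (f := fun q : ℝ × ℝ => q.2 - q.2 * θ)
          (ha.continuousAt (Ici_mem_nhds ?_)) (by fun_prop)
        show 0 < p.2 - p.2 * θ
        nlinarith
      exact e1.smul e2
  -- at `t = 0` the potential is `O(√t)`
  · obtain ⟨C, hC, hCb⟩ := exists_layer0_le 0 (p.2 + 1)
    have hv : layer0 a p.1 p.2 = 0 := by simp [layer0, ← h]
    rw [ContinuousWithinAt, hv]
    refine squeeze_zero_norm' (a := fun q : ℝ × ℝ => C * q.2 ^ (1 / 2 : ℝ) * M) ?_ ?_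
    · filter_upwards [self_mem_nhdsWithin, nhdsWithin_le_nhds hlt] with q hq hq'
      simpa using hCb (fun r h0 h1 => hM r ⟨h0, h1⟩) q.1 q.2 hq hq'.le
    · have : Continuous fun q : ℝ × ℝ => C * q.2 ^ (1 / 2 : ℝ) * M :=
        (continuous_const.mul (continuous_snd.rpow_const fun _ => Or.inr (by norm_num))).mul
          continuous_const
      have := this.tendsto p
      rw [← h, Real.zero_rpow (by norm_num), mul_zero, zero_mul] at this
      exact this.mono_left nhdsWithin_le_nhds

theorem measurableSet_layer1 (x t : ℝ) : MeasurableSet {z | |x| < √t * z} :=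
  (isOpen_lt continuous_const (by fun_prop)).measurableSet

theorem aestronglyMeasurable_layer1 (ha : ContinuousOn a (Ici 0)) (x t : ℝ) :
    AEStronglyMeasurable ({z | |x| < √t * z}.indicator fun z => gker z • a |t - x ^ 2 / z ^ 2|) := by
  refine AEStronglyMeasurable.indicator ?_ (measurableSet_layer1 x t)
  have : Measurable fun z : ℝ => t - x ^ 2 / z ^ 2 := by fun_prop
  exact (continuous_gker.aestronglyMeasurable).smul
    ((continuous_comp_abs ha).measurable.comp this).aestronglyMeasurable

/-- In the domain of integration of `layer1` the argument of the density is positive: the absolute value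
there only provides measurability outside of this domain. -/
theorem sub_div_sq_mem {x t z : ℝ} (h : |x| < √t * z) :
    0 < z ∧ 0 < t - x ^ 2 / z ^ 2 ∧ t - x ^ 2 / z ^ 2 ≤ t := by
  have hz : 0 < √t * z := (abs_nonneg x).trans_lt h
  have hs : 0 < √t := by
    rcases (Real.sqrt_nonneg t).lt_or_eq with h | h
    · exact h
    · rw [← h, zero_mul] at hz; exact absurd hz (lt_irrefl _)
  have hz0 : 0 < z := (mul_pos_iff_of_pos_left hs).1 hz
  refine ⟨hz0, ?_, sub_le_self _ (by positivity)⟩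
  rw [sub_pos, div_lt_iff₀ (by positivity), ← sq_abs]
  calc |x| ^ 2 < (√t * z) ^ 2 := by gcongr
    _ = t * z ^ 2 := by rw [mul_pow, Real.sq_sqrt (Real.sqrt_pos.1 hs).le]

theorem norm_layer1_integrand_le {T M : ℝ} (hM : ∀ r, 0 ≤ r → r ≤ T → ‖a r‖ ≤ M) (hM0 : 0 ≤ M)
    {t : ℝ} (htT : t ≤ T) (n : ℕ) (x z : ℝ) :
    (1 + |x|) ^ n * ‖{z | |x| < √t * z}.indicator (fun z => gker z • a |t - x ^ 2 / z ^ 2|) z‖ ≤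
      (1 + √T) ^ n * ((1 + |z|) ^ n * gker z) * M := by
  have hg := (gker_pos z).le
  by_cases hz : |x| < √t * z
  · obtain ⟨h0, h1, h2⟩ := sub_div_sq_mem hz
    rw [indicator_of_mem (by exact hz), norm_smul, Real.norm_of_nonneg hg, abs_of_pos h1]
    have hxz : 1 + |x| ≤ (1 + √T) * (1 + |z|) := by
      have := mul_le_mul_of_nonneg_right (Real.sqrt_le_sqrt htT) h0.le
      rw [abs_of_pos h0]
      nlinarith [Real.sqrt_nonneg T]
    calc (1 + |x|) ^ n * (gker z * ‖a (t - x ^ 2 / z ^ 2)‖)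
        ≤ ((1 + √T) * (1 + |z|)) ^ n * (gker z * M) := by
          gcongr
          exact hM _ h1.le (h2.trans htT)
      _ = _ := by rw [mul_pow]; ring
  · rw [indicator_of_notMem (by exact hz), norm_zero, mul_zero]
    positivity

theorem integrable_layer1 (ha : ContinuousOn a (Ici 0)) (x t : ℝ) :
    Integrable ({z | |x| < √t * z}.indicator fun z => gker z • a |t - x ^ 2 / z ^ 2|) := by
  obtain ⟨M, hM⟩ := isCompact_Icc.exists_bound_of_continuousOn
    (ha.mono (Icc_subset_Ici_self : Icc 0 (max t 0) ⊆ _))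
  have hM0 : 0 ≤ M := (norm_nonneg _).trans (hM 0 ⟨le_rfl, le_max_right _ _⟩)
  refine (integrable_gker.mul_const M).mono' (aestronglyMeasurable_layer1 ha x t)
    (ae_of_all _ fun z => ?_)
  simpa using norm_layer1_integrand_le (fun r h0 h1 => hM r ⟨h0, h1⟩) hM0 (le_max_left t 0) 0 x z

theorem exists_layer1_le (n : ℕ) (T : ℝ) : ∃ C > 0, ∀ {a : ℝ → ℂ} {M : ℝ},
    (∀ r, 0 ≤ r → r ≤ T → ‖a r‖ ≤ M) → ∀ x t : ℝ, 0 ≤ t → t ≤ T →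
    (1 + |x|) ^ n * ‖layer1 a x t‖ ≤ C * M := by
  have hI := (integrable_pow_mul_gker n).const_mul ((1 + √T) ^ n)
  refine ⟨2 * (∫ z, (1 + √T) ^ n * ((1 + |z|) ^ n * gker z)) + 1, ?_, ?_⟩
  · have : 0 ≤ ∫ z, (1 + √T) ^ n * ((1 + |z|) ^ n * gker z) :=
      integral_nonneg fun z => by have := (gker_pos z).le; positivity
    linarith
  intro a M hM x t ht htT
  have hM0 : 0 ≤ M := (norm_nonneg _).trans (hM 0 le_rfl (ht.trans htT))
  have hx : (0 : ℝ) < (1 + |x|) ^ n := by positivity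
  have h2 : ‖∫ z, {z | |x| < √t * z}.indicator (fun z => gker z • a |t - x ^ 2 / z ^ 2|) z‖ ≤
      ∫ z, ((1 + |x|) ^ n)⁻¹ * ((1 + √T) ^ n * ((1 + |z|) ^ n * gker z) * M) := by
    refine norm_integral_le_of_norm_le ((hI.mul_const M).const_mul _) (ae_of_all _ fun z => ?_)
    rw [← div_eq_inv_mul, le_div_iff₀ hx, mul_comm]
    exact norm_layer1_integrand_le hM hM0 htT n x z
  rw [integral_const_mul, integral_mul_const] at h2
  rw [layer1, norm_mul, Complex.norm_two]
  calc (1 + |x|) ^ n * (2 * _) ≤ (1 + |x|) ^ n * (2 * _) :=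
        mul_le_mul_of_nonneg_left (mul_le_mul_of_nonneg_left h2 zero_le_two) hx.le
    _ = 2 * (∫ z, (1 + √T) ^ n * ((1 + |z|) ^ n * gker z)) * M := by field_simp
    _ ≤ _ := by linarith

theorem layer1_add {b : ℝ → ℂ} (ha : ContinuousOn a (Ici 0)) (hb : ContinuousOn b (Ici 0)) (x t : ℝ) :
    layer1 (fun r => a r + b r) x t = layer1 a x t + layer1 b x t := by
  unfold layer1
  rw [← mul_add, ← integral_add (integrable_layer1 ha x t) (integrable_layer1 hb x t)]
  simp only [smul_add, indicator_add]

theorem layer1_const_mul (c : ℂ) (a : ℝ → ℂ) (x t : ℝ) :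
    layer1 (fun r => c * a r) x t = c * layer1 a x t := by
  unfold layer1
  rw [mul_left_comm, ← integral_const_mul c]
  congr 2
  funext z
  by_cases hz : z ∈ {z | |x| < √t * z}
  · simp [indicator_of_mem hz]
    ring
  · simp [indicator_of_notMem hz]

/-- The integrand of `layer1` is continuous in `(x, t)` off the characteristic `|x| = √t z`, which is a null
set of `z` unless `(x, t)` is the origin. -/
theorem continuousWithinAt_layer1 (ha : ContinuousOn a (Ici 0)) {p : ℝ × ℝ} (hp : 0 ≤ p.2)
    (h0 : p.1 ≠ 0 ∨ √p.2 ≠ 0) :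
    ContinuousWithinAt (fun p : ℝ × ℝ => layer1 a p.1 p.2) {q | 0 ≤ q.2} p := by
  obtain ⟨M, hM⟩ := isCompact_Icc.exists_bound_of_continuousOn
    (ha.mono (Icc_subset_Ici_self : Icc 0 (p.2 + 1) ⊆ _))
  have hM0 : 0 ≤ M := (norm_nonneg _).trans (hM 0 ⟨le_rfl, by linarith⟩)
  have hlt : ∀ᶠ q : ℝ × ℝ in 𝓝 p, q.2 < p.2 + 1 :=
    (continuous_snd.tendsto p).eventually (gt_mem_nhds (lt_add_one _))
  refine ContinuousAt.continuousWithinAt (continuousAt_const.mul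
    (continuousAt_of_dominated (bound := fun z => gker z * M)
      (Eventually.of_forall fun q => aestronglyMeasurable_layer1 ha q.1 q.2) ?_
      (integrable_gker.mul_const M) ?_))
  · filter_upwards [hlt] with q hq
    refine ae_of_all _ fun z => ?_
    simpa using norm_layer1_integrand_le (fun r h0 h1 => hM r ⟨h0, h1⟩) hM0 hq.le 0 q.1 z
  · have h0' : |p.1| ≠ 0 ∨ √p.2 ≠ 0 := by rwa [abs_ne_zero]
    filter_upwards [ae_sub_mul_ne_zero h0'] with z hz
    have hc : Continuous fun q : ℝ × ℝ => √q.2 * z := by fun_prop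
    have hc' : Continuous fun q : ℝ × ℝ => |q.1| := by fun_prop
    rcases (sub_ne_zero.1 hz).lt_or_gt with h | h
    · obtain ⟨-, h1, -⟩ := sub_div_sq_mem h
      have e : ContinuousAt (fun q : ℝ × ℝ => gker z • a |q.2 - q.1 ^ 2 / z ^ 2|) p := by
        have h2 : Continuous fun q : ℝ × ℝ => q.2 - q.1 ^ 2 / z ^ 2 := by fun_prop
        have h3 : Continuous fun q : ℝ × ℝ => a |q.2 - q.1 ^ 2 / z ^ 2| :=
          (continuous_comp_abs ha).comp h2
        exact (h3.fun_const_smul (gker z)).continuousAt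
      refine e.congr ?_
      filter_upwards [(hc'.continuousAt.eventually_lt hc.continuousAt h)] with q hq
      rw [indicator_of_mem (by exact hq)]
    · refine (continuousAt_const (y := (0 : ℂ))).congr ?_
      filter_upwards [(hc.continuousAt.eventually_lt hc'.continuousAt h)] with q hq
      rw [indicator_of_notMem (by exact not_lt.2 hq.le)]

/-- For compatible data `u 0 = a 0`, the jump of the odd extension of `u` is compensated by the
double layer potential: the sum is continuous at the corner. -/
theorem continuousWithinAt_heatP_add_layer1 {u : ℝ → ℂ} (hu : ContinuousOn u (Ici 0))
    (hub : ∃ M, ∀ y, 0 ≤ y → ‖u y‖ ≤ M) (ha : ContinuousOn a (Ici 0)) (h0 : u 0 = a 0) :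
    ContinuousWithinAt (fun p : ℝ × ℝ => heatP (-1) u p.1 p.2 + layer1 a p.1 p.2) Qbar (0, 0) := by
  obtain ⟨B, hB⟩ := hub
  obtain ⟨M, hM⟩ := isCompact_Icc.exists_bound_of_continuousOn
    (ha.mono (Icc_subset_Ici_self : Icc (0 : ℝ) 1 ⊆ _))
  have hM0 : 0 ≤ M := (norm_nonneg _).trans (hM 0 ⟨le_rfl, zero_le_one⟩)
  have hσ : |(-1 : ℝ)| ≤ 1 := by simp
  set F : ℝ × ℝ → ℝ → ℂ := fun p z => (gker z * sgf (-1) (p.1 - √p.2 * z)) • u |p.1 - √p.2 * z| +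
    2 * {z | |p.1| < √p.2 * z}.indicator (fun z => gker z • a |p.2 - p.1 ^ 2 / z ^ 2|) z with hF
  have hsum : ∀ p : ℝ × ℝ, heatP (-1) u p.1 p.2 + layer1 a p.1 p.2 = ∫ z, F p z := by
    intro p
    rw [heatP, layer1, ← integral_const_mul, ← integral_add
      (integrable_heatP hσ hu ⟨B, hB⟩ p.1 p.2) ((integrable_layer1 ha p.1 p.2).const_mul 2)]
  simp only [hsum]
  have hlt : ∀ᶠ q : ℝ × ℝ in 𝓝 (0, 0), q.2 < 1 :=
    (continuous_snd.tendsto ((0, 0) : ℝ × ℝ)).eventually (gt_mem_nhds one_pos)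
  refine continuousWithinAt_of_dominated (bound := fun z => gker z * B + 2 * (gker z * M))
    (Eventually.of_forall fun p => (aestronglyMeasurable_heatP _ hu _ _).add
      ((aestronglyMeasurable_layer1 ha _ _).const_mul 2)) ?_
    ((integrable_gker.mul_const B).add ((integrable_gker.mul_const M).const_mul 2)) ?_
  · filter_upwards [nhdsWithin_le_nhds hlt] with q hq
    refine ae_of_all _ fun z => (norm_add_le _ _).trans (add_le_add ?_ ?_)
    · exact (norm_heatP_integrand_le hσ u _ z).trans
        (mul_le_mul_of_nonneg_left (hB _ (abs_nonneg _)) (gker_pos z).le)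
    · rw [norm_mul, Complex.norm_two]
      gcongr
      simpa using norm_layer1_integrand_le (fun r h0 h1 => hM r ⟨h0, h1⟩) hM0 hq.le 0 q.1 z
  · refine ae_of_all _ fun z => ?_
    -- on either side of the characteristic `x = √t z` the integrand is continuous, and both
    -- branches have the limit `gker z • u 0`
    have hform : ∀ p ∈ Qbar, F p z = if 0 ≤ p.1 - √p.2 * z then gker z • u |p.1 - √p.2 * z|
        else gker z • (-u |p.1 - √p.2 * z| + 2 * a |p.2 - p.1 ^ 2 / z ^ 2|) := by
      intro p hp
      have hp1 : |p.1| = p.1 := abs_of_nonneg hp.1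
      simp only [hF, sgf]
      split_ifs with h
      · rw [indicator_of_notMem (by simp only [mem_ofPred_eq, hp1]; linarith)]
        simp
      · rw [indicator_of_mem (by simp only [mem_ofPred_eq, hp1]; linarith)]
        simp only [Complex.real_smul]
        push_cast
        ring
    have h00 : ((0, 0) : ℝ × ℝ) ∈ Qbar := ⟨le_refl (0 : ℝ), le_refl (0 : ℝ)⟩
    have hv : F (0, 0) z = gker z • u 0 := by rw [hform _ h00]; simp
    rw [ContinuousWithinAt, hv]
    have t1 : Tendsto (fun p : ℝ × ℝ => gker z • u |p.1 - √p.2 * z|) (𝓝[Qbar] (0, 0))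
        (𝓝 (gker z • u 0)) := by
      have h1 : Continuous fun p : ℝ × ℝ => p.1 - √p.2 * z := by fun_prop
      have h2 : Continuous fun p : ℝ × ℝ => u |p.1 - √p.2 * z| := (continuous_comp_abs hu).comp h1
      have : Continuous fun p : ℝ × ℝ => gker z • u |p.1 - √p.2 * z| := h2.fun_const_smul _
      have := this.tendsto (0, 0)
      simp only [Real.sqrt_zero, zero_mul, sub_zero, abs_zero] at this
      exact this.mono_left nhdsWithin_le_nhds
    have t2 : Tendsto (fun p : ℝ × ℝ => gker z • (-u |p.1 - √p.2 * z| +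
        2 * a |p.2 - p.1 ^ 2 / z ^ 2|)) (𝓝[Qbar] (0, 0)) (𝓝 (gker z • u 0)) := by
      have h1 : Continuous fun p : ℝ × ℝ => u |p.1 - √p.2 * z| :=
        (continuous_comp_abs hu).comp (f := fun p : ℝ × ℝ => p.1 - √p.2 * z) (by fun_prop)
      have h2 : Continuous fun p : ℝ × ℝ => a |p.2 - p.1 ^ 2 / z ^ 2| :=
        (continuous_comp_abs ha).comp (f := fun p : ℝ × ℝ => p.2 - p.1 ^ 2 / z ^ 2) (by fun_prop)
      have h3 : Continuous fun p : ℝ × ℝ => gker z • (-u |p.1 - √p.2 * z| +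
        2 * a |p.2 - p.1 ^ 2 / z ^ 2|) := (h1.fun_neg.fun_add (h2.const_mul 2)).fun_const_smul _
      have := h3.tendsto (0, 0)
      simp only [Real.sqrt_zero, zero_mul, sub_zero, abs_zero, ne_eq, OfNat.ofNat_ne_zero,
        not_false_eq_true, zero_pow, zero_div] at this
      rw [← h0, show -u 0 + 2 * u 0 = u 0 by ring] at this
      exact this.mono_left nhdsWithin_le_nhds
    refine Tendsto.congr' ?_ (t1.if' t2 (p := fun p : ℝ × ℝ => 0 ≤ p.1 - √p.2 * z))
    filter_upwards [self_mem_nhdsWithin] with p hp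
    exact (hform p hp).symm

/-- The double layer potential as a Volterra integral. -/
theorem layer1_eq_integral (a : ℝ → ℂ) {x t : ℝ} (hx : 0 < x) (ht : 0 < t) :
    layer1 a x t = ∫ s in (0 : ℝ)..t, hk 1 3 x s • a (t - s) := by
  have hs : 0 < √t := Real.sqrt_pos.2 ht
  have hS : {z : ℝ | |x| < √t * z} = Ioi (x / √t) := by
    ext z; simp only [mem_ofPred_eq, abs_of_pos hx, mem_Ioi, div_lt_iff₀ hs, mul_comm]
  have hxt : 0 < x / √t := by positivity
  have hpos : ∀ z ∈ Ioi (x / √t), 0 < z := fun z hz => hxt.trans hz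
  -- the substitution `s = x² / z²`
  have himg : (fun z : ℝ => x ^ 2 / z ^ 2) '' Ioi (x / √t) = Ioo 0 t := by
    ext s
    constructor
    · rintro ⟨z, hz, rfl⟩
      have hz0 := hpos z hz
      refine ⟨by positivity, ?_⟩
      have := (sub_div_sq_mem (x := x) (t := t) (z := z) (by rw [← hS] at hz; exact hz)).2.1
      simpa using this
    · rintro ⟨h0, h1⟩
      have hs0 : 0 < √s := Real.sqrt_pos.2 h0
      refine ⟨x / √s, ?_, ?_⟩
      · have : √s < √t := Real.sqrt_lt_sqrt h0.le h1
        show x / √t < x / √s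
        gcongr
      · simp only [div_pow, Real.sq_sqrt h0.le]
        field_simp
  have hinj : InjOn (fun z : ℝ => x ^ 2 / z ^ 2) (Ioi (x / √t)) := by
    intro z hz w hw h
    have hz0 := hpos z hz
    have hw0 := hpos w hw
    simp only at h
    rw [div_eq_div_iff (by positivity) (by positivity)] at h
    have h2 := mul_left_cancel₀ (by positivity) h
    exact ((sq_eq_sq₀ hw0.le hz0.le).1 h2).symm
  have hder : ∀ z ∈ Ioi (x / √t),
      HasDerivWithinAt (fun z : ℝ => x ^ 2 / z ^ 2) (-(2 * x ^ 2 / z ^ 3)) (Ioi (x / √t)) z := by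
    intro z hz
    have hz0 := hpos z hz
    have := ((hasDerivAt_const z (x ^ 2)).fun_div (hasDerivAt_pow 2 z) (by positivity))
    refine (this.congr_deriv ?_).hasDerivWithinAt
    field_simp
    ring
  rw [intervalIntegral.integral_of_le ht.le, integral_Ioc_eq_integral_Ioo, ← himg,
    integral_image_eq_integral_abs_deriv_smul measurableSet_Ioi hder hinj, layer1,
    integral_indicator (measurableSet_layer1 x t), hS, ← integral_const_mul]
  refine setIntegral_congr_fun measurableSet_Ioi fun z hz => ?_
  have hz0 := hpos z hz
  have h1 := (sub_div_sq_mem (x := x) (t := t) (z := z) (by rw [← hS] at hz; exact hz)).2.1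
  have hq : √(x ^ 2 / z ^ 2) = x / z := by
    rw [← div_pow, Real.sqrt_sq (by positivity)]
  have hk' : hk 1 3 x (x ^ 2 / z ^ 2) = z ^ 3 / x ^ 2 * gker z := by
    rw [hk_eq_gker (by positivity), hq]
    have : x / (x / z) = z := by field_simp
    rw [this, pow_one]
    congr 1
    field_simp
  simp only [hk', abs_of_pos h1, abs_neg]
  rw [abs_of_pos (by positivity), smul_smul]
  have : 2 * x ^ 2 / z ^ 3 * (z ^ 3 / x ^ 2 * gker z) = 2 * gker z := by field_simp
  rw [this]
  simp only [Complex.real_smul]; push_cast; ring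

theorem continuousOn_hk_time (b m : ℕ) {x : ℝ} (hx : 0 < x) :
    ContinuousOn (fun s => hk b (m + 1) x s) (Ici 0) := by
  intro s hs
  exact (continuousWithinAt_hk b m (p := (x, s)) hs (Or.inl hx.ne')).comp
    (f := fun s => (x, s)) (by fun_prop) fun r hr => hr

theorem hasDerivAt_layer_time (b m : ℕ) (ha : ContinuousOn a (Ici 0)) (ha' : ContinuousOn a' (Ici 0))
    (hd : ∀ r, 0 ≤ r → HasDerivWithinAt a (a' r) (Ici 0) r) {x t : ℝ} (hx : 0 < x) (ht : 0 < t) :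
    HasDerivAt (fun t => ∫ s in (0 : ℝ)..t, hk b (m + 1) x s • a (t - s))
      ((∫ s in (0 : ℝ)..t, hk b (m + 1) x s • a' (t - s)) + hk b (m + 1) x t • a 0) t := by
  obtain ⟨C, hC, hCb⟩ := exists_abs_hk_le b (m + 1) hx (t + 1)
  obtain ⟨M, hM⟩ := isCompact_Icc.exists_bound_of_continuousOn
    (ha.mono (Icc_subset_Ici_self : Icc 0 (t + 1) ⊆ _))
  obtain ⟨M', hM'⟩ := isCompact_Icc.exists_bound_of_continuousOn
    (ha'.mono (Icc_subset_Ici_self : Icc 0 (t + 1) ⊆ _))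
  have hk' : ContinuousOn (fun p : ℝ × ℝ => hk b (m + 1) x p.1) (Ioi 0 ×ˢ Ici 0) :=
    (continuousOn_hk_time b m hx).comp (by fun_prop) fun p hp => le_of_lt (show 0 < p.1 from hp.1)
  have hk'' : ∀ s, 0 < s → s ≤ t + 1 → ‖hk b (m + 1) x s‖ ≤ C := fun s h0 h1 =>
    hCb x s h0 h1 (Or.inl (le_abs_self x))
  refine hasDerivAt_integral_volterra (U := fun s r => hk b (m + 1) x s • a r)
    (V := fun s r => hk b (m + 1) x s • a' r) (C := C * max M M') ht
    (hk'.smul (ha.comp (by fun_prop) fun p hp => hp.2))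
    (hk'.smul (ha'.comp (by fun_prop) fun p hp => hp.2))
    (fun s hs r hr => (hd r hr).fun_const_smul _) ?_ ?_
  · intro s r h0 h1 h2 h3
    rw [norm_smul]
    exact mul_le_mul (hk'' s h0 h1) ((hM r ⟨h2, h3⟩).trans (le_max_left _ _)) (norm_nonneg _) hC.le
  · intro s r h0 h1 h2 h3
    rw [norm_smul]
    exact mul_le_mul (hk'' s h0 h1) ((hM' r ⟨h2, h3⟩).trans (le_max_right _ _)) (norm_nonneg _) hC.le

theorem hasDerivAt_layer0_time (ha : ContinuousOn a (Ici 0)) (ha' : ContinuousOn a' (Ici 0))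
    (hd : ∀ r, 0 ≤ r → HasDerivWithinAt a (a' r) (Ici 0) r) {x t : ℝ} (hx : 0 < x) (ht : 0 < t) :
    HasDerivAt (fun t => layer0 a x t) (layer0 a' x t + hk 0 1 x t • a 0) t :=
  hasDerivAt_layer_time 0 0 ha ha' hd hx ht

theorem hasDerivAt_layer1_time (ha : ContinuousOn a (Ici 0)) (ha' : ContinuousOn a' (Ici 0))
    (hd : ∀ r, 0 ≤ r → HasDerivWithinAt a (a' r) (Ici 0) r) {x t : ℝ} (hx : 0 < x) (ht : 0 < t) :
    HasDerivAt (fun t => layer1 a x t) (layer1 a' x t + hk 1 3 x t • a 0) t := by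
  rw [layer1_eq_integral a' hx ht]
  refine (hasDerivAt_layer_time 1 2 ha ha' hd hx ht).congr_of_eventuallyEq ?_
  filter_upwards [lt_mem_nhds ht] with s hs using layer1_eq_integral a hx hs

/-- Differentiation under the integral sign, for kernels bounded away from `x = 0`. -/
theorem hasDerivAt_layer_space {κ κ' : ℝ → ℝ → ℝ} (ha : ContinuousOn a (Ici 0)) {x t : ℝ} (hx : 0 < x)
    (ht : 0 < t) (hκm : ∀ x, Measurable (κ x)) (hκm' : ∀ x, Measurable (κ' x))
    (hd : ∀ s, 0 < s → ∀ x, HasDerivAt (fun x => κ x s) (κ' x s) x) {C : ℝ}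
    (hC : ∀ y s, x / 2 ≤ |y| → 0 < s → s ≤ t → |κ y s| ≤ C)
    (hC' : ∀ y s, x / 2 ≤ |y| → 0 < s → s ≤ t → |κ' y s| ≤ C) :
    HasDerivAt (fun x => ∫ s in (0 : ℝ)..t, κ x s • a (t - s))
      (∫ s in (0 : ℝ)..t, κ' x s • a (t - s)) x := by
  obtain ⟨M, hM⟩ := isCompact_Icc.exists_bound_of_continuousOn
    (ha.mono (Icc_subset_Ici_self : Icc 0 t ⊆ _))
  have ham : AEStronglyMeasurable (fun s => a (t - s)) (volume.restrict (uIoc 0 t)) := by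
    rw [uIoc_of_le ht.le]
    exact ((continuousOn_reflect ha t).mono Ioc_subset_Iic_self).aestronglyMeasurable measurableSet_Ioc
  have hC0 : 0 ≤ C := (abs_nonneg _).trans (hC x t (by rw [abs_of_pos hx]; linarith) ht le_rfl)
  have hb : ∀ κ : ℝ → ℝ → ℝ, (∀ y s, x / 2 ≤ |y| → 0 < s → s ≤ t → |κ y s| ≤ C) →
      ∀ y, x / 2 ≤ |y| → ∀ s ∈ uIoc 0 t, ‖κ y s • a (t - s)‖ ≤ C * M := by
    intro κ h y hy s hs
    rw [uIoc_of_le ht.le] at hs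
    rw [norm_smul]
    exact mul_le_mul (h y s hy hs.1 hs.2) (hM _ ⟨by linarith [hs.2], by linarith [hs.1]⟩)
      (norm_nonneg _) hC0
  have hxx : x / 2 ≤ |x| := by rw [abs_of_pos hx]; linarith
  refine (intervalIntegral.hasDerivAt_integral_of_dominated_loc_of_deriv_le
    (F := fun x s => κ x s • a (t - s)) (F' := fun x s => κ' x s • a (t - s))
    (bound := fun _ => C * M) (s := Ioi (x / 2)) (Ioi_mem_nhds (half_lt_self hx))
    (Eventually.of_forall fun y => (hκm y).aestronglyMeasurable.smul ham) ?_
    ((hκm' x).aestronglyMeasurable.smul ham) (ae_of_all _ fun s hs y hy =>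
      hb κ' hC' y ((le_of_lt hy).trans (le_abs_self y)) s hs) (by simp)
    (ae_of_all _ fun s hs y hy => ?_)).2
  · refine (intervalIntegrable_const (c := C * M)).mono_fun'
      ((hκm x).aestronglyMeasurable.smul ham) ?_
    filter_upwards [ae_restrict_mem measurableSet_uIoc] with s hs using hb κ hC x hxx s hs
  · rw [uIoc_of_le ht.le] at hs
    exact (hd s hs.1 y).smul_const _

/-- The boundary density is not differentiated, as `hk 1 3 = -2 ∂ₓ hk 0 1`. -/
theorem hasDerivAt_layer0_space (ha : ContinuousOn a (Ici 0)) {x t : ℝ} (hx : 0 < x) (ht : 0 < t) :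
    HasDerivAt (fun x => layer0 a x t) (-(layer1 a x t / 2)) x := by
  obtain ⟨A, -, hA⟩ := exists_abs_hk_le 0 1 (half_pos hx) t
  obtain ⟨B, hB0, hB⟩ := exists_abs_hk_le 1 3 (half_pos hx) t
  have h := hasDerivAt_layer_space (κ := fun x s => hk 0 1 x s) (κ' := fun x s => -(hk 1 3 x s / 2))
    (C := max A B) ha hx ht (measurable_hk 0 1) (fun x => ((measurable_hk 1 3 x).div_const 2).neg)
    (fun s hs x => hasDerivAt_hk01 hs)
    (fun y s hy h0 h1 => (hA y s h0 h1 (Or.inl hy)).trans (le_max_left _ _))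
    (fun y s hy h0 h1 => by
      rw [abs_neg, abs_div, abs_two]
      exact (half_le_self (abs_nonneg _)).trans ((hB y s h0 h1 (Or.inl hy)).trans (le_max_right _ _)))
  refine h.congr_deriv ?_
  rw [layer1_eq_integral a hx ht, div_eq_mul_inv, ← intervalIntegral.integral_mul_const,
    ← intervalIntegral.integral_neg]
  congr 1; ext s
  simp only [Complex.real_smul]; push_cast; ring

/-- The space derivative of the double layer potential is turned into a time derivative of the
kernel, which is moved to the density. -/
theorem hasDerivAt_layer1_space (ha : ContinuousOn a (Ici 0)) (ha' : ContinuousOn a' (Ici 0))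
    (hd : ∀ r, 0 ≤ r → HasDerivWithinAt a (a' r) (Ici 0) r) {x t : ℝ} (hx : 0 < x) (ht : 0 < t) :
    HasDerivAt (fun x => layer1 a x t) (-2 * (layer0 a' x t + hk 0 1 x t • a 0)) x := by
  obtain ⟨A, -, hA⟩ := exists_abs_hk_le 1 3 (half_pos hx) t
  obtain ⟨B, hB0, hB⟩ := exists_abs_hk01xx_le (half_pos hx) t
  have hm : ∀ y, Measurable fun s => hk01xx y s := fun y =>
    ((measurable_hk 0 3 y).div_const 2).neg.add ((measurable_hk 2 5 y).div_const 4)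
  have h := hasDerivAt_layer_space (κ := fun x s => hk 1 3 x s) (κ' := fun x s => -2 * hk01xx x s)
    (C := max A (2 * B)) ha hx ht (measurable_hk 1 3) (fun x => (hm x).const_mul (-2))
    (fun s hs x => ((hasDerivAt_neg_half_hk13 hs).const_mul (-2)).congr_of_eventuallyEq
      (Eventually.of_forall fun z => by ring))
    (fun y s hy h0 h1 => (hA y s h0 h1 (Or.inl hy)).trans (le_max_left _ _))
    (fun y s hy h0 h1 => by
      rw [abs_mul, abs_neg, abs_two]
      have := hB y s h0 h1 (Or.inl hy)
      exact le_max_of_le_right (by linarith))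
  have hxx : x / 2 ≤ |x| := by rw [abs_of_pos hx]; linarith
  have i2 := intervalIntegrable_layer0 ha' x ht.le
  have i1 : IntervalIntegrable (fun s => hk01xx x s • a (t - s)) volume 0 t := by
    obtain ⟨M, hM⟩ := isCompact_Icc.exists_bound_of_continuousOn
      (ha.mono (Icc_subset_Ici_self : Icc 0 t ⊆ _))
    rw [intervalIntegrable_iff_integrableOn_Ioc_of_le ht.le]
    refine (integrableOn_const (C := B * M) (by simp)).mono'
      ((hm x).aestronglyMeasurable.smul (((continuousOn_reflect ha t).mono
        Ioc_subset_Iic_self).aestronglyMeasurable measurableSet_Ioc)) ?_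
    filter_upwards [ae_restrict_mem measurableSet_Ioc] with s hs
    rw [norm_smul]
    exact mul_le_mul (hB x s hs.1 hs.2 (Or.inl hxx)) (hM _ ⟨by linarith [hs.2], by linarith [hs.1]⟩)
      (norm_nonneg _) hB0.le
  -- `hk01xx` is both the second space derivative and the time derivative of `hk 0 1`; integration by
  -- parts in time, where the kernel vanishes at `s = 0` because `x > 0`
  have hft := intervalIntegral.integral_eq_sub_of_hasDerivAt_of_le ht.le
    (f := fun s => hk 0 1 x s • a (t - s))
    (f' := fun s => hk01xx x s • a (t - s) - hk 0 1 x s • a' (t - s)) ?_ ?_ (i1.sub i2)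
  · rw [intervalIntegral.integral_sub i1 i2] at hft
    simp only [sub_self, hk_zero_right 0 0, zero_smul, sub_zero] at hft
    have hl : (fun x => layer1 a x t) =ᶠ[𝓝 x] fun x => ∫ s in (0 : ℝ)..t, hk 1 3 x s • a (t - s) := by
      filter_upwards [lt_mem_nhds hx] with y hy using layer1_eq_integral a hy ht
    refine (h.congr_of_eventuallyEq hl).congr_deriv ?_
    have e : ∫ s in (0 : ℝ)..t, (-2 * hk01xx x s) • a (t - s) =
        -2 * ∫ s in (0 : ℝ)..t, hk01xx x s • a (t - s) := by
      rw [← intervalIntegral.integral_const_mul]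
      congr 1; ext s
      simp only [Complex.real_smul]; push_cast; ring
    rw [e, layer0, ← hft]
    ring
  · exact ((continuousOn_hk_time 0 0 hx).mono Icc_subset_Ici_self).smul
      ((continuousOn_reflect ha t).mono Icc_subset_Iic_self)
  · intro s hs
    have h1 : HasDerivAt (fun s => a (t - s)) (-a' (t - s)) s :=
      ((hd _ (by linarith [hs.2])).hasDerivAt (Ici_mem_nhds (by linarith [hs.2]))).comp_const_sub t s
    refine ((hasDerivAt_hk01_time hs.1).smul h1).congr_deriv ?_
    module

end Layer

/-! ### The Duhamel integral -/

/-- Continuous functions on `[0, ∞)²` that are `O((1 + y)⁻²)`, locally uniformly in time. -/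
structure StripDecaying (h : ℝ × ℝ → ℂ) : Prop where
  cont : ContinuousOn h Qbar
  bound : ∀ T, ∃ M, ∀ y r, 0 ≤ y → 0 ≤ r → r ≤ T → (1 + y) ^ 2 * ‖h (y, r)‖ ≤ M

namespace StripDecaying

variable {h : ℝ × ℝ → ℂ}

theorem slice (hh : StripDecaying h) {r : ℝ} (hr : 0 ≤ r) : Decaying fun y => h (y, r) where
  cont := hh.cont.comp (f := fun y => (y, r)) (by fun_prop) fun _ hy => ⟨hy, hr⟩
  bound := (hh.bound r).imp fun _ hM y hy => hM y r hy hr le_rfl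

theorem exists_norm_le (hh : StripDecaying h) (T : ℝ) :
    ∃ M, ∀ y, 0 ≤ y → ∀ r, 0 ≤ r → r ≤ T → ‖h (y, r)‖ ≤ M := by
  obtain ⟨M, hM⟩ := hh.bound T
  refine ⟨M, fun y hy r h0 h1 => le_trans ?_ (hM y r hy h0 h1)⟩
  exact le_mul_of_one_le_left (norm_nonneg _) (one_le_pow₀ (by linarith))

theorem boundary (hh : StripDecaying h) : ContinuousOn (fun r => h (0, r)) (Ici 0) :=
  hh.cont.comp (f := fun r : ℝ => ((0 : ℝ), r)) (by fun_prop) fun _ hr => ⟨le_refl (0 : ℝ), hr⟩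

theorem continuousWithinAt_heatP (hh : StripDecaying h) {σ : ℝ} (hσ : |σ| ≤ 1) {q : ℝ × ℝ × ℝ}
    (hq : 0 ≤ q.2.2) (h0 : q.1 ≠ 0 ∨ √q.2.1 ≠ 0 ∨ σ = 1) :
    ContinuousWithinAt (fun q : ℝ × ℝ × ℝ => heatP σ (fun y => h (y, q.2.2)) q.1 q.2.1)
      {q | 0 ≤ q.2.2} q :=
  continuousWithinAt_heatP_param hσ (h := fun y r => h (y, r)) hh.cont hh.exists_norm_le hq h0

theorem continuousOn_heatP (hh : StripDecaying h) {σ : ℝ} (hσ : |σ| ≤ 1) (x : ℝ) :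
    ContinuousOn (fun p : ℝ × ℝ => heatP σ (fun y => h (y, p.2)) x p.1) (Ioi 0 ×ˢ Ici 0) := by
  intro p hp
  exact (hh.continuousWithinAt_heatP hσ (q := (x, p.1, p.2)) hp.2
    (Or.inr (Or.inl (Real.sqrt_pos.2 hp.1).ne'))).comp (f := fun p : ℝ × ℝ => (x, p.1, p.2))
    (by fun_prop) fun r hr => hr.2

end StripDecaying

/-- The Duhamel integral `∫₀ᵗ` of the heat semigroup applied to the forcing `h`, times `√(4π)`. -/
def heatW (σ : ℝ) (h : ℝ × ℝ → ℂ) (x t : ℝ) : ℂ :=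
  ∫ s in (0 : ℝ)..t, heatP σ (fun y => h (y, t - s)) x s

section HeatW

variable {σ : ℝ} {h h' : ℝ × ℝ → ℂ}

theorem continuousOn_heatW_integrand (hσ : |σ| ≤ 1) (hh : StripDecaying h) (x t : ℝ) :
    ContinuousOn (fun s => heatP σ (fun y => h (y, t - s)) x s) (Ioc 0 t) :=
  (hh.continuousOn_heatP hσ x).comp (f := fun s => (s, t - s)) (by fun_prop)
    fun s hs => ⟨hs.1, sub_nonneg.2 hs.2⟩

theorem intervalIntegrable_heatW (hσ : |σ| ≤ 1) (hh : StripDecaying h) (x : ℝ) {t : ℝ} (ht : 0 ≤ t) :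
    IntervalIntegrable (fun s => heatP σ (fun y => h (y, t - s)) x s) volume 0 t := by
  obtain ⟨C, hC, hCb⟩ := exists_norm_heatP_le t
  obtain ⟨M, hM⟩ := hh.exists_norm_le t
  rw [intervalIntegrable_iff_integrableOn_Ioc_of_le ht]
  refine (integrableOn_const (C := C * M) (by simp)).mono'
    ((continuousOn_heatW_integrand hσ hh x t).aestronglyMeasurable measurableSet_Ioc) ?_
  filter_upwards [ae_restrict_mem measurableSet_Ioc] with s hs
  exact hCb hσ (fun y hy => hM y hy _ (by linarith [hs.2]) (by linarith [hs.1])) x s hs.2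

theorem exists_heatW_le (n : ℕ) (T : ℝ) : ∃ C > 0, ∀ {σ : ℝ}, |σ| ≤ 1 → ∀ {h : ℝ × ℝ → ℂ} {M : ℝ},
    (∀ y r, 0 ≤ y → 0 ≤ r → r ≤ T → (1 + y) ^ n * ‖h (y, r)‖ ≤ M) → ∀ x t : ℝ, 0 ≤ t → t ≤ T →
    (1 + |x|) ^ n * ‖heatW σ h x t‖ ≤ C * M * t := by
  obtain ⟨C, hC, hCb⟩ := exists_heatP_le n T
  refine ⟨C, hC, fun {σ} hσ {h M} hM x t ht htT => ?_⟩
  have hx : (0 : ℝ) < (1 + |x|) ^ n := by positivity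
  have h1 : ‖heatW σ h x t‖ ≤ C * M / (1 + |x|) ^ n * |t - 0| := by
    refine intervalIntegral.norm_integral_le_of_norm_le_const fun s hs => ?_
    rw [uIoc_of_le ht] at hs
    rw [le_div_iff₀' hx]
    exact hCb hσ (fun y hy => hM y _ hy (by linarith [hs.2]) (by linarith [hs.1])) x s
      (hs.2.trans htT)
  rw [sub_zero, abs_of_nonneg ht] at h1
  calc (1 + |x|) ^ n * ‖heatW σ h x t‖ ≤ (1 + |x|) ^ n * _ := mul_le_mul_of_nonneg_left h1 hx.le
    _ = _ := by field_simp

theorem heatW_add (hσ : |σ| ≤ 1) (hh : StripDecaying h) (hh' : StripDecaying h') (x : ℝ) {t : ℝ}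
    (ht : 0 ≤ t) : heatW σ (fun p => h p + h' p) x t = heatW σ h x t + heatW σ h' x t := by
  unfold heatW
  rw [← intervalIntegral.integral_add (intervalIntegrable_heatW hσ hh x ht)
    (intervalIntegrable_heatW hσ hh' x ht)]
  refine intervalIntegral.integral_congr fun s hs => ?_
  rw [uIcc_of_le ht] at hs
  have d := hh.slice (sub_nonneg.2 hs.2)
  have d' := hh'.slice (sub_nonneg.2 hs.2)
  exact heatP_add hσ d.cont d'.cont d.exists_norm_le d'.exists_norm_le x s

theorem heatW_const_mul (σ : ℝ) (c : ℂ) (h : ℝ × ℝ → ℂ) (x t : ℝ) :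
    heatW σ (fun p => c * h p) x t = c * heatW σ h x t := by
  unfold heatW
  rw [← intervalIntegral.integral_const_mul]
  simp only [heatP_const_mul]

/-- The scaling `s = tθ` makes the interval of integration independent of `t`. -/
theorem heatW_eq_smul (σ : ℝ) (h : ℝ × ℝ → ℂ) (x t : ℝ) :
    heatW σ h x t = t • ∫ θ in (0 : ℝ)..1, heatP σ (fun y => h (y, t - t * θ)) x (t * θ) := by
  have := intervalIntegral.smul_integral_comp_mul_left (a := 0) (b := 1)
    (fun s => heatP σ (fun y => h (y, t - s)) x s) t
  rw [this, mul_zero, mul_one, heatW]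

theorem continuousWithinAt_heatW (hσ : |σ| ≤ 1) (hh : StripDecaying h) {p : ℝ × ℝ} (hp : 0 ≤ p.2) :
    ContinuousWithinAt (fun p : ℝ × ℝ => heatW σ h p.1 p.2) {q | 0 ≤ q.2} p := by
  obtain ⟨M, hM⟩ := hh.exists_norm_le (p.2 + 1)
  have hlt : ∀ᶠ q : ℝ × ℝ in 𝓝 p, q.2 < p.2 + 1 :=
    (continuous_snd.tendsto p).eventually (gt_mem_nhds (lt_add_one _))
  rcases hp.lt_or_eq with h0 | h0
  · obtain ⟨C, hC, hCb⟩ := exists_norm_heatP_le (p.2 + 1)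
    have hgt : ∀ᶠ q : ℝ × ℝ in 𝓝 p, 0 < q.2 :=
      (continuous_snd.tendsto p).eventually (lt_mem_nhds h0)
    refine ContinuousAt.continuousWithinAt ?_
    simp only [heatW_eq_smul]
    refine continuous_snd.continuousAt.smul
      (intervalIntegral.continuousAt_of_dominated_interval (bound := fun _ => C * M) ?_ ?_ ?_ ?_)
    · filter_upwards [hgt] with q hq
      rw [uIoc_of_le zero_le_one]
      refine ContinuousOn.aestronglyMeasurable ((hh.continuousOn_heatP hσ q.1).comp
        (f := fun θ => (q.2 * θ, q.2 - q.2 * θ)) (by fun_prop) fun θ hθ => ⟨?_, ?_⟩)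
        measurableSet_Ioc
      · exact mul_pos hq hθ.1
      · show 0 ≤ q.2 - q.2 * θ
        nlinarith [hθ.2]
    · filter_upwards [hgt, hlt] with q hq hq'
      refine ae_of_all _ fun θ hθ => ?_
      rw [uIoc_of_le zero_le_one] at hθ
      have h2 : q.2 * θ ≤ q.2 := mul_le_of_le_one_right hq.le hθ.2
      have h3 : 0 < q.2 * θ := mul_pos hq hθ.1
      exact hCb hσ (fun y hy => hM y hy _ (by linarith) (by linarith)) _ _ (by linarith)
    · simp
    · have hne : ∀ᵐ θ : ℝ, θ ≠ 1 := by simp [ae_iff, measure_singleton]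
      filter_upwards [hne] with θ hθ1 hθ
      rw [uIoc_of_le zero_le_one] at hθ
      have hθ1 : θ < 1 := lt_of_le_of_ne hθ.2 hθ1
      have h1 : 0 < p.2 - p.2 * θ := by nlinarith
      have h2 := hh.continuousWithinAt_heatP hσ (q := (p.1, p.2 * θ, p.2 - p.2 * θ)) h1.le
        (Or.inr (Or.inl (Real.sqrt_pos.2 (mul_pos h0 hθ.1)).ne'))
      have h3 := h2.continuousAt (by
        have : Continuous fun q : ℝ × ℝ × ℝ => q.2.2 := by fun_prop
        exact (this.tendsto _).eventually (Ici_mem_nhds h1))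
      exact ContinuousAt.comp (f := fun q : ℝ × ℝ => (q.1, q.2 * θ, q.2 - q.2 * θ)) h3 (by fun_prop)
  -- at `t = 0` the integral is `O(t)`
  · obtain ⟨C, hC, hCb⟩ := exists_heatW_le 0 (p.2 + 1)
    have hv : heatW σ h p.1 p.2 = 0 := by simp [heatW, ← h0]
    rw [ContinuousWithinAt, hv]
    refine squeeze_zero_norm' (a := fun q : ℝ × ℝ => C * M * q.2) ?_ ?_
    · filter_upwards [self_mem_nhdsWithin, nhdsWithin_le_nhds hlt] with q hq hq'
      simpa using hCb hσ (h := h) (M := M) (fun y r hy hr hrT => by simpa using hM y hy r hr hrT)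
        q.1 q.2 hq hq'.le
    · have : Continuous fun q : ℝ × ℝ => C * M * q.2 := by fun_prop
      have := this.tendsto p
      rw [← h0, mul_zero] at this
      exact this.mono_left nhdsWithin_le_nhds

/-- The boundary terms of the space derivatives of the semigroup add up to a single layer potential. -/
theorem hasDerivAt_heatW_space (hσ : |σ| ≤ 1) (hh : StripDecaying h) (hh' : StripDecaying h')
    (hd : ∀ y r, 0 ≤ y → 0 ≤ r → HasDerivWithinAt (fun y => h (y, r)) (h' (y, r)) (Ici 0) y)
    {x t : ℝ} (hx : 0 < x) (ht : 0 < t) :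
    HasDerivAt (fun x => heatW σ h x t)
      ((1 - σ) * layer0 (fun r => h (0, r)) x t + heatW (-σ) h' x t) x := by
  have hσ' : |(-σ)| ≤ 1 := by rwa [abs_neg]
  obtain ⟨C, hC, hCb⟩ := exists_norm_heatP_le t
  obtain ⟨K, hK, hKb⟩ := exists_abs_hk_le 0 1 (half_pos hx) t
  obtain ⟨M, hM⟩ := hh.exists_norm_le t
  obtain ⟨M', hM'⟩ := hh'.exists_norm_le t
  set F' : ℝ → ℝ → ℂ := fun x s => ((1 - σ) * hk 0 1 x s) • h (0, t - s) +
    heatP (-σ) (fun y => h' (y, t - s)) x s with hF'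
  have hm : ∀ x, AEStronglyMeasurable (fun s => heatP σ (fun y => h (y, t - s)) x s)
      (volume.restrict (uIoc 0 t)) := fun x => by
    rw [uIoc_of_le ht.le]
    exact (continuousOn_heatW_integrand hσ hh x t).aestronglyMeasurable measurableSet_Ioc
  have hm' : AEStronglyMeasurable (F' x) (volume.restrict (uIoc 0 t)) := by
    rw [uIoc_of_le ht.le]
    exact (((measurable_hk 0 1 x).const_mul _).aestronglyMeasurable.smul
      (((continuousOn_reflect hh.boundary t).mono Ioc_subset_Iic_self).aestronglyMeasurable
        measurableSet_Ioc)).add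
      ((continuousOn_heatW_integrand hσ' hh' x t).aestronglyMeasurable measurableSet_Ioc)
  have key := (intervalIntegral.hasDerivAt_integral_of_dominated_loc_of_deriv_le
    (F := fun x s => heatP σ (fun y => h (y, t - s)) x s) (F' := F')
    (bound := fun _ => 2 * K * M + C * M') (s := Ioi (x / 2)) (Ioi_mem_nhds (half_lt_self hx))
    (Eventually.of_forall hm) (intervalIntegrable_heatW hσ hh x ht.le) hm'
    (ae_of_all _ fun s hs y hy => ?_) (by simp) (ae_of_all _ fun s hs y hy => ?_)).2
  · have e : (1 - σ : ℂ) * layer0 (fun r => h (0, r)) x t + heatW (-σ) h' x t =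
        ∫ s in (0 : ℝ)..t, F' x s := by
      simp only [hF']
      rw [layer0, heatW, ← intervalIntegral.integral_const_mul, ← intervalIntegral.integral_add
        ((intervalIntegrable_layer0 hh.boundary x ht.le).const_mul _)
        (intervalIntegrable_heatW hσ' hh' x ht.le)]
      congr 1; ext s
      simp only [Complex.real_smul]; push_cast; ring
    rw [e]
    exact key
  · rw [uIoc_of_le ht.le] at hs
    have hs1 : 0 ≤ t - s := sub_nonneg.2 hs.2
    have hs2 : t - s ≤ t := by linarith [hs.1]
    -- away from `y = 0` the boundary term is bounded in spite of the singularity of the kernel at `s = 0`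
    have hy : x / 2 ≤ |y| := (le_of_lt hy).trans (le_abs_self y)
    refine (norm_add_le _ _).trans (add_le_add ?_ (hCb hσ' (fun z hz => hM' z hz _ hs1 hs2) y s hs.2))
    rw [norm_smul, norm_mul]
    refine mul_le_mul (mul_le_mul ?_ (hKb y s hs.1 hs.2 (Or.inl hy)) (norm_nonneg _) zero_le_two)
      (hM 0 le_rfl _ hs1 hs2) (norm_nonneg _) (by positivity)
    rw [Real.norm_eq_abs, abs_le]
    have := abs_le.1 hσ
    constructor <;> linarith
  · rw [uIoc_of_le ht.le] at hs
    have hs1 : 0 ≤ t - s := sub_nonneg.2 hs.2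
    exact hasDerivAt_heatP_space hσ (hh.slice hs1) (hh'.slice hs1) (fun z hz => hd z _ hz hs1) y hs.1

theorem hasDerivWithinAt_heatP_param (hσ : |σ| ≤ 1) (hh : StripDecaying h) (hh' : StripDecaying h')
    (hd : ∀ y r, 0 ≤ y → 0 ≤ r → HasDerivWithinAt (fun r => h (y, r)) (h' (y, r)) (Ici 0) r)
    (x s : ℝ) {r : ℝ} (hr : 0 ≤ r) :
    HasDerivWithinAt (fun r => heatP σ (fun y => h (y, r)) x s)
      (heatP σ (fun y => h' (y, r)) x s) (Ici 0) r := by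
  obtain ⟨M', hM'⟩ := hh'.exists_norm_le (r + 1)
  -- the difference quotients converge dominatedly
  rw [hasDerivWithinAt_iff_tendsto_slope]
  have hslope : ∀ r' ∈ Ici 0 \ {r}, slope (fun r => heatP σ (fun y => h (y, r)) x s) r r' =
      ∫ z, (gker z * sgf σ (x - √s * z)) • slope (fun r => h (|x - √s * z|, r)) r r' := by
    intro r' hr'
    have d := hh.slice hr
    have d' := hh.slice (show 0 ≤ r' from hr'.1)
    rw [slope_def_module, heatP, heatP, ← integral_sub (integrable_heatP hσ d'.cont d'.exists_norm_le x s)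
      (integrable_heatP hσ d.cont d.exists_norm_le x s), ← integral_smul]
    congr 1; ext z
    rw [slope_def_module, ← smul_sub, smul_comm]
  refine Tendsto.congr' (f₁ := fun r' => ∫ z, (gker z * sgf σ (x - √s * z)) •
    slope (fun r => h (|x - √s * z|, r)) r r') ?_ ?_
  · filter_upwards [self_mem_nhdsWithin] with r' hr' using (hslope r' hr').symm
  refine tendsto_integral_filter_of_dominated_convergence (fun z => gker z * M') ?_ ?_
    (integrable_gker.mul_const M') (ae_of_all _ fun z => ?_)
  · filter_upwards [self_mem_nhdsWithin] with r' hr'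
    have d := hh.slice hr
    have d' := hh.slice (show 0 ≤ r' from hr'.1)
    have := ((aestronglyMeasurable_heatP σ d'.cont x s).sub
      (aestronglyMeasurable_heatP σ d.cont x s)).const_smul (r' - r)⁻¹
    refine this.congr (ae_of_all _ fun z => ?_)
    simp only [Pi.smul_apply, Pi.sub_apply]
    rw [slope_def_module, ← smul_sub, smul_comm]
  · have hlt : ∀ᶠ r' in 𝓝[Ici 0 \ {r}] r, r' < r + 1 :=
      nhdsWithin_le_nhds (gt_mem_nhds (lt_add_one r))
    filter_upwards [self_mem_nhdsWithin, hlt] with r' hr' hr1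
    refine ae_of_all _ fun z => ?_
    have hne : r' - r ≠ 0 := sub_ne_zero.2 hr'.2
    have := (convex_Icc (0 : ℝ) (r + 1)).norm_image_sub_le_of_norm_hasDerivWithin_le
      (f := fun r => h (|x - √s * z|, r)) (f' := fun r => h' (|x - √s * z|, r)) (C := M')
      (fun ρ hρ => (hd _ ρ (abs_nonneg _) hρ.1).mono Icc_subset_Ici_self)
      (fun ρ hρ => hM' _ (abs_nonneg _) ρ hρ.1 hρ.2)
      (show r ∈ Icc 0 (r + 1) from ⟨hr, by linarith⟩) (show r' ∈ Icc 0 (r + 1) from ⟨hr'.1, hr1.le⟩)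
    rw [norm_smul, norm_mul, Real.norm_of_nonneg (gker_pos z).le, Real.norm_eq_abs]
    have h1 : ‖slope (fun r => h (|x - √s * z|, r)) r r'‖ ≤ M' := by
      rw [slope_def_module, norm_smul, norm_inv, inv_mul_le_iff₀ (norm_pos_iff.2 hne)]
      exact this.trans (mul_comm _ _).le
    calc gker z * |sgf σ (x - √s * z)| * _ ≤ gker z * 1 * M' := by
          have := (gker_pos z).le
          have := abs_sgf_le hσ (x - √s * z)
          gcongr
      _ = _ := by ring
  · have := (hasDerivWithinAt_iff_tendsto_slope.1 (hd |x - √s * z| r (abs_nonneg _) hr))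
    exact this.const_smul _

/-- The boundary term of the Leibniz rule is the semigroup applied to the forcing at time zero. -/
theorem hasDerivAt_heatW_time (hσ : |σ| ≤ 1) (hh : StripDecaying h) (hh' : StripDecaying h')
    (hd : ∀ y r, 0 ≤ y → 0 ≤ r → HasDerivWithinAt (fun r => h (y, r)) (h' (y, r)) (Ici 0) r)
    (x : ℝ) {t : ℝ} (ht : 0 < t) :
    HasDerivAt (fun t => heatW σ h x t)
      (heatW σ h' x t + heatP σ (fun y => h (y, 0)) x t) t := by
  obtain ⟨C, hC, hCb⟩ := exists_norm_heatP_le (t + 1)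
  obtain ⟨M, hM⟩ := hh.exists_norm_le (t + 1)
  obtain ⟨M', hM'⟩ := hh'.exists_norm_le (t + 1)
  refine hasDerivAt_integral_volterra (U := fun s r => heatP σ (fun y => h (y, r)) x s)
    (V := fun s r => heatP σ (fun y => h' (y, r)) x s) (C := C * max M M') ht
    (hh.continuousOn_heatP hσ x) (hh'.continuousOn_heatP hσ x)
    (fun s _ r hr => hasDerivWithinAt_heatP_param hσ hh hh' hd x s hr) ?_ ?_
  · exact fun s r h0 h1 h2 h3 => hCb hσ
      (fun y hy => (hM y hy r h2 h3).trans (le_max_left _ _)) x s h1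
  · exact fun s r h0 h1 h2 h3 => hCb hσ
      (fun y hy => (hM' y hy r h2 h3).trans (le_max_right _ _)) x s h1

end HeatW

/-! ### Data depending linearly on a parameter -/

section Jets

variable {D : Type*} [AddCommGroup D] [Module ℂ D] [TopologicalSpace D]

/-- Functions on `[0, ∞)` that depend linearly on `d : D`, given together with all their
derivatives: `φ k y d` is the `k`-th derivative at `y`. All derivatives decrease rapidly, with
bounds that are continuous in `d`. -/
structure SchwartzJet (φ : ℕ → ℝ → D →ₗ[ℂ] ℂ) : Prop where
  deriv : ∀ k d y, 0 ≤ y → HasDerivWithinAt (fun y => φ k y d) (φ (k + 1) y d) (Ici 0) y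
  bound : ∀ k N : ℕ, ∃ p : Seminorm ℂ D, Continuous p ∧
    ∀ d y, 0 ≤ y → (1 + y) ^ N * ‖φ k y d‖ ≤ p d

/-- Like `SchwartzJet`, with bounds on bounded intervals only. -/
structure SmoothJet (a : ℕ → ℝ → D →ₗ[ℂ] ℂ) : Prop where
  deriv : ∀ k d t, 0 ≤ t → HasDerivWithinAt (fun t => a k t d) (a (k + 1) t d) (Ici 0) t
  bound : ∀ (k : ℕ) (T : ℝ), ∃ p : Seminorm ℂ D, Continuous p ∧
    ∀ d t, 0 ≤ t → t ≤ T → ‖a k t d‖ ≤ p d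

/-- Functions on `[0, ∞)²` that depend linearly on `d : D`, given together with all their partial
derivatives: `f k l (y, t) d` is the derivative of order `k` in `y` and `l` in `t`. -/
structure StripJet (f : ℕ → ℕ → ℝ × ℝ → D →ₗ[ℂ] ℂ) : Prop where
  cont : ∀ k l d, ContinuousOn (fun q => f k l q d) Qbar
  deriv_space : ∀ k l d y t, 0 ≤ y → 0 ≤ t →
    HasDerivWithinAt (fun y => f k l (y, t) d) (f (k + 1) l (y, t) d) (Ici 0) y
  deriv_time : ∀ k l d y t, 0 ≤ y → 0 ≤ t →
    HasDerivWithinAt (fun t => f k l (y, t) d) (f k (l + 1) (y, t) d) (Ici 0) t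
  bound : ∀ (k l N : ℕ) (T : ℝ), ∃ p : Seminorm ℂ D, Continuous p ∧
    ∀ d y t, 0 ≤ y → 0 ≤ t → t ≤ T → (1 + y) ^ N * ‖f k l (y, t) d‖ ≤ p d

theorem exists_seminorm_const_mul {p : Seminorm ℂ D} (hp : Continuous p) {C : ℝ} (hC : 0 ≤ C) :
    ∃ q : Seminorm ℂ D, Continuous q ∧ ∀ d, q d = C * p d :=
  have h : ∀ d, (C.toNNReal • p) d = C * p d := fun d => by
    rw [smul_apply, NNReal.smul_def, Real.coe_toNNReal C hC, smul_eq_mul]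
  ⟨C.toNNReal • p, (hp.const_mul C).congr fun d => (h d).symm, h⟩

theorem exists_seminorm_add {p q : Seminorm ℂ D} (hp : Continuous p) (hq : Continuous q) :
    ∃ r : Seminorm ℂ D, Continuous r ∧ ∀ d, r d = p d + q d :=
  ⟨p + q, hp.add hq, fun _ => rfl⟩

namespace SchwartzJet

variable {φ ψ : ℕ → ℝ → D →ₗ[ℂ] ℂ}

theorem decaying (h : SchwartzJet φ) (k : ℕ) (d : D) : Decaying fun y => φ k y d where
  cont y hy := (h.deriv k d y hy).continuousWithinAt
  bound := by
    obtain ⟨p, -, hp⟩ := h.bound k 2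
    exact ⟨p d, hp d⟩

theorem shift (h : SchwartzJet φ) : SchwartzJet fun k => φ (k + 1) :=
  ⟨fun k => h.deriv (k + 1), fun k => h.bound (k + 1)⟩

theorem add (h : SchwartzJet φ) (h' : SchwartzJet ψ) : SchwartzJet fun k y => φ k y + ψ k y where
  deriv k d y hy := (h.deriv k d y hy).add (h'.deriv k d y hy)
  bound k N := by
    obtain ⟨p, hp, hpb⟩ := h.bound k N
    obtain ⟨q, hq, hqb⟩ := h'.bound k N
    obtain ⟨r, hr, hrb⟩ := exists_seminorm_add hp hq
    refine ⟨r, hr, fun d y hy => ?_⟩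
    rw [hrb, LinearMap.add_apply]
    calc _ ≤ (1 + y) ^ N * (‖φ k y d‖ + ‖ψ k y d‖) := by gcongr; exact norm_add_le _ _
      _ ≤ _ := by rw [mul_add]; exact add_le_add (hpb d y hy) (hqb d y hy)

theorem functional_bound (h : SchwartzJet φ) (k : ℕ) :
    ∃ p : Seminorm ℂ D, Continuous p ∧ ∀ d, ‖φ k 0 d‖ ≤ p d := by
  obtain ⟨p, hp, hpb⟩ := h.bound k 0
  exact ⟨p, hp, fun d => by simpa using hpb d 0 le_rfl⟩

end SchwartzJet

namespace SmoothJet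

variable {a b : ℕ → ℝ → D →ₗ[ℂ] ℂ}

theorem cont (h : SmoothJet a) (k : ℕ) (d : D) : ContinuousOn (fun t => a k t d) (Ici 0) :=
  fun t ht => (h.deriv k d t ht).continuousWithinAt

theorem shift (h : SmoothJet a) : SmoothJet fun k => a (k + 1) :=
  ⟨fun k => h.deriv (k + 1), fun k => h.bound (k + 1)⟩

theorem sub (h : SmoothJet a) (h' : SmoothJet b) : SmoothJet fun k t => a k t - b k t where
  deriv k d t ht := (h.deriv k d t ht).sub (h'.deriv k d t ht)
  bound k T := by
    obtain ⟨p, hp, hpb⟩ := h.bound k T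
    obtain ⟨q, hq, hqb⟩ := h'.bound k T
    obtain ⟨r, hr, hrb⟩ := exists_seminorm_add hp hq
    refine ⟨r, hr, fun d t ht htT => ?_⟩
    rw [hrb, LinearMap.sub_apply]
    exact (norm_sub_le _ _).trans (add_le_add (hpb d t ht htT) (hqb d t ht htT))

theorem functional_bound (h : SmoothJet a) (k : ℕ) :
    ∃ p : Seminorm ℂ D, Continuous p ∧ ∀ d, ‖a k 0 d‖ ≤ p d := by
  obtain ⟨p, hp, hpb⟩ := h.bound k 0
  exact ⟨p, hp, fun d => hpb d 0 le_rfl le_rfl⟩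

end SmoothJet

namespace StripJet

variable {f : ℕ → ℕ → ℝ × ℝ → D →ₗ[ℂ] ℂ}

theorem stripDecaying (h : StripJet f) (k l : ℕ) (d : D) : StripDecaying fun q => f k l q d where
  cont := h.cont k l d
  bound T := by
    obtain ⟨p, -, hp⟩ := h.bound k l 2 T
    exact ⟨p d, hp d⟩

theorem shift_space (h : StripJet f) : StripJet fun k => f (k + 1) :=
  ⟨fun k => h.cont (k + 1), fun k => h.deriv_space (k + 1), fun k => h.deriv_time (k + 1),
    fun k => h.bound (k + 1)⟩

theorem shift_time (h : StripJet f) : StripJet fun k l => f k (l + 1) :=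
  ⟨fun k l => h.cont k (l + 1), fun k l => h.deriv_space k (l + 1),
    fun k l => h.deriv_time k (l + 1), fun k l => h.bound k (l + 1)⟩

theorem initial (h : StripJet f) : SchwartzJet fun k y => f k 0 (y, 0) where
  deriv k d y hy := h.deriv_space k 0 d y 0 hy le_rfl
  bound k N := (h.bound k 0 N 0).imp fun _ hp =>
    ⟨hp.1, fun d y hy => hp.2 d y 0 hy le_rfl le_rfl⟩

theorem boundary (h : StripJet f) : SmoothJet fun l t => f 0 l (0, t) where
  deriv l d t ht := h.deriv_time 0 l d 0 t le_rfl ht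
  bound l T := (h.bound 0 l 0 T).imp fun _ hp =>
    ⟨hp.1, fun d t ht htT => by simpa using hp.2 d 0 t le_rfl ht htT⟩

end StripJet

/-! ### Heat operators -/

/-- The class of operators, from `D` to functions on the quarter-plane, that is generated by the
heat semigroup, the layer potentials, the Duhamel integral and the heat kernels with pole at the
origin. It is closed under both partial derivatives. -/
inductive IsHeatOp : (D → ℝ × ℝ → ℂ) → Prop
  | semigroup {σ : ℝ} (hσ : |σ| ≤ 1) {φ : ℕ → ℝ → D →ₗ[ℂ] ℂ} (hφ : SchwartzJet φ) :
      IsHeatOp fun d p => heatP σ (fun y => φ 0 y d) p.1 p.2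
  | single {a : ℕ → ℝ → D →ₗ[ℂ] ℂ} (ha : SmoothJet a) :
      IsHeatOp fun d p => layer0 (fun r => a 0 r d) p.1 p.2
  | double {a : ℕ → ℝ → D →ₗ[ℂ] ℂ} (ha : SmoothJet a) :
      IsHeatOp fun d p => layer1 (fun r => a 0 r d) p.1 p.2
  | duhamel {σ : ℝ} (hσ : |σ| ≤ 1) {f : ℕ → ℕ → ℝ × ℝ → D →ₗ[ℂ] ℂ} (hf : StripJet f) :
      IsHeatOp fun d p => heatW σ (fun q => f 0 0 q d) p.1 p.2
  | kernel (b m : ℕ) {c : D →ₗ[ℂ] ℂ} (hc : ∃ p : Seminorm ℂ D, Continuous p ∧ ∀ d, ‖c d‖ ≤ p d) :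
      IsHeatOp fun d p => hk b (m + 1) p.1 p.2 • c d
  | add {H₁ H₂ : D → ℝ × ℝ → ℂ} (h₁ : IsHeatOp H₁) (h₂ : IsHeatOp H₂) :
      IsHeatOp fun d p => H₁ d p + H₂ d p
  | const_mul (c : ℂ) {H : D → ℝ × ℝ → ℂ} (h : IsHeatOp H) : IsHeatOp fun d p => c * H d p

theorem mem_Qpunct {p : ℝ × ℝ} : p ∈ Qpunct ↔ (0 ≤ p.1 ∧ 0 ≤ p.2) ∧ (p.1 ≠ 0 ∨ p.2 ≠ 0) := by
  have : p ∈ Qpunct ↔ p ∈ Qbar ∧ p ≠ (0, 0) := Iff.rfl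
  rw [this, ne_eq, Prod.ext_iff, not_and_or]
  rfl

namespace IsHeatOp

variable {H : D → ℝ × ℝ → ℂ}

theorem map_add (h : IsHeatOp H) (d d' : D) {p : ℝ × ℝ} (hp : p ∈ Qbar) :
    H (d + d') p = H d p + H d' p := by
  induction h with
  | semigroup hσ hφ =>
    simp only [_root_.map_add]
    have a := hφ.decaying 0 d
    have b := hφ.decaying 0 d'
    exact heatP_add hσ a.cont b.cont a.exists_norm_le b.exists_norm_le _ _
  | single ha =>
    simp only [_root_.map_add]
    exact layer0_add (ha.cont 0 d) (ha.cont 0 d') _ hp.2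
  | double ha =>
    simp only [_root_.map_add]
    exact layer1_add (ha.cont 0 d) (ha.cont 0 d') _ _
  | duhamel hσ hf =>
    simp only [_root_.map_add]
    exact heatW_add hσ (hf.stripDecaying 0 0 d) (hf.stripDecaying 0 0 d') _ hp.2
  | kernel b m hc => simp
  | add _ _ ih₁ ih₂ => simp only [ih₁, ih₂]; ring
  | const_mul c _ ih => simp only [ih]; ring

theorem map_smul (h : IsHeatOp H) (c : ℂ) (d : D) (p : ℝ × ℝ) : H (c • d) p = c * H d p := by
  induction h with
  | semigroup hσ hφ => simp only [_root_.map_smul, smul_eq_mul, heatP_const_mul]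
  | single ha => simp only [_root_.map_smul, smul_eq_mul, layer0_const_mul]
  | double ha => simp only [_root_.map_smul, smul_eq_mul, layer1_const_mul]
  | duhamel hσ hf => simp only [_root_.map_smul, smul_eq_mul, heatW_const_mul]
  | kernel b m hc => simp only [_root_.map_smul, smul_eq_mul, mul_smul_comm]
  | add _ _ ih₁ ih₂ => simp only [ih₁, ih₂]; ring
  | const_mul c _ ih => simp only [ih]; ring

theorem continuousOn (h : IsHeatOp H) (d : D) : ContinuousOn (H d) Qpunct := by
  have hsub : Qpunct ⊆ {q : ℝ × ℝ | 0 ≤ q.2} := fun q hq => (mem_Qpunct.1 hq).1.2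
  have hne : ∀ p ∈ Qpunct, p.1 ≠ 0 ∨ √p.2 ≠ 0 := fun p hp =>
    (mem_Qpunct.1 hp).2.imp id fun h => (Real.sqrt_ne_zero (mem_Qpunct.1 hp).1.2).2 h
  induction h with
  | semigroup hσ hφ =>
    intro p hp
    have a := hφ.decaying 0 d
    exact (continuousAt_heatP hσ a.cont a.exists_norm_le
      ((hne p hp).imp id Or.inl)).continuousWithinAt
  | single ha => exact fun p hp => (continuousWithinAt_layer0 (ha.cont 0 d) (hsub hp)).mono hsub
  | double ha =>
    exact fun p hp => (continuousWithinAt_layer1 (ha.cont 0 d) (hsub hp) (hne p hp)).mono hsub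
  | duhamel hσ hf =>
    exact fun p hp => (continuousWithinAt_heatW hσ (hf.stripDecaying 0 0 d) (hsub hp)).mono hsub
  | kernel b m hc =>
    exact fun p hp => ((continuousWithinAt_hk b m (hsub hp) (mem_Qpunct.1 hp).2).mono
      hsub).smul_const _
  | add _ _ ih₁ ih₂ => exact ih₁.add ih₂
  | const_mul c _ ih => exact continuousOn_const.mul ih

/-- The weighted bounds on `Λ_n` that control the seminorms of `𝒮₁(Q̄ − {(0,0)})`. -/
theorem exists_bound (h : IsHeatOp H) (N : ℕ) (n : ℕ+) : ∃ p : Seminorm ℂ D, Continuous p ∧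
    ∀ d, ∀ q ∈ stripPunct n, (1 + q.1) ^ N * ‖H d q‖ ≤ p d := by
  have hn : (1 : ℝ) ≤ (n : ℕ) := by exact_mod_cast (one_le : (1 : ℕ+) ≤ n)
  have hn' : 1 / ((n : ℕ) : ℝ) ≤ (n : ℕ) := by
    rw [div_le_iff₀ (by linarith)]; nlinarith
  have hT : ∀ q ∈ stripPunct n, 0 ≤ q.1 ∧ 0 ≤ q.2 ∧ q.2 ≤ (n : ℕ) := by
    rintro q (⟨h, -, h2⟩ | ⟨h, -, h2⟩)
    · exact ⟨h.1, h.2, h2⟩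
    · exact ⟨h.1, h.2, h2.trans hn'⟩
  induction h with
  | semigroup hσ hφ =>
    obtain ⟨C, hC, hCb⟩ := exists_heatP_le N (n : ℕ)
    obtain ⟨p, hp, hpb⟩ := hφ.bound 0 N
    obtain ⟨r, hr, hrb⟩ := exists_seminorm_const_mul hp hC.le
    refine ⟨r, hr, fun d q hq => ?_⟩
    have := hCb hσ (hpb d) q.1 q.2 (hT q hq).2.2
    rwa [abs_of_nonneg (hT q hq).1, ← hrb] at this
  | single ha =>
    obtain ⟨C, hC, hCb⟩ := exists_layer0_le N (n : ℕ)
    obtain ⟨p, hp, hpb⟩ := ha.bound 0 (n : ℕ)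
    obtain ⟨r, hr, hrb⟩ := exists_seminorm_const_mul hp
      (C := C * ((n : ℕ) : ℝ) ^ (1 / 2 : ℝ)) (by positivity)
    refine ⟨r, hr, fun d q hq => ?_⟩
    have := hCb (hpb d) q.1 q.2 (hT q hq).2.1 (hT q hq).2.2
    rw [abs_of_nonneg (hT q hq).1] at this
    refine this.trans ?_
    rw [hrb]
    have := apply_nonneg p d
    have h2 := (hT q hq).2.1
    have h3 := (hT q hq).2.2
    gcongr
  | double ha =>
    obtain ⟨C, hC, hCb⟩ := exists_layer1_le N (n : ℕ)
    obtain ⟨p, hp, hpb⟩ := ha.bound 0 (n : ℕ)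
    obtain ⟨r, hr, hrb⟩ := exists_seminorm_const_mul hp hC.le
    refine ⟨r, hr, fun d q hq => ?_⟩
    have := hCb (hpb d) q.1 q.2 (hT q hq).2.1 (hT q hq).2.2
    rwa [abs_of_nonneg (hT q hq).1, ← hrb] at this
  | @duhamel σ hσ f hf =>
    obtain ⟨C, hC, hCb⟩ := exists_heatW_le N (n : ℕ)
    obtain ⟨p, hp, hpb⟩ := hf.bound 0 0 N (n : ℕ)
    obtain ⟨r, hr, hrb⟩ := exists_seminorm_const_mul hp (C := C * (n : ℕ)) (by positivity)
    refine ⟨r, hr, fun d q hq => ?_⟩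
    have := hCb hσ (h := fun q => f 0 0 q d) (hpb d) q.1 q.2 (hT q hq).2.1 (hT q hq).2.2
    rw [abs_of_nonneg (hT q hq).1] at this
    refine this.trans ?_
    rw [hrb, mul_right_comm]
    have := apply_nonneg p d
    have h3 := (hT q hq).2.2
    gcongr
  -- on `stripPunct n` either `x ≥ 1/n` or `t ≥ 1/n`, so that the pole of the kernel is avoided
  | kernel b m hc =>
    obtain ⟨C, hC, hCb⟩ := exists_hk_le b (m + 1) N (δ := 1 / ((n : ℕ) : ℝ)) (by positivity) (n : ℕ)
    obtain ⟨p, hp, hpb⟩ := hc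
    obtain ⟨r, hr, hrb⟩ := exists_seminorm_const_mul hp hC.le
    refine ⟨r, hr, fun d q hq => ?_⟩
    rw [norm_smul, hrb, ← mul_assoc]
    refine mul_le_mul ?_ (hpb d) (norm_nonneg _) hC.le
    obtain ⟨h1, h2, h3⟩ := hT q hq
    rcases h2.lt_or_eq with h2 | h2
    · have := hCb q.1 q.2 h2 h3 ?_
      · rwa [abs_of_nonneg h1] at this
      · rw [abs_of_nonneg h1]
        rcases hq with hq | hq
        · exact Or.inr hq.2.1
        · exact Or.inl hq.2.1
    · rw [← h2, hk_zero_right, norm_zero, mul_zero]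
      exact hC.le
  | add _ _ ih₁ ih₂ =>
    obtain ⟨p, hp, hpb⟩ := ih₁
    obtain ⟨q, hq, hqb⟩ := ih₂
    obtain ⟨r, hr, hrb⟩ := exists_seminorm_add hp hq
    refine ⟨r, hr, fun d x hx => ?_⟩
    rw [hrb]
    have h0 := (hT x hx).1
    refine le_trans ?_ (add_le_add (hpb d x hx) (hqb d x hx))
    rw [← mul_add]
    gcongr
    exact norm_add_le _ _
  | const_mul c _ ih =>
    obtain ⟨p, hp, hpb⟩ := ih
    obtain ⟨r, hr, hrb⟩ := exists_seminorm_const_mul hp (norm_nonneg c)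
    refine ⟨r, hr, fun d x hx => ?_⟩
    rw [hrb, norm_mul, mul_left_comm]
    exact mul_le_mul_of_nonneg_left (hpb d x hx) (norm_nonneg _)

/-- The class of heat operators is closed under partial derivatives. -/
theorem exists_deriv (h : IsHeatOp H) : ∃ Hx Ht : D → ℝ × ℝ → ℂ, IsHeatOp Hx ∧ IsHeatOp Ht ∧
    ∀ d, ∀ p ∈ Q, HasDerivAt (fun x => H d (x, p.2)) (Hx d p) p.1 ∧
      HasDerivAt (fun t => H d (p.1, t)) (Ht d p) p.2 := by
  induction h with
  | @semigroup σ hσ φ hφ =>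
    have hσ' : |(-σ)| ≤ 1 := by rwa [abs_neg]
    refine ⟨fun d p => ((1 - σ : ℝ) : ℂ) * (hk 0 1 p.1 p.2 • φ 0 0 d) +
        heatP (-σ) (fun y => φ 1 y d) p.1 p.2,
      fun d p => (((1 - σ) * -(1 / 2) : ℝ) : ℂ) * (hk 1 3 p.1 p.2 • φ 0 0 d) +
        ((1 + σ : ℝ) : ℂ) * (hk 0 1 p.1 p.2 • φ 1 0 d) + heatP σ (fun y => φ 2 y d) p.1 p.2,
      ((kernel 0 0 (hφ.functional_bound 0)).const_mul _).add (semigroup hσ' hφ.shift),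
      (((kernel 1 2 (hφ.functional_bound 0)).const_mul _).add
        ((kernel 0 0 (hφ.functional_bound 1)).const_mul _)).add (semigroup hσ hφ.shift.shift),
      fun d p hp => ⟨?_, ?_⟩⟩
    · refine (hasDerivAt_heatP_space hσ (hφ.decaying 0 d) (hφ.decaying 1 d) (hφ.deriv 0 d) p.1
        hp.2).congr_deriv ?_
      simp only [Complex.real_smul]; push_cast; ring
    · refine (hasDerivAt_heatP_time hσ (hφ.decaying 0 d) (hφ.decaying 1 d) (hφ.decaying 2 d)
        (hφ.deriv 0 d) (hφ.deriv 1 d) p.1 hp.2).congr_deriv ?_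
      simp only [Complex.real_smul]; push_cast; ring
  | @single a ha =>
    refine ⟨fun d p => (-(1 / 2) : ℂ) * layer1 (fun r => a 0 r d) p.1 p.2,
      fun d p => layer0 (fun r => a 1 r d) p.1 p.2 + hk 0 1 p.1 p.2 • a 0 0 d,
      (double ha).const_mul _, (single ha.shift).add (kernel 0 0 (ha.functional_bound 0)),
      fun d p hp => ⟨?_, ?_⟩⟩
    · refine (hasDerivAt_layer0_space (ha.cont 0 d) hp.1 hp.2).congr_deriv ?_
      ring
    · exact hasDerivAt_layer0_time (ha.cont 0 d) (ha.cont 1 d) (ha.deriv 0 d) hp.1 hp.2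
  | @double a ha =>
    refine ⟨fun d p => (-2 : ℂ) * (layer0 (fun r => a 1 r d) p.1 p.2 + hk 0 1 p.1 p.2 • a 0 0 d),
      fun d p => layer1 (fun r => a 1 r d) p.1 p.2 + hk 1 3 p.1 p.2 • a 0 0 d,
      ((single ha.shift).add (kernel 0 0 (ha.functional_bound 0))).const_mul _,
      (double ha.shift).add (kernel 1 2 (ha.functional_bound 0)), fun d p hp => ⟨?_, ?_⟩⟩
    · exact hasDerivAt_layer1_space (ha.cont 0 d) (ha.cont 1 d) (ha.deriv 0 d) hp.1 hp.2
    · exact hasDerivAt_layer1_time (ha.cont 0 d) (ha.cont 1 d) (ha.deriv 0 d) hp.1 hp.2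
  | @duhamel σ hσ f hf =>
    have hσ' : |(-σ)| ≤ 1 := by rwa [abs_neg]
    refine ⟨fun d p => (1 - σ : ℂ) * layer0 (fun r => f 0 0 (0, r) d) p.1 p.2 +
        heatW (-σ) (fun q => f 1 0 q d) p.1 p.2,
      fun d p => heatW σ (fun q => f 0 1 q d) p.1 p.2 + heatP σ (fun y => f 0 0 (y, 0) d) p.1 p.2,
      ((single hf.boundary).const_mul _).add (duhamel hσ' hf.shift_space),
      (duhamel hσ hf.shift_time).add (semigroup hσ hf.initial), fun d p hp => ⟨?_, ?_⟩⟩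
    · exact hasDerivAt_heatW_space hσ (hf.stripDecaying 0 0 d) (hf.stripDecaying 1 0 d)
        (fun y r => hf.deriv_space 0 0 d y r) hp.1 hp.2
    · exact hasDerivAt_heatW_time hσ (hf.stripDecaying 0 0 d) (hf.stripDecaying 0 1 d)
        (fun y r => hf.deriv_time 0 0 d y r) p.1 hp.2
  | @kernel b m c hc =>
    -- for `b = 0` the exponent `b - 1` is truncated, but the factor `b` removes this term
    refine ⟨fun d p => (b : ℂ) * (hk (b - 1) (m + 1) p.1 p.2 • c d) +
        (-(1 / 2) : ℂ) * (hk (b + 1) (m + 3) p.1 p.2 • c d),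
      fun d p => (-((m + 1) / 2) : ℂ) * (hk b (m + 3) p.1 p.2 • c d) +
        (1 / 4 : ℂ) * (hk (b + 2) (m + 5) p.1 p.2 • c d),
      ((kernel _ _ hc).const_mul _).add ((kernel _ _ hc).const_mul _),
      ((kernel _ _ hc).const_mul _).add ((kernel _ _ hc).const_mul _), fun d p hp => ⟨?_, ?_⟩⟩
    · refine ((hasDerivAt_hk_space b (m + 1) hp.2).smul_const (c d)).congr_deriv ?_
      simp only [Complex.real_smul]; push_cast; ring
    · refine ((hasDerivAt_hk_time b (m + 1) hp.2).smul_const (c d)).congr_deriv ?_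
      simp only [Complex.real_smul]; push_cast; ring
  | add _ _ ih₁ ih₂ =>
    obtain ⟨X₁, T₁, hX₁, hT₁, h₁⟩ := ih₁
    obtain ⟨X₂, T₂, hX₂, hT₂, h₂⟩ := ih₂
    exact ⟨_, _, hX₁.add hX₂, hT₁.add hT₂, fun d p hp =>
      ⟨(h₁ d p hp).1.add (h₂ d p hp).1, (h₁ d p hp).2.add (h₂ d p hp).2⟩⟩
  | const_mul c _ ih =>
    obtain ⟨X, T, hX, hT, h⟩ := ih
    exact ⟨_, _, hX.const_mul c, hT.const_mul c, fun d p hp =>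
      ⟨(h d p hp).1.const_mul c, (h d p hp).2.const_mul c⟩⟩

end IsHeatOp

end Jets

/-! ### Smoothness up to the boundary -/

theorem isOpen_Q : IsOpen Q := isOpen_Ioi.prod isOpen_Ioi

theorem convex_Q : Convex ℝ Q := (convex_Ioi 0).prod (convex_Ioi 0)

theorem closure_Q : closure Q = Qbar := by
  rw [Q, closure_prod_eq, closure_Ioi, Qbar]

theorem Q_subset_Qpunct : Q ⊆ Qpunct := fun _ hp =>
  mem_Qpunct.2 ⟨⟨le_of_lt hp.1, le_of_lt hp.2⟩, Or.inl (ne_of_gt hp.1)⟩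

/-- The real-linear map `(v, w) ↦ v a + w b`. -/
def gradMap (a b : ℂ) : ℝ × ℝ →L[ℝ] ℂ :=
  ContinuousLinearMap.smulRightL ℝ (ℝ × ℝ) ℂ (ContinuousLinearMap.fst ℝ ℝ ℝ) a +
    ContinuousLinearMap.smulRightL ℝ (ℝ × ℝ) ℂ (ContinuousLinearMap.snd ℝ ℝ ℝ) b

theorem gradMap_apply (a b : ℂ) (v : ℝ × ℝ) : gradMap a b v = v.1 • a + v.2 • b := rfl

theorem contDiffOn_gradMap {n : WithTop ℕ∞} {A B : ℝ × ℝ → ℂ} {S : Set (ℝ × ℝ)}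
    (hA : ContDiffOn ℝ n A S) (hB : ContDiffOn ℝ n B S) :
    ContDiffOn ℝ n (fun p => gradMap (A p) (B p)) S :=
  ((ContinuousLinearMap.contDiff _).comp_contDiffOn hA).add
    ((ContinuousLinearMap.contDiff _).comp_contDiffOn hB)

/-- A function with continuous partial derivatives on the open quarter-plane is differentiable. -/
theorem hasFDerivAt_of_partial {h A B : ℝ × ℝ → ℂ} (hA : ContinuousOn A Q) (hB : ContinuousOn B Q)
    (hd : ∀ p ∈ Q, HasDerivAt (fun x => h (x, p.2)) (A p) p.1 ∧
      HasDerivAt (fun t => h (p.1, t)) (B p) p.2) {p : ℝ × ℝ} (hp : p ∈ Q) :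
    HasFDerivAt h (gradMap (A p) (B p)) p := by
  have hQ : Q ∈ 𝓝 p := isOpen_Q.mem_nhds hp
  set R := ContinuousLinearMap.smulRightL ℝ ℝ ℂ (ContinuousLinearMap.id ℝ ℝ) with hR
  have key := hasStrictFDerivAt_uncurry_coprod (𝕜 := ℝ) (u := p) (f := fun x t => h (x, t))
    (f₁ := fun x t => R (A (x, t))) (f₂ := fun x t => R (B (x, t))) ?_ ?_ ?_ ?_
  · refine key.hasFDerivAt.congr_fderiv ?_
    ext <;> simp [gradMap, hR, Function.HasUncurry.uncurry]
  · filter_upwards [hQ] with q hq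
    refine ((hd q hq).1.hasFDerivAt).congr_fderiv ?_
    ext; simp [hR, Function.HasUncurry.uncurry]
  · filter_upwards [hQ] with q hq
    refine ((hd q hq).2.hasFDerivAt).congr_fderiv ?_
    ext; simp [hR, Function.HasUncurry.uncurry]
  · exact R.continuous.continuousAt.comp (hA.continuousAt hQ)
  · exact R.continuous.continuousAt.comp (hB.continuousAt hQ)

/-- A function on `Q̄ − {(0,0)}` that is differentiable in the interior, with a derivative that
extends continuously, is differentiable up to the boundary. -/
theorem hasFDerivWithinAt_Qpunct {h A B : ℝ × ℝ → ℂ} (hc : ContinuousOn h Qpunct)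
    (hA : ContinuousOn A Qpunct) (hB : ContinuousOn B Qpunct)
    (hd : ∀ p ∈ Q, HasFDerivAt h (gradMap (A p) (B p)) p) {p : ℝ × ℝ} (hp : p ∈ Qpunct) :
    HasFDerivWithinAt h (gradMap (A p) (B p)) Qpunct p := by
  have hp0 : 0 < ‖p‖ := norm_pos_iff.2 hp.2
  -- the closure of this convex part of `Q` avoids the origin, so the extension theorem for derivatives
  -- applies on it
  set s := Q ∩ Metric.ball p (‖p‖ / 2) with hs
  have hsQ : s ⊆ Q := inter_subset_left
  have hso : IsOpen s := isOpen_Q.inter Metric.isOpen_ball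
  have hcl : closure s ⊆ Qpunct := by
    intro q hq
    have h1 : q ∈ Qbar := closure_Q ▸ closure_mono hsQ hq
    have h2 : q ∈ Metric.closedBall p (‖p‖ / 2) :=
      Metric.closure_ball_subset_closedBall (closure_mono inter_subset_right hq)
    refine ⟨h1, ?_⟩
    rintro rfl
    rw [Metric.mem_closedBall, dist_eq_norm, show ((0, 0) : ℝ × ℝ) = 0 from rfl, zero_sub,
      norm_neg] at h2
    linarith
  have hmem : closure s ∈ 𝓝[Qpunct] p := by
    have h1 : Metric.ball p (‖p‖ / 2) ∩ closure Q ⊆ closure (Metric.ball p (‖p‖ / 2) ∩ Q) :=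
      Metric.isOpen_ball.inter_closure
    rw [inter_comm _ Q, closure_Q] at h1
    refine mem_of_superset (inter_mem (nhdsWithin_le_nhds (Metric.ball_mem_nhds p (half_pos hp0)))
      self_mem_nhdsWithin) fun q hq => h1 ⟨hq.1, hq.2.1⟩
  have key := hasFDerivWithinAt_closure_of_tendsto_fderiv (f := h) (s := s) (x := p)
    (f' := gradMap (A p) (B p))
    (fun q hq => (hd q (hsQ hq)).differentiableAt.differentiableWithinAt)
    (convex_Q.inter (convex_ball _ _)) hso
    (fun q hq => (hc q (hcl hq)).mono (hsQ.trans Q_subset_Qpunct)) ?_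
  · exact key.mono_of_mem_nhdsWithin hmem
  · have h1 : ContinuousWithinAt (fun q => gradMap (A q) (B q)) Qpunct p :=
      ((ContinuousLinearMap.continuous _).continuousAt.comp_continuousWithinAt (hA p hp)).add
        ((ContinuousLinearMap.continuous _).continuousAt.comp_continuousWithinAt (hB p hp))
    refine (h1.mono (hsQ.trans Q_subset_Qpunct)).tendsto.congr' ?_
    filter_upwards [self_mem_nhdsWithin] with q hq using (hd q (hsQ hq)).fderiv.symm

section SmoothOps

variable {D : Type*} [AddCommGroup D] [Module ℂ D] [TopologicalSpace D]

namespace IsHeatOp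

variable {H : D → ℝ × ℝ → ℂ}

theorem exists_hasFDerivWithinAt (h : IsHeatOp H) : ∃ Hx Ht : D → ℝ × ℝ → ℂ,
    IsHeatOp Hx ∧ IsHeatOp Ht ∧
    ∀ d, ∀ p ∈ Qpunct, HasFDerivWithinAt (H d) (gradMap (Hx d p) (Ht d p)) Qpunct p := by
  obtain ⟨X, T, hX, hT, hd⟩ := h.exists_deriv
  refine ⟨X, T, hX, hT, fun d p hp => hasFDerivWithinAt_Qpunct (h.continuousOn d) (hX.continuousOn d)
    (hT.continuousOn d) (fun q hq => ?_) hp⟩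
  exact hasFDerivAt_of_partial ((hX.continuousOn d).mono Q_subset_Qpunct)
    ((hT.continuousOn d).mono Q_subset_Qpunct) (hd d) hq

/-- A heat operator takes values in the smooth functions up to the boundary away from the origin, as its
first partial derivatives are heat operators again. -/
theorem contDiffOn (h : IsHeatOp H) (d : D) : ContDiffOn ℝ ∞ (H d) Qpunct := by
  rw [contDiffOn_infty]
  intro n
  induction n generalizing H with
  | zero => simpa using h.continuousOn d
  | succ n ih =>
    obtain ⟨X, T, hX, hT, hd⟩ := h.exists_hasFDerivWithinAt
    rw [Nat.cast_succ, contDiffOn_succ_iff_hasFDerivWithinAt_of_uniqueDiffOn uniqueDiffOn_Qpunct]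
    exact ⟨fun hn => absurd hn (by simp), _, contDiffOn_gradMap (ih hX) (ih hT), hd d⟩

theorem exists_iterate_dirDeriv (v : ℝ × ℝ) (k : ℕ) (h : IsHeatOp H) :
    ∃ H' : D → ℝ × ℝ → ℂ, IsHeatOp H' ∧ ∀ d, EqOn ((dirDeriv Qpunct v)^[k] (H d)) (H' d) Qpunct := by
  induction k with
  | zero => exact ⟨H, h, fun d p _ => rfl⟩
  | succ k ih =>
    obtain ⟨H', h', he⟩ := ih
    obtain ⟨X, T, hX, hT, hd⟩ := h'.exists_hasFDerivWithinAt
    refine ⟨_, (hX.const_mul (v.1 : ℂ)).add (hT.const_mul (v.2 : ℂ)), fun d p hp => ?_⟩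
    rw [Function.iterate_succ_apply', dirDeriv, fderivWithin_congr (he d) (he d hp),
      (hd d p hp).fderivWithin (uniqueDiffOn_Qpunct p hp), gradMap_apply]
    simp

theorem exists_mixedPartial (k l : ℕ) (h : IsHeatOp H) :
    ∃ H' : D → ℝ × ℝ → ℂ, IsHeatOp H' ∧ ∀ d, EqOn (mixedPartial Qpunct k l (H d)) (H' d) Qpunct := by
  obtain ⟨H₁, h₁, e₁⟩ := h.exists_iterate_dirDeriv (0, 1) l
  obtain ⟨H₂, h₂, e₂⟩ := h₁.exists_iterate_dirDeriv (1, 0) k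
  exact ⟨H₂, h₂, fun d => (iterate_dirDeriv_congr (1, 0) k (e₁ d)).trans (e₂ d)⟩

end IsHeatOp

/-- A linear map into the underlying function space whose functionals `L n a` are bounded by
continuous seminorms gives a continuous linear map into `SupSpace L`. -/
theorem exists_supSpace_map [IsTopologicalAddGroup D] {E : Type*} [AddCommGroup E] [Module ℂ E]
    {κ : Type*} [Nonempty κ] {ι : κ → Type*} (L : ∀ n : κ, ι n → E →ₗ[ℂ] ℂ) (T : D →ₗ[ℂ] E)
    (hT : ∀ n, ∃ p : Seminorm ℂ D, Continuous p ∧ ∀ d a, ‖L n a (T d)‖ ≤ p d) :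
    ∃ Ψ : D → SupSpace L, Continuous Ψ ∧ ∀ d, SupSpace.val L (Ψ d) = T d := by
  have hmem : ∀ d, T d ∈ boundedSubmodule L := fun d n => by
    obtain ⟨p, -, hp⟩ := hT n
    refine ⟨p d, ?_⟩
    rintro _ ⟨a, rfl⟩
    exact hp d a
  let Ψ : D →ₗ[ℂ] SupSpace L := LinearMap.codRestrict (boundedSubmodule L) T hmem
  have hΨ : ∀ d, SupSpace.val L (Ψ d) = T d := fun d => rfl
  refine ⟨Ψ, ?_, hΨ⟩
  refine WithSeminorms.continuous_of_continuous_comp (withSeminorms_supSeminorm L) Ψ fun n => ?_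
  obtain ⟨p, hp, hpb⟩ := hT n
  refine Seminorm.continuous_of_le hp fun d => ?_
  exact Real.iSup_le (fun a => hpb d a) (apply_nonneg p d)

/-- A heat operator is continuous into `𝒮₁(Q̄ − {(0,0)})`. -/
theorem IsHeatOp.exists_S1Qpunct_map [IsTopologicalAddGroup D] {H : D → ℝ × ℝ → ℂ}
    (h : IsHeatOp H) : ∃ Ψ : D → S1Qpunct, Continuous Ψ ∧
      ∀ d, S1Qpunct.toFun (Ψ d) = Qpunct.indicator (H d) := by
  have heq : ∀ d, EqOn (Qpunct.indicator (H d)) (H d) Qpunct := fun d p hp => indicator_of_mem hp _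
  let T : D →ₗ[ℂ] smoothOn Qpunct :=
    { toFun := fun d => ⟨Qpunct.indicator (H d), (h.contDiffOn d).congr (heq d),
        fun p hp => indicator_of_notMem hp _⟩
      map_add' := fun d d' => Subtype.ext (funext fun p => by
        by_cases hp : p ∈ Qpunct
        · simp [indicator_of_mem hp, h.map_add d d' hp.1]
        · simp [indicator_of_notMem hp])
      map_smul' := fun c d => Subtype.ext (funext fun p => by
        by_cases hp : p ∈ Qpunct
        · simp [indicator_of_mem hp, h.map_smul c d]
        · simp [indicator_of_notMem hp]) }
  have hT : ∀ d, ((T d : smoothOn Qpunct) : ℝ × ℝ → ℂ) = Qpunct.indicator (H d) := fun d => rfl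
  obtain ⟨Ψ, hΨ, hv⟩ := exists_supSpace_map stripPunctFunctional T fun n => by
    -- finitely many partial derivatives enter the seminorm with index `n`
    have hkl : ∀ k l : ℕ, ∃ p : Seminorm ℂ D, Continuous p ∧ ∀ d, ∀ q ∈ stripPunct n,
        (1 + q.1) ^ (n : ℕ) * ‖mixedPartial Qpunct k l (H d) q‖ ≤ p d := fun k l => by
      obtain ⟨H', h', he⟩ := h.exists_mixedPartial k l
      obtain ⟨p, hp, hpb⟩ := h'.exists_bound n n
      refine ⟨p, hp, fun d q hq => ?_⟩
      rw [he d (stripPunct_subset n hq)]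
      exact hpb d q hq
    choose p hp hpb using hkl
    have hsum : ∀ s : Finset (ℕ × ℕ), ∃ r : Seminorm ℂ D, Continuous r ∧
        ∀ d, ∀ i ∈ s, p i.1 i.2 d ≤ r d := by
      intro s
      induction s using Finset.induction_on with
      | empty => exact ⟨0, continuous_const, fun d i hi => absurd hi (Finset.notMem_empty i)⟩
      | insert i s _ ih =>
        obtain ⟨r, hr, hrb⟩ := ih
        obtain ⟨r', hr', hrb'⟩ := exists_seminorm_add (hp i.1 i.2) hr
        refine ⟨r', hr', fun d j hj => ?_⟩
        rw [hrb']
        rcases Finset.mem_insert.1 hj with rfl | hj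
        · linarith [apply_nonneg r d]
        · linarith [hrb d j hj, apply_nonneg (p i.1 i.2) d]
    obtain ⟨r, hr, hrb⟩ := hsum (Finset.range (n + 1) ×ˢ Finset.range (n + 1))
    refine ⟨r, hr, ?_⟩
    rintro d ⟨⟨⟨k, l⟩, q⟩, hkl, hq⟩
    have hq' : q ∈ stripPunct n := hq
    have hkl' : k + l ≤ (n : ℕ) := hkl
    refine le_trans ?_ (hrb d (k, l) (Finset.mem_product.2
      ⟨Finset.mem_range.2 (by simp only; omega), Finset.mem_range.2 (by simp only; omega)⟩))
    refine le_trans (le_of_eq ?_) (hpb k l d q hq')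
    have hq0 : 0 ≤ q.1 := (stripPunct_subset n hq').1.1
    have e : mixedPartial Qpunct k l (Qpunct.indicator (H d)) q = mixedPartial Qpunct k l (H d) q :=
      iterate_dirDeriv_congr _ k (iterate_dirDeriv_congr _ l (heq d)) (stripPunct_subset n hq')
    show ‖(((1 + q.1) ^ (n : ℕ) : ℝ) : ℂ) • mixedPartial Qpunct k l (Qpunct.indicator (H d)) q‖ = _
    rw [e, norm_smul, Complex.norm_real, Real.norm_of_nonneg (by positivity)]
  exact ⟨Ψ, hΨ, fun d => by rw [S1Qpunct.toFun, hv, hT]⟩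

end SmoothOps

/-! ### The unit square -/

/-- Partial derivatives in the first variable extend from the open quarter-plane to its closure. -/
theorem hasDerivWithinAt_of_continuousOn_Qbar {G G' : ℝ × ℝ → ℂ} (hG : ContinuousOn G Qbar)
    (hG' : ContinuousOn G' Qbar) (hd : ∀ p ∈ Q, HasDerivAt (fun x => G (x, p.2)) (G' p) p.1)
    {x t : ℝ} (hx : 0 ≤ x) (ht : 0 ≤ t) :
    HasDerivWithinAt (fun x => G (x, t)) (G' (x, t)) (Ici 0) x := by
  -- the retraction of the plane onto `Q̄`, which extends `G` and its derivative continuously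
  set c : ℝ × ℝ → ℝ × ℝ := fun q => (max 0 q.1, max 0 q.2) with hc
  have hcc : Continuous c := by fun_prop
  have hcm : ∀ q, c q ∈ Qbar := fun q => ⟨le_max_left (0 : ℝ) _, le_max_left (0 : ℝ) _⟩
  have hcG : Continuous fun q => G (c q) := hG.comp_continuous hcc hcm
  have hcG' : Continuous fun q => G' (c q) := hG'.comp_continuous hcc hcm
  -- the fundamental theorem of calculus on interior lines, extended by continuity
  have key : ∀ y, 0 ≤ y → ∀ t, 0 ≤ t →
      G (c (y, t)) - G (c (0, t)) - ∫ ξ in (0 : ℝ)..y, G' (c (ξ, t)) = 0 := by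
    intro y hy
    have hcont : Continuous fun t => G (c (y, t)) - G (c (0, t)) - ∫ ξ in (0 : ℝ)..y, G' (c (ξ, t)) := by
      have h1 : Continuous fun t => G (c (y, t)) := hcG.comp (by fun_prop)
      have h2 : Continuous fun t => G (c (0, t)) := hcG.comp (by fun_prop)
      have h3 : Continuous (Function.uncurry fun (t : ℝ) (ξ : ℝ) => G' (c (ξ, t))) :=
        hcG'.comp (f := fun q : ℝ × ℝ => (q.2, q.1)) (by fun_prop)
      exact (h1.sub h2).sub
        (intervalIntegral.continuous_parametric_intervalIntegral_of_continuous' h3 0 y)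
    have hzero : ∀ t ∈ Ioi (0 : ℝ),
        G (c (y, t)) - G (c (0, t)) - ∫ ξ in (0 : ℝ)..y, G' (c (ξ, t)) = 0 := by
      intro t ht
      have ht : 0 < t := ht
      have h1 : Continuous fun ξ => G (c (ξ, t)) := hcG.comp (by fun_prop)
      have h2 : Continuous fun ξ => G' (c (ξ, t)) := hcG'.comp (by fun_prop)
      have := intervalIntegral.integral_eq_sub_of_hasDerivAt_of_le hy
        (f := fun ξ => G (c (ξ, t))) (f' := fun ξ => G' (c (ξ, t))) h1.continuousOn
        (fun ξ hξ => ?_) (h2.intervalIntegrable _ _)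
      · rw [this, sub_self]
      · have e := hd (ξ, t) ⟨hξ.1, ht⟩
        have e1 : c (ξ, t) = (ξ, t) := by simp [hc, hξ.1.le, ht.le]
        rw [e1]
        refine e.congr_of_eventuallyEq ?_
        filter_upwards [lt_mem_nhds hξ.1] with z hz
        simp [hc, hz.le, ht.le]
    intro t ht
    have hcl : IsClosed {t | G (c (y, t)) - G (c (0, t)) -
        ∫ ξ in (0 : ℝ)..y, G' (c (ξ, t)) = 0} := isClosed_eq hcont continuous_const
    have := hcl.closure_subset_iff.2 (fun t ht => hzero t ht : Ioi (0 : ℝ) ⊆ _)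
    rw [closure_Ioi] at this
    exact this ht
  have h2 : Continuous fun ξ => G' (c (ξ, t)) := hcG'.comp (by fun_prop)
  have hder : HasDerivAt (fun y => G (c (0, t)) + ∫ ξ in (0 : ℝ)..y, G' (c (ξ, t)))
      (G' (c (x, t))) x :=
    (intervalIntegral.integral_hasDerivAt_right (h2.intervalIntegrable _ _)
      (h2.stronglyMeasurableAtFilter _ _) h2.continuousAt).const_add _
  have e1 : ∀ y, 0 ≤ y → c (y, t) = (y, t) := fun y hy => by simp [hc, hy, ht]
  rw [e1 x hx] at hder
  refine hder.hasDerivWithinAt.congr_of_mem (fun y hy => ?_) hx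
  have := key y hy t ht
  rw [sub_sub, sub_eq_zero, e1 y hy] at this
  exact this

/-- Iterated one-sided derivatives from a chain of first derivatives. -/
theorem iteratedDerivWithin_chain {k : ℕ} {X : ℕ → ℝ → ℂ} {h : ℝ → ℂ}
    (hX : ∀ i < k, ∀ x ∈ Icc (0 : ℝ) 1, HasDerivWithinAt (X i) (X (i + 1) x) (Icc 0 1) x)
    (hXk : ContinuousOn (X k) (Icc 0 1)) (h0 : EqOn h (X 0) (Icc 0 1)) :
    (∀ i ≤ k, EqOn (iteratedDerivWithin i h (Icc 0 1)) (X i) (Icc 0 1)) ∧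
      ContDiffOn ℝ k h (Icc 0 1) := by
  have h1 : ∀ i ≤ k, EqOn (iteratedDerivWithin i h (Icc 0 1)) (X i) (Icc 0 1) := by
    intro i
    induction i with
    | zero => exact fun _ x hx => by simpa using h0 hx
    | succ i ih =>
      intro hi x hx
      have e := ih (by omega)
      rw [iteratedDerivWithin_succ, derivWithin_congr e (e hx)]
      exact (hX i (by omega) x hx).derivWithin (uniqueDiffOn_unitInterval x hx)
  have hXc : ∀ i ≤ k, ContinuousOn (X i) (Icc 0 1) := fun i hi => by
    rcases hi.lt_or_eq with hi | rfl
    · exact fun x hx => (hX i hi x hx).continuousWithinAt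
    · exact hXk
  refine ⟨h1, ?_⟩
  have := contDiffOn_of_continuousOn_differentiableOn_deriv (𝕜 := ℝ) (n := (k : ℕ∞)) (f := h)
    (s := Icc 0 1) (fun m hm => ?_) (fun m hm => ?_)
  · exact_mod_cast this
  · have hm : m ≤ k := by exact_mod_cast hm
    exact (hXc m hm).congr (h1 m hm)
  · have hm : m < k := by exact_mod_cast hm
    exact fun x hx => ((hX m hm x hx).differentiableWithinAt).congr (h1 m hm.le) (h1 m hm.le hx)

theorem unitSquare_subset_Qbar : unitSquare ⊆ Qbar := fun _ hp => ⟨hp.1.1, hp.2.1⟩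

/-- A function with chains of partial derivatives `X i`, `i ≤ k`, and `T j`, `j ≤ l`, that are
continuous on `Q̄` belongs to `C^{(k,l)}`. -/
theorem indicator_unitSquare_mem_ckl {k l : ℕ} {h : ℝ × ℝ → ℂ} {X T : ℕ → ℝ × ℝ → ℂ}
    (hX0 : X 0 = h) (hT0 : T 0 = h)
    (hXc : ∀ i ≤ k, ContinuousOn (X i) Qbar) (hTc : ∀ j ≤ l, ContinuousOn (T j) Qbar)
    (hX : ∀ i < k, ∀ p ∈ Q, HasDerivAt (fun x => X i (x, p.2)) (X (i + 1) p) p.1)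
    (hT : ∀ j < l, ∀ p ∈ Q, HasDerivAt (fun t => T j (p.1, t)) (T (j + 1) p) p.2) :
    unitSquare.indicator h ∈ ckl k l ∧
      (∀ i ≤ k, EqOn (squareDx i (unitSquare.indicator h)) (X i) unitSquare) ∧
      ∀ j ≤ l, EqOn (squareDt j (unitSquare.indicator h)) (T j) unitSquare := by
  have hx : ∀ t ∈ Icc (0 : ℝ) 1,
      (∀ i ≤ k, EqOn (iteratedDerivWithin i (fun x => unitSquare.indicator h (x, t)) (Icc 0 1))
        (fun x => X i (x, t)) (Icc 0 1)) ∧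
      ContDiffOn ℝ k (fun x => unitSquare.indicator h (x, t)) (Icc 0 1) := fun t ht => by
    refine iteratedDerivWithin_chain (X := fun i x => X i (x, t)) (fun i hi x hx => ?_) ?_ ?_
    · exact (hasDerivWithinAt_of_continuousOn_Qbar (hXc i hi.le) (hXc (i + 1) hi) (hX i hi)
        hx.1 ht.1).mono Icc_subset_Ici_self
    · exact (hXc k le_rfl).comp (by fun_prop) fun x hx => ⟨hx.1, ht.1⟩
    · intro x hx
      simp only [hX0]
      exact indicator_of_mem (show (x, t) ∈ unitSquare from ⟨hx, ht⟩) h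
  have ht : ∀ x ∈ Icc (0 : ℝ) 1,
      (∀ j ≤ l, EqOn (iteratedDerivWithin j (fun t => unitSquare.indicator h (x, t)) (Icc 0 1))
        (fun t => T j (x, t)) (Icc 0 1)) ∧
      ContDiffOn ℝ l (fun t => unitSquare.indicator h (x, t)) (Icc 0 1) := fun x hx => by
    have hswap : ∀ j ≤ l, ContinuousOn (fun q : ℝ × ℝ => T j (q.2, q.1)) Qbar := fun j hj =>
      (hTc j hj).comp (f := fun q : ℝ × ℝ => (q.2, q.1)) (by fun_prop) fun q hq => ⟨hq.2, hq.1⟩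
    refine iteratedDerivWithin_chain (X := fun j t => T j (x, t)) (fun j hj t ht => ?_) ?_ ?_
    · exact (hasDerivWithinAt_of_continuousOn_Qbar (hswap j hj.le) (hswap (j + 1) hj)
        (fun p hp => hT j hj (p.2, p.1) ⟨hp.2, hp.1⟩) ht.1 hx.1).mono Icc_subset_Ici_self
    · exact (hTc l le_rfl).comp (by fun_prop) fun t ht => ⟨hx.1, ht.1⟩
    · intro t ht
      simp only [hT0]
      exact indicator_of_mem (show (x, t) ∈ unitSquare from ⟨hx, ht⟩) h
  have hdx : ∀ i ≤ k, EqOn (squareDx i (unitSquare.indicator h)) (X i) unitSquare :=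
    fun i hi p hp => (hx p.2 hp.2).1 i hi hp.1
  have hdt : ∀ j ≤ l, EqOn (squareDt j (unitSquare.indicator h)) (T j) unitSquare :=
    fun j hj p hp => (ht p.1 hp.1).1 j hj hp.2
  exact ⟨⟨fun t ht => (hx t ht).2, fun x hx => (ht x hx).2,
    fun i hi => ((hXc i hi).mono unitSquare_subset_Qbar).congr (hdx i hi),
    fun j hj => ((hTc j hj).mono unitSquare_subset_Qbar).congr (hdt j hj),
    fun p hp => indicator_of_notMem hp h⟩, hdx, hdt⟩

/-- The operator version of `indicator_unitSquare_mem_ckl`. -/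
theorem exists_Ckl_map {D : Type*} [AddCommGroup D] [Module ℂ D] [TopologicalSpace D]
    [IsTopologicalAddGroup D] {k l : ℕ} {H : D → ℝ × ℝ → ℂ} {X T : ℕ → D → ℝ × ℝ → ℂ}
    (hadd : ∀ d d', ∀ p ∈ unitSquare, H (d + d') p = H d p + H d' p)
    (hsmul : ∀ (c : ℂ) d, ∀ p ∈ unitSquare, H (c • d) p = c * H d p)
    (hX0 : X 0 = H) (hT0 : T 0 = H)
    (hXc : ∀ i ≤ k, ∀ d, ContinuousOn (X i d) Qbar) (hTc : ∀ j ≤ l, ∀ d, ContinuousOn (T j d) Qbar)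
    (hX : ∀ i < k, ∀ d, ∀ p ∈ Q, HasDerivAt (fun x => X i d (x, p.2)) (X (i + 1) d p) p.1)
    (hT : ∀ j < l, ∀ d, ∀ p ∈ Q, HasDerivAt (fun t => T j d (p.1, t)) (T (j + 1) d p) p.2)
    (hXb : ∀ i ≤ k, ∃ p : Seminorm ℂ D, Continuous p ∧ ∀ d, ∀ q ∈ unitSquare, ‖X i d q‖ ≤ p d)
    (hTb : ∀ j ≤ l, ∃ p : Seminorm ℂ D, Continuous p ∧ ∀ d, ∀ q ∈ unitSquare, ‖T j d q‖ ≤ p d) :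
    ∃ Ψ : D → Ckl k l, Continuous Ψ ∧ ∀ d, Ckl.toFun (Ψ d) = unitSquare.indicator (H d) := by
  have hm := fun d => indicator_unitSquare_mem_ckl (h := H d) (X := fun i => X i d)
    (T := fun j => T j d) (by rw [hX0]) (by rw [hT0]) (fun i hi => hXc i hi d)
    (fun j hj => hTc j hj d) (fun i hi => hX i hi d) (fun j hj => hT j hj d)
  let S : D →ₗ[ℂ] ckl k l :=
    { toFun := fun d => ⟨unitSquare.indicator (H d), (hm d).1⟩
      map_add' := fun d d' => Subtype.ext (funext fun p => by
        by_cases hp : p ∈ unitSquare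
        · simp [indicator_of_mem hp, hadd d d' p hp]
        · simp [indicator_of_notMem hp])
      map_smul' := fun c d => Subtype.ext (funext fun p => by
        by_cases hp : p ∈ unitSquare
        · simp [indicator_of_mem hp, hsmul c d p hp]
        · simp [indicator_of_notMem hp]) }
  obtain ⟨Ψ, hΨ, hv⟩ := exists_supSpace_map (cklFunctional k l) S fun m => by
    rcases m with i | j
    · obtain ⟨p, hp, hpb⟩ := hXb i (Nat.lt_succ_iff.1 i.2)
      refine ⟨p, hp, fun d q => ?_⟩
      have := (hm d).2.1 i (Nat.lt_succ_iff.1 i.2) q.2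
      show ‖squareDx i (unitSquare.indicator (H d)) q‖ ≤ _
      rw [this]
      exact hpb d q q.2
    · obtain ⟨p, hp, hpb⟩ := hTb j (Nat.lt_succ_iff.1 j.2)
      refine ⟨p, hp, fun d q => ?_⟩
      have := (hm d).2.2 j (Nat.lt_succ_iff.1 j.2) q.2
      show ‖squareDt j (unitSquare.indicator (H d)) q‖ ≤ _
      rw [this]
      exact hpb d q q.2
  exact ⟨Ψ, hΨ, fun d => by rw [Ckl.toFun, hv]; rfl⟩

/-! ### Heat exponentials along rays -/

section Rays

open Complex (I)
open scoped ComplexConjugate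

theorem norm_heatExp (z t : ℝ) (w : ℂ) :
    ‖heatExp z t w‖ = Real.exp (-(w.im * z) - (w ^ 2).re * t) := by
  rw [heatExp, Complex.norm_exp]
  congr 1
  simp

theorem hasDerivAt_heatExp (z t : ℝ) (w : ℂ) :
    HasDerivAt (heatExp z t) (heatExp z t w * (I * z - 2 * w * t)) w := by
  have h : HasDerivAt (fun w : ℂ => I * w * z - w ^ 2 * t) (I * z - 2 * w * t) w := by
    simpa using (((hasDerivAt_id w).const_mul I).mul_const (z : ℂ)).fun_sub
      ((hasDerivAt_pow 2 w).mul_const (t : ℂ))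
  exact h.cexp

theorem continuous_heatExp (z t : ℝ) : Continuous (heatExp z t) := by
  unfold heatExp; fun_prop

theorem heatExp_neg_conj (z t : ℝ) (w : ℂ) :
    heatExp z t (-conj w) = conj (heatExp z t w) := by
  rw [heatExp, heatExp, ← Complex.exp_conj]
  simp

theorem heatExp_mul_exp (x t y : ℝ) (w : ℂ) :
    heatExp x t w * Complex.exp (-I * w * y) = heatExp (x - y) t w := by
  rw [heatExp, heatExp, ← Complex.exp_add]
  congr 1
  push_cast; ring

/-- On the sector `0 ≤ arg w ≤ π/4` the heat exponential decays exponentially: as `r² ≥ r - 1`, its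
exponent is at most `t` minus `r` times a mean of `t` and `z/√2`. -/
theorem exists_heatExp_sector_le {z t : ℝ} (hz : 0 < z) (ht : 0 < t) : ∃ C c : ℝ, 0 < c ∧
    ∀ θ ∈ Icc 0 (Real.pi / 4), ∀ r : ℝ, 0 ≤ r →
      (1 + r) ^ 2 * ‖heatExp z t (r * Complex.exp (I * θ))‖ ≤ C * Real.exp (-c * r) := by
  have h2 : 0 < √2 := by positivity
  have h22 : √2 * √2 = 2 := Real.mul_self_sqrt (by norm_num)
  set c := min t (z / √2) with hc
  have hc0 : 0 < c := lt_min ht (by positivity)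
  refine ⟨(2 + 16 / c ^ 2) * Real.exp t, c / 2, by positivity, fun θ hθ r hr => ?_⟩
  have hs0 : 0 ≤ Real.sin θ := Real.sin_nonneg_of_nonneg_of_le_pi hθ.1 (by linarith [hθ.2, Real.pi_pos])
  have hs1 : √2 * Real.sin θ ≤ 1 := by
    have := Real.sin_le_sin_of_le_of_le_pi_div_two (by linarith [hθ.1, Real.pi_pos])
      (by linarith [Real.pi_pos]) hθ.2
    rw [Real.sin_pi_div_four] at this
    nlinarith
  have hw : (r : ℂ) * Complex.exp (I * θ) = ((r * Real.cos θ : ℝ) : ℂ) + ((r * Real.sin θ : ℝ) : ℂ) * I := by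
    rw [mul_comm I, Complex.exp_mul_I]; push_cast; ring
  have him : ((r : ℂ) * Complex.exp (I * θ)).im = r * Real.sin θ := by
    rw [hw, Complex.add_im, Complex.ofReal_im, Complex.im_ofReal_mul, Complex.I_im]; ring
  have hre : (((r : ℂ) * Complex.exp (I * θ)) ^ 2).re = r ^ 2 * (1 - 2 * Real.sin θ ^ 2) := by
    rw [hw, pow_two, Complex.mul_re]
    simp only [Complex.add_re, Complex.add_im, Complex.ofReal_re, Complex.ofReal_im,
      Complex.re_ofReal_mul, Complex.im_ofReal_mul, Complex.I_re, Complex.I_im]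
    linear_combination r ^ 2 * Real.sin_sq_add_cos_sq θ
  rw [norm_heatExp, him, hre]
  set s := √2 * Real.sin θ with hs
  have hs0' : 0 ≤ s := by positivity
  have hss : 2 * Real.sin θ ^ 2 = s ^ 2 := by rw [hs, mul_pow, Real.sq_sqrt (by norm_num)]
  have hsz : Real.sin θ * z = s * (z / √2) := by rw [hs]; field_simp
  have hexp : -(r * Real.sin θ * z) - r ^ 2 * (1 - 2 * Real.sin θ ^ 2) * t ≤ t + -(c * r) := by
    rw [hss, mul_assoc r, hsz]
    have a1 : c ≤ t := min_le_left _ _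
    have a2 : c ≤ z / √2 := min_le_right _ _
    have b1 : s ^ 2 ≤ s := by nlinarith
    have b2 : (r - 1) * (1 - s) ≤ r ^ 2 * (1 - s ^ 2) := by
      nlinarith [sq_nonneg (r - 1), mul_nonneg (sq_nonneg r) (sub_nonneg.2 b1)]
    have b3 : (r - 1) * (1 - s) * t ≤ r ^ 2 * (1 - s ^ 2) * t := by gcongr
    have b4 : r * s * c ≤ r * s * (z / √2) := by gcongr
    have b5 : r * (1 - s) * c ≤ r * (1 - s) * t := by gcongr
    nlinarith
  have hpow : (1 + r) ^ 2 ≤ (2 + 16 / c ^ 2) * Real.exp (c / 2 * r) := by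
    have hq := Real.quadratic_le_exp_of_nonneg (x := c / 2 * r) (by positivity)
    have : (2 + 16 / c ^ 2) * (1 + c / 2 * r + (c / 2 * r) ^ 2 / 2) =
        2 + 16 / c ^ 2 + c * r + 8 / c * r + c ^ 2 * r ^ 2 / 4 + 2 * r ^ 2 := by
      field_simp; ring
    have h3 : (2 + 16 / c ^ 2) * (1 + c / 2 * r + (c / 2 * r) ^ 2 / 2) ≤
        (2 + 16 / c ^ 2) * Real.exp (c / 2 * r) := by gcongr
    have : 0 ≤ 16 / c ^ 2 := by positivity
    have : 0 ≤ c * r := by positivity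
    have : 0 ≤ 8 / c * r := by positivity
    have : 0 ≤ c ^ 2 * r ^ 2 / 4 := by positivity
    nlinarith [sq_nonneg (r - 1)]
  calc (1 + r) ^ 2 * Real.exp (-(r * Real.sin θ * z) - r ^ 2 * (1 - 2 * Real.sin θ ^ 2) * t)
      ≤ (2 + 16 / c ^ 2) * Real.exp (c / 2 * r) * Real.exp (t + -(c * r)) := by gcongr
    _ = (2 + 16 / c ^ 2) * Real.exp t * Real.exp (-(c / 2) * r) := by
      rw [mul_assoc, ← Real.exp_add, mul_assoc, ← Real.exp_add]
      congr 2; ring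

/-- Rotation of the contour from the ray `arg w = π/4` to the positive half-line. -/
theorem integral_heatExp_rotate {z t : ℝ} (hz : 0 < z) (ht : 0 < t) :
    ∫ r in Ioi (0 : ℝ), heatExp z t (r * Complex.exp (I * (Real.pi / 4 : ℝ))) *
      Complex.exp (I * (Real.pi / 4 : ℝ)) = ∫ r in Ioi (0 : ℝ), heatExp z t r := by
  obtain ⟨C, c, hc, hb⟩ := exists_heatExp_sector_le hz ht
  have hpi : (0 : ℝ) ≤ Real.pi / 4 := by positivity
  set e : ℝ → ℂ := fun θ => Complex.exp (I * θ) with he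
  have hec : Continuous e := by fun_prop
  have hen : ∀ θ, ‖e θ‖ = 1 := fun θ => by rw [he]; simp [mul_comm I, Complex.norm_exp_ofReal_mul_I]
  have hed : ∀ θ, HasDerivAt e (I * e θ) θ := fun θ => by
    have := (((hasDerivAt_id (θ : ℂ)).const_mul I).cexp).comp_ofReal
    simpa [he, mul_comm] using this
  have hEc := continuous_heatExp z t
  set F : ℝ → ℝ → ℂ := fun θ r => heatExp z t (r * e θ) * e θ with hF
  set K : ℝ → ℝ → ℂ := fun θ r =>
    I * e θ * heatExp z t (r * e θ) * (1 + r * e θ * (I * z - 2 * (r * e θ) * t)) with hK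
  have hKc : Continuous fun p : ℝ × ℝ => K p.1 p.2 := by
    simp only [hK]
    have h1 : Continuous fun p : ℝ × ℝ => e p.1 := hec.comp continuous_fst
    have h2 : Continuous fun p : ℝ × ℝ => heatExp z t (p.2 * e p.1) := hEc.comp (by fun_prop)
    fun_prop
  have hdθ : ∀ θ r : ℝ, HasDerivAt (fun θ => F θ r) (K θ r) θ := fun θ r => by
    have h1 := (hasDerivAt_heatExp z t (r * e θ)).comp θ ((hed θ).const_mul (r : ℂ))
    have h2 := h1.mul (hed θ)
    refine h2.congr_deriv ?_
    simp only [hK, Function.comp]; ring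
  have hdr : ∀ θ r : ℝ, HasDerivAt (fun r : ℝ => I * (r * F θ r)) (K θ r) r := fun θ r => by
    have h0 : HasDerivAt (fun r : ℝ => (r : ℂ)) 1 r := Complex.ofRealCLM.hasDerivAt
    have h1 := (hasDerivAt_heatExp z t (r * e θ)).comp r (h0.mul_const (e θ))
    have h2 := (h0.mul (h1.mul_const (e θ))).const_mul I
    refine h2.congr_deriv ?_
    simp only [hK, Function.comp]; ring
  have hexp : IntegrableOn (fun r => Real.exp (-c * r)) (Ioi 0) := exp_neg_integrableOn_Ioi 0 hc
  have hFb : ∀ θ ∈ Icc 0 (Real.pi / 4), ∀ r : ℝ, 0 ≤ r → (1 + r) ^ 2 * ‖F θ r‖ ≤ C * Real.exp (-c * r) := by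
    intro θ hθ r hr
    simp only [hF, norm_mul, hen, mul_one]
    exact hb θ hθ r hr
  have hKb : ∀ θ ∈ Icc 0 (Real.pi / 4), ∀ r : ℝ, 0 ≤ r →
      ‖K θ r‖ ≤ (1 + z + 2 * t) * C * Real.exp (-c * r) := by
    intro θ hθ r hr
    have h1 : ‖1 + r * e θ * (I * z - 2 * (r * e θ) * t)‖ ≤ 1 + r * (z + 2 * r * t) := by
      refine (norm_add_le _ _).trans ?_
      rw [norm_one, norm_mul, norm_mul, hen, Complex.norm_real, Real.norm_of_nonneg hr, mul_one]
      gcongr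
      refine (norm_sub_le _ _).trans (le_of_eq ?_)
      simp [hen, abs_of_nonneg hr, abs_of_pos hz, abs_of_pos ht]
    have h2 : 1 + r * (z + 2 * r * t) ≤ (1 + z + 2 * t) * (1 + r) ^ 2 := by
      nlinarith [mul_nonneg hr hz.le, mul_nonneg (mul_nonneg hr hr) hz.le, mul_nonneg hr ht.le]
    calc ‖K θ r‖ = ‖heatExp z t (r * e θ)‖ * ‖1 + r * e θ * (I * z - 2 * (r * e θ) * t)‖ := by
          simp only [hK, norm_mul, hen, Complex.norm_I, one_mul]
      _ ≤ ‖heatExp z t (r * e θ)‖ * ((1 + z + 2 * t) * (1 + r) ^ 2) := by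
          gcongr; exact h1.trans h2
      _ = (1 + z + 2 * t) * ((1 + r) ^ 2 * ‖heatExp z t (r * e θ)‖) := by ring
      _ ≤ (1 + z + 2 * t) * (C * Real.exp (-c * r)) :=
          mul_le_mul_of_nonneg_left (hb θ hθ r hr) (by positivity)
      _ = _ := by ring
  have hFint : ∀ θ ∈ Icc 0 (Real.pi / 4), IntegrableOn (F θ) (Ioi 0) := fun θ hθ => by
    refine Integrable.mono' (hexp.const_mul C) ?_ ?_
    · have : Continuous (F θ) := by
        simp only [hF]; exact (hEc.comp (by fun_prop)).mul continuous_const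
      exact this.aestronglyMeasurable
    · filter_upwards [ae_restrict_mem measurableSet_Ioi] with r hr
      refine le_trans ?_ (hFb θ hθ r (le_of_lt hr))
      exact le_mul_of_one_le_left (norm_nonneg _) (one_le_pow₀ (by linarith [mem_Ioi.1 hr]))
  -- each radial integral of the derivative in `θ` vanishes, as that derivative is a radial one
  have hzero : ∀ θ ∈ Icc 0 (Real.pi / 4), ∫ r in Ioi (0 : ℝ), K θ r = 0 := fun θ hθ => by
    have hint : IntegrableOn (K θ) (Ioi 0) := by
      refine Integrable.mono' (hexp.const_mul ((1 + z + 2 * t) * C))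
        (hKc.comp (Continuous.prodMk_right θ)).aestronglyMeasurable ?_
      filter_upwards [ae_restrict_mem measurableSet_Ioi] with r hr using hKb θ hθ r (le_of_lt hr)
    have hlim : Tendsto (fun r : ℝ => I * (r * F θ r)) atTop (𝓝 0) := by
      refine squeeze_zero_norm' (a := fun r => C * Real.exp (-c * r)) ?_ ?_
      · filter_upwards [eventually_ge_atTop 0] with r hr
        refine le_trans ?_ (hFb θ hθ r hr)
        rw [norm_mul, Complex.norm_I, one_mul, norm_mul, Complex.norm_real, Real.norm_of_nonneg hr]
        gcongr
        nlinarith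
      · have : Tendsto (fun r : ℝ => Real.exp (-c * r)) atTop (𝓝 0) :=
          Real.tendsto_exp_atBot.comp (tendsto_id.const_mul_atTop_of_neg (by linarith))
        simpa using this.const_mul C
    have := integral_Ioi_of_hasDerivAt_of_tendsto' (a := 0) (fun r _ => hdr θ r) hint hlim
    simpa using this
  have hswap : ∫ r in Ioi (0 : ℝ), (F (Real.pi / 4) r - F 0 r) = 0 := by
    have h1 : ∀ r, F (Real.pi / 4) r - F 0 r = ∫ θ in Ioc 0 (Real.pi / 4), K θ r := fun r => by
      rw [← intervalIntegral.integral_of_le hpi]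
      refine (intervalIntegral.integral_eq_sub_of_hasDerivAt (fun θ _ => hdθ θ r) ?_).symm
      exact (hKc.comp (Continuous.prodMk_left r)).intervalIntegrable _ _
    simp only [h1]
    rw [integral_integral_swap]
    · rw [setIntegral_congr_fun measurableSet_Ioc fun θ hθ => hzero θ (Ioc_subset_Icc_self hθ)]
      simp
    · have hcst : Integrable (fun _ : ℝ => (1 : ℝ)) (volume.restrict (Ioc 0 (Real.pi / 4))) :=
        integrable_const _
      refine Integrable.mono' ((hexp.const_mul ((1 + z + 2 * t) * C)).mul_prod hcst) ?_ ?_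
      · exact (hKc.comp continuous_swap).aestronglyMeasurable
      · rw [Measure.prod_restrict]
        filter_upwards [ae_restrict_mem (measurableSet_Ioi.prod measurableSet_Ioc)] with p hp
        rw [mul_one]
        exact hKb p.2 (Ioc_subset_Icc_self hp.2) p.1 (le_of_lt hp.1)
  rw [integral_sub (hFint _ ⟨hpi, le_rfl⟩) (hFint _ ⟨le_rfl, hpi⟩), sub_eq_zero] at hswap
  have h0 : F 0 = fun r : ℝ => heatExp z t r := by
    funext r; simp [hF, he]
  rw [h0] at hswap
  exact hswap

/-- The Fourier transform of a Gaussian. -/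
theorem integral_heatExp (z : ℝ) {t : ℝ} (ht : 0 < t) :
    ∫ r : ℝ, heatExp z t r = √Real.pi * hk 0 1 z t := by
  have h := fourierIntegral_gaussian (b := (t : ℂ)) (by simpa using ht) (z : ℂ)
  have e1 : ∀ r : ℝ, heatExp z t r = Complex.exp (I * z * r) * Complex.exp (-t * r ^ 2) := fun r => by
    rw [heatExp, ← Complex.exp_add]; congr 1; ring
  simp only [e1]
  rw [h]
  have e2 : ((Real.pi : ℂ) / t) ^ (1 / 2 : ℂ) = ((√Real.pi * (√t)⁻¹ : ℝ) : ℂ) := by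
    rw [← Complex.ofReal_div, ← div_eq_mul_inv, ← Real.sqrt_div Real.pi_pos.le, Real.sqrt_eq_rpow,
      Complex.ofReal_cpow (by positivity)]
    push_cast; rfl
  rw [e2, hk]
  push_cast
  rw [neg_div]; ring

theorem integrable_heatExp (z : ℝ) {t : ℝ} (ht : 0 < t) : Integrable fun r : ℝ => heatExp z t r := by
  refine Integrable.mono' (integrable_exp_neg_mul_sq ht)
    ((continuous_heatExp z t).comp Complex.continuous_ofReal).aestronglyMeasurable (ae_of_all _ fun r => ?_)
  rw [norm_heatExp, ← Complex.ofReal_pow, Complex.ofReal_im, Complex.ofReal_re]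
  refine le_of_eq (congrArg _ ?_)
  ring

theorem exp_three_pi_div_four : Complex.exp (I * (3 * Real.pi / 4 : ℝ)) =
    -conj (Complex.exp (I * (Real.pi / 4 : ℝ))) := by
  rw [← Complex.exp_conj, neg_eq_neg_one_mul, ← Complex.exp_pi_mul_I, ← Complex.exp_add]
  congr 1
  simp only [map_mul, Complex.conj_I, Complex.conj_ofReal]
  push_cast; ring

/-- The contour `γ` is rotated to the real line: its left ray is the image of its right ray under
`w ↦ -conj w`, which conjugates the heat exponential. -/
theorem gammaIntegral_heatExp {z t : ℝ} (hz : 0 < z) (ht : 0 < t) :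
    gammaIntegral (heatExp z t) = √Real.pi * hk 0 1 z t := by
  have h2 : ∫ r in Ioi (0 : ℝ), heatExp z t (r * Complex.exp (I * (3 * Real.pi / 4 : ℝ))) *
      Complex.exp (I * (3 * Real.pi / 4 : ℝ)) = -conj (∫ r in Ioi (0 : ℝ), heatExp z t r) := by
    rw [← integral_heatExp_rotate hz ht, ← integral_conj, ← integral_neg]
    refine integral_congr_ae (ae_of_all _ fun r => ?_)
    simp only [exp_three_pi_div_four, map_mul]
    rw [← heatExp_neg_conj, map_mul, Complex.conj_ofReal, mul_neg, mul_neg]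
  rw [gammaIntegral, h2, integral_heatExp_rotate hz ht, ← integral_heatExp z ht, sub_neg_eq_add,
    ← intervalIntegral.integral_Iic_add_Ioi (b := 0) (integrable_heatExp z ht).integrableOn
      (integrable_heatExp z ht).integrableOn, add_comm, ← neg_zero, ← integral_comp_neg_Ioi, neg_zero,
    ← integral_conj]
  congr 1
  refine integral_congr_ae (ae_of_all _ fun r => ?_)
  simp only
  rw [← heatExp_neg_conj, Complex.conj_ofReal, Complex.ofReal_neg]

/-- The two directions of the contour `γ` lie in the upper half-plane and have imaginary squares. -/
structure IsRay (η : ℂ) : Prop where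
  norm_eq : ‖η‖ = 1
  sq_re : (η ^ 2).re = 0
  im_pos : 0 < η.im

theorem isRay_exp_pi_div_four : IsRay (Complex.exp (I * (Real.pi / 4 : ℝ))) := by
  have h : Complex.exp (I * (Real.pi / 4 : ℝ)) = ((√2 / 2 : ℝ) : ℂ) + ((√2 / 2 : ℝ) : ℂ) * I := by
    rw [mul_comm, Complex.exp_mul_I, ← Complex.ofReal_cos, ← Complex.ofReal_sin, Real.cos_pi_div_four,
      Real.sin_pi_div_four]
  refine ⟨by rw [mul_comm, Complex.norm_exp_ofReal_mul_I], ?_, ?_⟩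
  · rw [h, pow_two, Complex.mul_re]; simp
  · rw [h]; simp

theorem isRay_exp_three_pi_div_four : IsRay (Complex.exp (I * (3 * Real.pi / 4 : ℝ))) := by
  obtain ⟨h1, h2, h3⟩ := isRay_exp_pi_div_four
  rw [exp_three_pi_div_four]
  refine ⟨by rw [norm_neg, Complex.norm_conj, h1], ?_, ?_⟩
  · rw [neg_sq, ← map_pow, Complex.conj_re, h2]
  · rw [Complex.neg_im, Complex.conj_im, neg_neg]; exact h3

namespace IsRay

variable {η : ℂ}

theorem norm_heatExp (hη : IsRay η) (z t r : ℝ) :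
    ‖heatExp z t (r * η)‖ = Real.exp (-(η.im * z) * r) := by
  rw [HalfLineHeat.norm_heatExp, mul_pow, ← Complex.ofReal_pow, Complex.re_ofReal_mul, hη.sq_re,
    Complex.im_ofReal_mul]
  congr 1; ring

theorem norm_mul_pow (hη : IsRay η) {r : ℝ} (hr : 0 ≤ r) (k : ℕ) : ‖((r : ℂ) * η) ^ k * η‖ = r ^ k := by
  rw [norm_mul, norm_pow, norm_mul, hη.norm_eq, Complex.norm_real, Real.norm_of_nonneg hr]; ring

theorem integrableOn_pow (hη : IsRay η) {x : ℝ} (hx : 0 < x) (k : ℕ) :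
    IntegrableOn (fun r => r ^ k * Real.exp (-(η.im * x) * r)) (Ioi 0) := by
  have := integrableOn_rpow_mul_exp_neg_mul_rpow (s := k) (p := 1) (b := η.im * x)
    (by linarith [k.cast_nonneg (α := ℝ)]) one_pos (mul_pos hη.im_pos hx)
  simpa using this

theorem integrableOn (hη : IsRay η) {z : ℝ} (hz : 0 < z) (t : ℝ) (k : ℕ) :
    IntegrableOn (fun r : ℝ => heatExp z t (r * η) * ((r * η) ^ k * η)) (Ioi 0) := by
  refine Integrable.mono' (hη.integrableOn_pow hz k) ?_ ?_
  · have : Continuous fun r : ℝ => heatExp z t (r * η) := (continuous_heatExp z t).comp (by fun_prop)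
    exact Continuous.aestronglyMeasurable (by fun_prop)
  · filter_upwards [ae_restrict_mem measurableSet_Ioi] with r hr
    rw [norm_mul, hη.norm_heatExp, hη.norm_mul_pow (le_of_lt hr), mul_comm]

/-- The integral along a ray of the derivative of the heat exponential is minus its value at the vertex. -/
theorem integral_deriv (hη : IsRay η) {z : ℝ} (hz : 0 < z) (t : ℝ) :
    I * z * (∫ r in Ioi (0 : ℝ), heatExp z t (r * η) * ((r * η) ^ 0 * η)) -
      2 * t * (∫ r in Ioi (0 : ℝ), heatExp z t (r * η) * ((r * η) ^ 1 * η)) = -1 := by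
  rw [← integral_const_mul, ← integral_const_mul, ← integral_sub ((hη.integrableOn hz t 0).const_mul _)
    ((hη.integrableOn hz t 1).const_mul _)]
  have hlim : Tendsto (fun r : ℝ => heatExp z t (r * η)) atTop (𝓝 0) := by
    refine squeeze_zero_norm (fun r => (hη.norm_heatExp z t r).le) ?_
    exact Real.tendsto_exp_atBot.comp
      (tendsto_id.const_mul_atTop_of_neg (by linarith [mul_pos hη.im_pos hz]))
  have hsub : IntegrableOn (fun r : ℝ => I * z * (heatExp z t (r * η) * ((r * η) ^ 0 * η)) -
      2 * t * (heatExp z t (r * η) * ((r * η) ^ 1 * η))) (Ioi 0) :=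
    ((hη.integrableOn hz t 0).const_mul (I * z)).sub ((hη.integrableOn hz t 1).const_mul (2 * t))
  have h := integral_Ioi_of_hasDerivAt_of_tendsto' (a := 0)
    (f := fun r : ℝ => heatExp z t (r * η))
    (f' := fun r : ℝ => I * z * (heatExp z t (r * η) * ((r * η) ^ 0 * η)) -
      2 * t * (heatExp z t (r * η) * ((r * η) ^ 1 * η))) (fun r _ => ?_)
    hsub hlim
  · rw [h]; simp [heatExp]
  · have h0 : HasDerivAt (fun r : ℝ => (r : ℂ)) 1 r := Complex.ofRealCLM.hasDerivAt
    refine ((hasDerivAt_heatExp z t (r * η)).comp r (h0.mul_const η)).congr_deriv ?_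
    ring

end IsRay

theorem gammaIntegral_heatExp_mul_pow (z t : ℝ) (k : ℕ) :
    gammaIntegral (fun w => heatExp z t w * w ^ k) =
      (∫ r in Ioi (0 : ℝ), heatExp z t (r * Complex.exp (I * (Real.pi / 4 : ℝ))) *
        ((r * Complex.exp (I * (Real.pi / 4 : ℝ))) ^ k * Complex.exp (I * (Real.pi / 4 : ℝ)))) -
      ∫ r in Ioi (0 : ℝ), heatExp z t (r * Complex.exp (I * (3 * Real.pi / 4 : ℝ))) *
        ((r * Complex.exp (I * (3 * Real.pi / 4 : ℝ))) ^ k *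
          Complex.exp (I * (3 * Real.pi / 4 : ℝ))) := by
  simp only [gammaIntegral, mul_assoc]

/-- Integration by parts along both rays; the contributions of the vertex cancel. -/
theorem gammaIntegral_heatExp_mul {z t : ℝ} (hz : 0 < z) (ht : 0 < t) :
    gammaIntegral (fun w => heatExp z t w * w ^ 1) = I / 2 * (√Real.pi * hk 1 3 z t) := by
  have h1 := isRay_exp_pi_div_four.integral_deriv hz t
  have h2 := isRay_exp_three_pi_div_four.integral_deriv hz t
  have h0 := gammaIntegral_heatExp hz ht
  have h0' := gammaIntegral_heatExp_mul_pow z t 0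
  simp only [pow_zero, mul_one] at h0'
  rw [h0] at h0'
  simp only [pow_zero, one_mul] at h0' h1 h2
  rw [gammaIntegral_heatExp_mul_pow]
  have hk13 : (t : ℂ) * hk 1 3 z t = z * hk 0 1 z t := by
    have : t * hk 1 3 z t = z * hk 0 1 z t := by
      have hs : (√t)⁻¹ ^ 3 = (√t)⁻¹ / t := by
        nth_rewrite 3 [← Real.sq_sqrt ht.le]
        field_simp
      simp only [hk, hs]
      field_simp
    exact_mod_cast this
  have htc : (t : ℂ) ≠ 0 := by exact_mod_cast ht.ne'
  refine mul_left_cancel₀ (mul_ne_zero two_ne_zero htc) ?_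
  linear_combination h2 - h1 - I * z * h0' - I * √Real.pi * hk13

end Rays

/-! ### The contour integrals as heat potentials -/

section Fubini

open Complex (I)

variable {α : Type*} [MeasurableSpace α] {μ : Measure α} [SFinite μ] {v : α → ℂ} {Z S : α → ℝ}

/-- On the rays `|e^{-w²s}| = 1`, and `|e^{iwz}|` decreases exponentially, uniformly for `z ≥ x > 0`; hence
Fubini applies to any integrable density. -/
theorem IsRay.integral_swap {η : ℂ} (hη : IsRay η) (hv : Integrable v μ) (hZ : Measurable Z)
    (hS : Measurable S) {x : ℝ} (hx : 0 < x) (hZx : ∀ᵐ a ∂μ, x ≤ Z a) (k : ℕ) :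
    Integrable (fun a => (∫ r in Ioi (0 : ℝ), heatExp (Z a) (S a) (r * η) * ((r * η) ^ k * η)) * v a) μ ∧
      ∫ r in Ioi (0 : ℝ), (∫ a, heatExp (Z a) (S a) (r * η) * v a ∂μ) * ((r * η) ^ k * η) =
        ∫ a, (∫ r in Ioi (0 : ℝ), heatExp (Z a) (S a) (r * η) * ((r * η) ^ k * η)) * v a ∂μ := by
  have hint : Integrable (fun p : ℝ × α =>
      heatExp (Z p.2) (S p.2) (p.1 * η) * ((p.1 * η) ^ k * η) * v p.2)
      ((volume.restrict (Ioi (0 : ℝ))).prod μ) := by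
    refine Integrable.mono' ((hη.integrableOn_pow hx k).mul_prod hv.norm) ?_ ?_
    · refine AEStronglyMeasurable.mul (Measurable.aestronglyMeasurable ?_)
        hv.aestronglyMeasurable.comp_snd
      unfold heatExp
      fun_prop
    · filter_upwards [Measure.quasiMeasurePreserving_snd.ae hZx,
        Measure.quasiMeasurePreserving_fst.ae (ae_restrict_mem measurableSet_Ioi)] with p hp hr
      have hr' : 0 < p.1 := hr
      rw [norm_mul, norm_mul, hη.norm_heatExp, hη.norm_mul_pow hr'.le, mul_comm (Real.exp _)]
      gcongr
      exact hη.im_pos.le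
  constructor
  · simpa only [integral_mul_const] using hint.integral_prod_right
  · simp only [← integral_mul_const]
    refine Eq.trans ?_ (integral_integral_swap hint)
    simp only [mul_right_comm]

theorem integral_gammaIntegral_swap (hv : Integrable v μ) (hZ : Measurable Z)
    (hS : Measurable S) {x : ℝ} (hx : 0 < x) (hZx : ∀ᵐ a ∂μ, x ≤ Z a) (k : ℕ) :
    Integrable (fun a => gammaIntegral (fun w => heatExp (Z a) (S a) w * w ^ k) * v a) μ ∧
      gammaIntegral (fun w => (∫ a, heatExp (Z a) (S a) w * v a ∂μ) * w ^ k) =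
        ∫ a, gammaIntegral (fun w => heatExp (Z a) (S a) w * w ^ k) * v a ∂μ := by
  obtain ⟨i1, e1⟩ := isRay_exp_pi_div_four.integral_swap hv hZ hS hx hZx k
  obtain ⟨i2, e2⟩ := isRay_exp_three_pi_div_four.integral_swap hv hZ hS hx hZx k
  simp only [gammaIntegral_heatExp_mul_pow, sub_mul]
  refine ⟨i1.sub i2, ?_⟩
  rw [integral_sub i1 i2, ← e1, ← e2]
  simp only [gammaIntegral, mul_assoc]

/-- The contour integral of a superposition of heat exponentials is the superposition of the heat kernels. -/
theorem gammaIntegral_heatExp_potential (hv : Integrable v μ) (hZ : Measurable Z)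
    (hS : Measurable S) {x : ℝ} (hx : 0 < x) (hZx : ∀ᵐ a ∂μ, x ≤ Z a) (hS0 : ∀ᵐ a ∂μ, 0 < S a) :
    Integrable (fun a => (√Real.pi * hk 0 1 (Z a) (S a) : ℂ) * v a) μ ∧
      gammaIntegral (fun w => ∫ a, heatExp (Z a) (S a) w * v a ∂μ) =
        ∫ a, (√Real.pi * hk 0 1 (Z a) (S a) : ℂ) * v a ∂μ := by
  obtain ⟨i, e⟩ := integral_gammaIntegral_swap hv hZ hS hx hZx 0
  have hae : (fun a => gammaIntegral (fun w => heatExp (Z a) (S a) w * w ^ 0) * v a) =ᵐ[μ]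
      fun a => (√Real.pi * hk 0 1 (Z a) (S a) : ℂ) * v a := by
    filter_upwards [hZx, hS0] with a h1 h2
    simp only [pow_zero, mul_one]
    rw [← gammaIntegral_heatExp (hx.trans_le h1) h2]
  rw [integral_congr_ae hae] at e
  refine ⟨i.congr hae, ?_⟩
  simpa using e

/-- The analogue on the real line. Absolute convergence comes from `e^{-r²S}` alone, whose integral over
`r` is a multiple of `S^(-1/2)`; hence the assumption on `v`. -/
theorem integral_heatExp_potential (hv : AEStronglyMeasurable v μ) (hZ : Measurable Z)
    (hS : Measurable S) (hS0 : ∀ᵐ a ∂μ, 0 < S a)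
    (hint : Integrable (fun a => (√(S a))⁻¹ * ‖v a‖) μ) :
    Integrable (fun a => (√Real.pi * hk 0 1 (Z a) (S a) : ℂ) * v a) μ ∧
      ∫ r : ℝ, (∫ a, heatExp (Z a) (S a) r * v a ∂μ) =
        ∫ a, (√Real.pi * hk 0 1 (Z a) (S a) : ℂ) * v a ∂μ := by
  have hi : Integrable (fun p : ℝ × α => heatExp (Z p.2) (S p.2) p.1 * v p.2)
      ((volume : Measure ℝ).prod μ) := by
    rw [integrable_prod_iff']
    · constructor
      · filter_upwards [hS0] with a ha using (integrable_heatExp (Z a) ha).mul_const _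
      · refine (hint.const_mul √Real.pi).congr ?_
        filter_upwards [hS0] with a ha
        simp only [norm_mul, integral_mul_const]
        rw [← mul_assoc]
        congr 1
        have : ∀ r : ℝ, ‖heatExp (Z a) (S a) r‖ = Real.exp (-(S a) * r ^ 2) := fun r => by
          rw [norm_heatExp, ← Complex.ofReal_pow, Complex.ofReal_im, Complex.ofReal_re]
          congr 1; ring
        simp only [this]
        rw [integral_gaussian, Real.sqrt_div Real.pi_pos.le, div_eq_mul_inv]
    · refine AEStronglyMeasurable.mul (Measurable.aestronglyMeasurable ?_) hv.comp_snd
      unfold heatExp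
      fun_prop
  have hae : (fun a => ∫ r : ℝ, heatExp (Z a) (S a) r * v a) =ᵐ[μ]
      fun a => (√Real.pi * hk 0 1 (Z a) (S a) : ℂ) * v a := by
    filter_upwards [hS0] with a ha
    rw [integral_mul_const, integral_heatExp (Z a) ha]
  exact ⟨hi.integral_prod_right.congr hae, by rw [integral_integral_swap hi, integral_congr_ae hae]⟩

end Fubini

section Transforms

open Complex (I)

theorem heatExp_mul_hatTransform (u : ℝ → ℂ) (x t ε : ℝ) (w : ℂ) :
    heatExp x t w * hatTransform u (ε * w) = ∫ y in Ioi (0 : ℝ), heatExp (x - ε * y) t w * u y := by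
  rw [hatTransform, ← integral_const_mul]
  congr 1; funext y
  rw [← heatExp_mul_exp x t (ε * y), ← mul_assoc]
  congr 3
  push_cast; ring

/-- The direct terms of the initial values give the heat kernel at `x - y`, the terms on `γ` that at `x + y`;
their difference is the odd reflection. -/
theorem opI0_eq_heatP {u : ℝ → ℂ} (hu : Decaying u) {x t : ℝ} (hx : 0 < x) (ht : 0 < t) :
    opI0plus u x t - opI0minus u x t = √Real.pi * heatP (-1) u x t := by
  obtain ⟨i1, e1⟩ := integral_heatExp_potential (μ := volume.restrict (Ioi (0 : ℝ))) (v := u)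
    (Z := fun y => x - 1 * y) (S := fun _ => t) hu.integrableOn.aestronglyMeasurable
    (by fun_prop) (by fun_prop) (ae_of_all _ fun _ => ht) (hu.integrableOn.norm.const_mul _)
  obtain ⟨i2, e2⟩ := gammaIntegral_heatExp_potential (μ := volume.restrict (Ioi (0 : ℝ))) (v := u)
    (Z := fun y => x - (-1) * y) (S := fun _ => t) hu.integrableOn (by fun_prop) (by fun_prop) hx
    (by filter_upwards [ae_restrict_mem measurableSet_Ioi] with y hy
        linarith [mem_Ioi.1 hy]) (ae_of_all _ fun _ => ht)
  simp only [← heatExp_mul_hatTransform] at e1 e2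
  have h1 : opI0plus u x t = ∫ y in Ioi (0 : ℝ), (√Real.pi * hk 0 1 (x - 1 * y) t : ℂ) * u y := by
    rw [← e1, opI0plus]; simp
  have h2 : opI0minus u x t = ∫ y in Ioi (0 : ℝ), (√Real.pi * hk 0 1 (x - (-1) * y) t : ℂ) * u y := by
    rw [← e2, opI0minus]; simp
  rw [h1, h2, heatP_eq_foldInt (by simp) hu x ht, foldInt, ← integral_const_mul]
  rw [← integral_sub i1 i2]
  refine integral_congr_ae (ae_of_all _ fun y => ?_)
  simp only [Complex.real_smul]
  push_cast; ring_nf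

/-- The factor `λ` in the integral over `γ` turns the heat kernel into the kernel of the double layer. -/
theorem opI1_eq_layer1 {g : ℝ → ℂ} (hg : ContinuousOn g (Ici 0)) {x t : ℝ} (hx : 0 < x) (ht : 0 < t) :
    -(2 * I * opI1 g x t) = √Real.pi * layer1 g x t := by
  have hgi : IntegrableOn g (Ioc 0 t) :=
    ((hg.mono Icc_subset_Ici_self).integrableOn_compact isCompact_Icc).mono_set Ioc_subset_Icc_self
  obtain ⟨-, e⟩ := integral_gammaIntegral_swap (μ := volume.restrict (Ioc 0 t)) (v := g)
    (Z := fun _ => x) (S := fun τ => t - τ) hgi (by fun_prop) (by fun_prop) hx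
    (ae_of_all _ fun _ => le_rfl) 1
  have h1 : ∀ w : ℂ, heatExp x t w * tildeTransform g (w ^ 2) t =
      ∫ τ in Ioc 0 t, heatExp x (t - τ) w * g τ := fun w => by
    rw [tildeTransform, intervalIntegral.integral_of_le ht.le, ← integral_const_mul]
    congr 1; funext τ
    rw [← mul_assoc, heatExp, heatExp, ← Complex.exp_add]
    congr 2; push_cast; ring
  have hne : ∀ᵐ τ ∂(volume.restrict (Ioc 0 t)), τ ≠ t :=
    ae_restrict_of_ae (by simp [ae_iff, measure_singleton])
  have h2 : (fun τ => gammaIntegral (fun w => heatExp x (t - τ) w * w ^ 1) * g τ)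
      =ᵐ[volume.restrict (Ioc 0 t)]
      fun τ => I / 2 * √Real.pi * (hk 1 3 x (t - τ) • g τ) := by
    filter_upwards [ae_restrict_mem measurableSet_Ioc, hne] with τ hτ hτt
    rw [gammaIntegral_heatExp_mul hx (sub_pos.2 (lt_of_le_of_ne hτ.2 hτt)), Complex.real_smul]
    ring
  simp only [← h1] at e
  have h3 : opI1 g x t = I / 2 * √Real.pi * layer1 g x t := by
    rw [opI1, layer1_eq_integral g hx ht]
    simp only [pow_one] at e h2
    rw [e, integral_congr_ae h2, integral_const_mul, ← intervalIntegral.integral_of_le ht.le]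
    congr 1
    have := intervalIntegral.integral_comp_sub_left (a := 0) (b := t)
      (fun s => hk 1 3 x s • g (t - s)) t
    simpa using this
  rw [h3]
  linear_combination (-(√Real.pi * layer1 g x t) : ℂ) * Complex.I_mul_I

/-- The measure `dτ dy` on `(0, t] × (0, ∞)`. -/
def stripMeasure (t : ℝ) : Measure (ℝ × ℝ) :=
  (volume.restrict (Ioc 0 t)).prod (volume.restrict (Ioi 0))

instance (t : ℝ) : SFinite (stripMeasure t) := by unfold stripMeasure; infer_instance

theorem ae_stripMeasure (t : ℝ) : ∀ᵐ q ∂stripMeasure t, q.1 ∈ Ioc 0 t ∧ q.2 ∈ Ioi (0 : ℝ) := by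
  rw [stripMeasure, Measure.prod_restrict]
  exact ae_restrict_mem (measurableSet_Ioc.prod measurableSet_Ioi)

theorem ae_stripMeasure_lt (t : ℝ) : ∀ᵐ q ∂stripMeasure t, 0 < t - q.1 := by
  have hne : ∀ᵐ τ ∂(volume.restrict (Ioc 0 t)), τ ≠ t :=
    ae_restrict_of_ae (by simp [ae_iff, measure_singleton])
  filter_upwards [ae_stripMeasure t, Measure.quasiMeasurePreserving_fst.ae hne] with q hq hq'
  exact sub_pos.2 (lt_of_le_of_ne hq.1.2 hq')

namespace StripDecaying

variable {f : ℝ × ℝ → ℂ}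

theorem aestronglyMeasurable (hf : StripDecaying f) (t : ℝ) :
    AEStronglyMeasurable (fun q : ℝ × ℝ => f (q.2, q.1)) (stripMeasure t) := by
  rw [stripMeasure, Measure.prod_restrict]
  refine ContinuousOn.aestronglyMeasurable ?_ (measurableSet_Ioc.prod measurableSet_Ioi)
  exact hf.cont.comp (f := fun q : ℝ × ℝ => (q.2, q.1)) (by fun_prop)
    fun q hq => ⟨(show (0 : ℝ) ≤ q.2 from le_of_lt hq.2), (show (0 : ℝ) ≤ q.1 from le_of_lt hq.1.1)⟩

theorem integrable_mul (hf : StripDecaying f) {t : ℝ} {ρ : ℝ → ℝ} (hρ : IntegrableOn ρ (Ioc 0 t))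
    (hρ0 : ∀ τ, 0 ≤ ρ τ) : Integrable (fun q => ρ q.1 * ‖f (q.2, q.1)‖) (stripMeasure t) := by
  obtain ⟨M, hM⟩ := hf.bound t
  have h1 : Integrable (fun y : ℝ => M * (1 + y ^ 2)⁻¹) (volume.restrict (Ioi 0)) :=
    (integrable_inv_one_add_sq.const_mul M).integrableOn
  refine Integrable.mono' (hρ.mul_prod h1)
    (hρ.aestronglyMeasurable.comp_fst.mul (hf.aestronglyMeasurable t).norm) ?_
  filter_upwards [ae_stripMeasure t] with q hq
  have hy : 0 < q.2 := hq.2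
  rw [Real.norm_of_nonneg (mul_nonneg (hρ0 _) (norm_nonneg _))]
  refine mul_le_mul_of_nonneg_left ?_ (hρ0 _)
  rw [← div_eq_mul_inv, le_div_iff₀ (by positivity), mul_comm]
  refine le_trans ?_ (hM q.2 q.1 hy.le hq.1.1.le hq.1.2)
  gcongr
  nlinarith

theorem integrable (hf : StripDecaying f) (t : ℝ) :
    Integrable (fun q : ℝ × ℝ => f (q.2, q.1)) (stripMeasure t) := by
  have := hf.integrable_mul (t := t) (ρ := fun _ => 1) (integrableOn_const (by simp))
    (fun _ => zero_le_one)
  rw [← integrable_norm_iff (hf.aestronglyMeasurable t)]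
  simpa using this

end StripDecaying

/-- The sign condition on `ε w.im` keeps the integral over `y` absolutely convergent: `ε = 1` is used for
real `w`, and `ε = -1` on the contour `γ`. -/
theorem heatExp_mul_forcingTransform {f : ℝ × ℝ → ℂ} (hf : StripDecaying f) {t : ℝ} (ht : 0 ≤ t)
    (x ε : ℝ) {w : ℂ} (hw : ε * w.im ≤ 0) :
    heatExp x t w * forcingTransform f (ε * w) (w ^ 2) t =
      ∫ q, heatExp (x - ε * q.2) (t - q.1) w * f (q.2, q.1) ∂stripMeasure t := by
  have hint : Integrable (fun q : ℝ × ℝ => heatExp (x - ε * q.2) (t - q.1) w * f (q.2, q.1))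
      (stripMeasure t) := by
    refine Integrable.mono' ((hf.integrable t).norm.const_mul
      (Real.exp (-(w.im * x) + |(w ^ 2).re| * t))) ?_ ?_
    · refine AEStronglyMeasurable.mul (Measurable.aestronglyMeasurable ?_) (hf.aestronglyMeasurable t)
      unfold heatExp
      fun_prop
    · filter_upwards [ae_stripMeasure t] with q hq
      have hy : 0 < q.2 := hq.2
      rw [norm_mul, norm_heatExp]
      gcongr
      have h1 : ε * w.im * q.2 ≤ 0 := mul_nonpos_of_nonpos_of_nonneg hw hy.le
      have h2 : -((w ^ 2).re * (t - q.1)) ≤ |(w ^ 2).re| * t := by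
        calc -((w ^ 2).re * (t - q.1)) ≤ |(w ^ 2).re| * (t - q.1) := by
              rw [← neg_mul]
              exact mul_le_mul_of_nonneg_right (neg_le_abs _) (by linarith [hq.1.2])
          _ ≤ |(w ^ 2).re| * t := by gcongr; linarith [hq.1.1]
      nlinarith
  rw [stripMeasure] at hint ⊢
  rw [integral_prod _ hint, forcingTransform, intervalIntegral.integral_of_le ht, ← integral_const_mul]
  congr 1; funext τ
  rw [hatTransform, ← integral_const_mul, ← integral_const_mul]
  congr 1; funext y
  simp only [heatExp]
  rw [← mul_assoc, ← mul_assoc, ← Complex.exp_add, ← Complex.exp_add]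
  congr 2
  push_cast; ring

/-- Like `opI0_eq_heatP`, with the additional integration over `(0, t)`. -/
theorem opI2_eq_heatW {f : ℝ × ℝ → ℂ} (hf : StripDecaying f) {x t : ℝ} (hx : 0 < x) (ht : 0 < t) :
    opI2plus f x t - opI2minus f x t = √Real.pi * heatW (-1) f x t := by
  have hρ : IntegrableOn (fun τ => (√(t - τ))⁻¹) (Ioc 0 t) := by
    have h := (integrable_inv_sqrt 0 t).comp_sub_left t
    simp only [sub_zero, sub_self] at h
    rw [← intervalIntegrable_iff_integrableOn_Ioc_of_le ht.le]
    refine h.symm.congr fun τ hτ => ?_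
    rw [uIoc_of_le ht.le] at hτ
    rw [Real.rpow_neg (by linarith [hτ.2]), Real.sqrt_eq_rpow]
  obtain ⟨i1, e1⟩ := integral_heatExp_potential (μ := stripMeasure t)
    (v := fun q : ℝ × ℝ => f (q.2, q.1)) (Z := fun q => x - (1 : ℝ) * q.2) (S := fun q => t - q.1)
    (hf.aestronglyMeasurable t) (by fun_prop) (by fun_prop) (ae_stripMeasure_lt t)
    (hf.integrable_mul hρ fun τ => by positivity)
  obtain ⟨i2, e2⟩ := gammaIntegral_heatExp_potential (μ := stripMeasure t)
    (v := fun q : ℝ × ℝ => f (q.2, q.1)) (Z := fun q => x - (-1 : ℝ) * q.2) (S := fun q => t - q.1)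
    (hf.integrable t) (by fun_prop) (by fun_prop) hx
    (by filter_upwards [ae_stripMeasure t] with q hq
        linarith [mem_Ioi.1 hq.2]) (ae_stripMeasure_lt t)
  have h1 : opI2plus f x t = ∫ q, (√Real.pi * hk 0 1 (x - (1 : ℝ) * q.2) (t - q.1) : ℂ) * f (q.2, q.1)
      ∂stripMeasure t := by
    rw [← e1, opI2plus]
    congr 1; funext r
    rw [← heatExp_mul_forcingTransform hf ht.le x 1 (by simp)]
    simp
  have h2 : opI2minus f x t = ∫ q, (√Real.pi * hk 0 1 (x - (-1 : ℝ) * q.2) (t - q.1) : ℂ) *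
      f (q.2, q.1) ∂stripMeasure t := by
    rw [← e2, opI2minus, gammaIntegral, gammaIntegral]
    have hr : ∀ {η : ℂ}, IsRay η → ∫ r in Ioi (0 : ℝ), heatExp x t (r * η) *
        forcingTransform f (-(r * η)) ((r * η) ^ 2) t * η =
        ∫ r in Ioi (0 : ℝ), (∫ q, heatExp (x - (-1 : ℝ) * q.2) (t - q.1) (r * η) * f (q.2, q.1)
          ∂stripMeasure t) * η := fun {η} hη => by
      refine setIntegral_congr_fun measurableSet_Ioi fun r hr => ?_
      rw [← heatExp_mul_forcingTransform hf ht.le x (-1) ?_]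
      · simp
      · rw [Complex.im_ofReal_mul]
        have := mul_pos (mem_Ioi.1 hr) hη.im_pos
        linarith
    rw [hr isRay_exp_pi_div_four, hr isRay_exp_three_pi_div_four]
  have i12 : Integrable (fun q : ℝ × ℝ =>
      (√Real.pi * hk 0 1 (x - (1 : ℝ) * q.2) (t - q.1) : ℂ) * f (q.2, q.1) -
      (√Real.pi * hk 0 1 (x - (-1 : ℝ) * q.2) (t - q.1) : ℂ) * f (q.2, q.1)) (stripMeasure t) := i1.sub i2
  rw [h1, h2, ← integral_sub i1 i2]
  rw [stripMeasure] at i12 ⊢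
  rw [integral_prod _ i12, heatW, ← intervalIntegral.integral_of_le ht.le, ← intervalIntegral.integral_const_mul]
  have hcv := intervalIntegral.integral_comp_sub_left (a := 0) (b := t)
    (fun s => (√Real.pi : ℂ) * heatP (-1) (fun y => f (y, t - s)) x s) t
  simp only [sub_zero, sub_self, sub_sub_cancel] at hcv
  rw [← hcv]
  have hne : ∀ᵐ τ : ℝ, τ ≠ t := by simp [ae_iff, measure_singleton]
  refine intervalIntegral.integral_congr_ae ?_
  filter_upwards [hne] with τ hτt hτ
  rw [uIoc_of_le ht.le] at hτ
  rw [heatP_eq_foldInt (by simp) (hf.slice hτ.1.le) x (sub_pos.2 (lt_of_le_of_ne hτ.2 hτt)), foldInt,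
    ← integral_const_mul]
  refine integral_congr_ae (ae_of_all _ fun y => ?_)
  simp only [Complex.real_smul]
  push_cast; ring_nf

end Transforms

/-! ### The initial-boundary value problems -/

section SquareBounds

variable {D : Type*} [AddCommGroup D] [Module ℂ D] [TopologicalSpace D]
  {φ : ℕ → ℝ → D →ₗ[ℂ] ℂ} {a : ℕ → ℝ → D →ₗ[ℂ] ℂ} {f : ℕ → ℕ → ℝ × ℝ → D →ₗ[ℂ] ℂ}

/-- Bounds on the unit square by a continuous seminorm. -/
def SquareBounded (H : D → ℝ × ℝ → ℂ) : Prop :=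
  ∃ p : Seminorm ℂ D, Continuous p ∧ ∀ d, ∀ q ∈ unitSquare, ‖H d q‖ ≤ p d

namespace SquareBounded

theorem add {H₁ H₂ : D → ℝ × ℝ → ℂ} (h₁ : SquareBounded H₁) (h₂ : SquareBounded H₂) :
    SquareBounded fun d p => H₁ d p + H₂ d p := by
  obtain ⟨p, hp, hpb⟩ := h₁
  obtain ⟨q, hq, hqb⟩ := h₂
  obtain ⟨r, hr, hrb⟩ := exists_seminorm_add hp hq
  refine ⟨r, hr, fun d z hz => (norm_add_le _ _).trans ?_⟩
  rw [hrb]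
  exact add_le_add (hpb d z hz) (hqb d z hz)

theorem const_mul (c : ℂ) {H : D → ℝ × ℝ → ℂ} (h : SquareBounded H) :
    SquareBounded fun d p => c * H d p := by
  obtain ⟨p, hp, hpb⟩ := h
  obtain ⟨r, hr, hrb⟩ := exists_seminorm_const_mul hp (norm_nonneg c)
  refine ⟨r, hr, fun d z hz => ?_⟩
  rw [hrb, norm_mul]
  exact mul_le_mul_of_nonneg_left (hpb d z hz) (norm_nonneg c)

theorem heatP {σ : ℝ} (hσ : |σ| ≤ 1) (hφ : SchwartzJet φ) :
    SquareBounded fun d p => heatP σ (fun y => φ 0 y d) p.1 p.2 := by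
  obtain ⟨C, hC, hCb⟩ := exists_norm_heatP_le 1
  obtain ⟨p, hp, hpb⟩ := hφ.bound 0 0
  obtain ⟨r, hr, hrb⟩ := exists_seminorm_const_mul hp hC.le
  refine ⟨r, hr, fun d q hq => ?_⟩
  rw [hrb]
  exact hCb hσ (fun y hy => by simpa using hpb d y hy) q.1 q.2 hq.2.2

theorem layer0 (ha : SmoothJet a) :
    SquareBounded fun d p => layer0 (fun r => a 0 r d) p.1 p.2 := by
  obtain ⟨C, hC, hCb⟩ := exists_layer0_le 0 1
  obtain ⟨p, hp, hpb⟩ := ha.bound 0 1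
  obtain ⟨r, hr, hrb⟩ := exists_seminorm_const_mul hp hC.le
  refine ⟨r, hr, fun d q hq => ?_⟩
  rw [hrb]
  have := hCb (hpb d) q.1 q.2 hq.2.1 hq.2.2
  rw [pow_zero, one_mul] at this
  refine this.trans (mul_le_mul_of_nonneg_right ?_ (apply_nonneg p d))
  exact mul_le_of_le_one_right hC.le (Real.rpow_le_one hq.2.1 hq.2.2 (by norm_num))

theorem layer1 (ha : SmoothJet a) :
    SquareBounded fun d p => layer1 (fun r => a 0 r d) p.1 p.2 := by
  obtain ⟨C, hC, hCb⟩ := exists_layer1_le 0 1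
  obtain ⟨p, hp, hpb⟩ := ha.bound 0 1
  obtain ⟨r, hr, hrb⟩ := exists_seminorm_const_mul hp hC.le
  refine ⟨r, hr, fun d q hq => ?_⟩
  rw [hrb]
  simpa using hCb (hpb d) q.1 q.2 hq.2.1 hq.2.2

theorem heatW {σ : ℝ} (hσ : |σ| ≤ 1) (hf : StripJet f) :
    SquareBounded fun d p => heatW σ (fun q => f 0 0 q d) p.1 p.2 := by
  obtain ⟨C, hC, hCb⟩ := exists_heatW_le 0 1
  obtain ⟨p, hp, hpb⟩ := hf.bound 0 0 0 1
  obtain ⟨r, hr, hrb⟩ := exists_seminorm_const_mul hp hC.le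
  refine ⟨r, hr, fun d q hq => ?_⟩
  rw [hrb]
  have := hCb hσ (h := fun q => f 0 0 q d) (hpb d) q.1 q.2 hq.2.1 hq.2.2
  rw [pow_zero, one_mul] at this
  exact this.trans (mul_le_of_le_one_right (mul_nonneg hC.le (apply_nonneg p d)) hq.2.2)

end SquareBounded

end SquareBounds

section Problems

variable {D : Type*} [AddCommGroup D] [Module ℂ D]

/-- The solution of `h_t = h_xx + f` on the quarter-plane with initial values `φ` and boundary
values `a`. -/
def dirichletOp (φ : ℕ → ℝ → D →ₗ[ℂ] ℂ) (a : ℕ → ℝ → D →ₗ[ℂ] ℂ)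
    (f : ℕ → ℕ → ℝ × ℝ → D →ₗ[ℂ] ℂ) (d : D) (p : ℝ × ℝ) : ℂ :=
  ((√(4 * Real.pi))⁻¹ : ℝ) * (heatP (-1) (fun y => φ 0 y d) p.1 p.2 +
    layer1 (fun r => a 0 r d) p.1 p.2 + heatW (-1) (fun q => f 0 0 q d) p.1 p.2)

/-- The solution of `h_t = h_xx + f` on the quarter-plane with initial values `φ` and boundary
values `b` of `h_x`. -/
def neumannOp (φ : ℕ → ℝ → D →ₗ[ℂ] ℂ) (b : ℕ → ℝ → D →ₗ[ℂ] ℂ)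
    (f : ℕ → ℕ → ℝ × ℝ → D →ₗ[ℂ] ℂ) (d : D) (p : ℝ × ℝ) : ℂ :=
  ((√(4 * Real.pi))⁻¹ : ℝ) * (heatP 1 (fun y => φ 0 y d) p.1 p.2 +
    -2 * layer0 (fun r => b 0 r d) p.1 p.2 + heatW 1 (fun q => f 0 0 q d) p.1 p.2)

variable [TopologicalSpace D] {φ : ℕ → ℝ → D →ₗ[ℂ] ℂ} {a b : ℕ → ℝ → D →ₗ[ℂ] ℂ}
  {f : ℕ → ℕ → ℝ × ℝ → D →ₗ[ℂ] ℂ}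

theorem isHeatOp_dirichletOp (hφ : SchwartzJet φ) (ha : SmoothJet a) (hf : StripJet f) :
    IsHeatOp (dirichletOp φ a f) :=
  (((IsHeatOp.semigroup (by simp) hφ).add (.double ha)).add (.duhamel (by simp) hf)).const_mul _

theorem squareBounded_dirichletOp (hφ : SchwartzJet φ) (ha : SmoothJet a) (hf : StripJet f) :
    SquareBounded (dirichletOp φ a f) :=
  (((SquareBounded.heatP (by simp) hφ).add (.layer1 ha)).add (.heatW (by simp) hf)).const_mul _

theorem squareBounded_neumannOp (hφ : SchwartzJet φ) (hb : SmoothJet b) (hf : StripJet f) :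
    SquareBounded (neumannOp φ b f) :=
  (((SquareBounded.heatP (by simp) hφ).add ((SquareBounded.layer0 hb).const_mul _)).add
    (.heatW (by simp) hf)).const_mul _

theorem continuousOn_dirichletOp (hφ : SchwartzJet φ) (ha : SmoothJet a) (hf : StripJet f) {d : D}
    (h0 : φ 0 0 d = a 0 0 d) : ContinuousOn (dirichletOp φ a f d) Qbar := by
  intro p hp
  have hsub : Qbar ⊆ {q : ℝ × ℝ | 0 ≤ q.2} := fun q hq => hq.2
  have hφd := hφ.decaying 0 d
  have h1 : ContinuousWithinAt (fun p : ℝ × ℝ => heatP (-1) (fun y => φ 0 y d) p.1 p.2 +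
      layer1 (fun r => a 0 r d) p.1 p.2) Qbar p := by
    -- away from the corner both summands are continuous; at the corner only their sum is
    by_cases hp0 : p.1 ≠ 0 ∨ √p.2 ≠ 0
    · exact (continuousAt_heatP (by simp) hφd.cont hφd.exists_norm_le
        (hp0.imp id Or.inl)).continuousWithinAt.add
        ((continuousWithinAt_layer1 (ha.cont 0 d) hp.2 hp0).mono hsub)
    · rw [not_or, not_not, not_not, Real.sqrt_eq_zero hp.2] at hp0
      rw [show p = (0, 0) from Prod.ext hp0.1 hp0.2]
      exact continuousWithinAt_heatP_add_layer1 hφd.cont hφd.exists_norm_le (ha.cont 0 d) h0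
  exact (h1.add ((continuousWithinAt_heatW (by simp) (hf.stripDecaying 0 0 d) hp.2).mono
    hsub)).const_mul _

/-- No compatibility is needed: even reflections are continuous, and the single layer potential is
continuous at the corner. -/
theorem continuousOn_neumannOp (hφ : SchwartzJet φ) (hb : SmoothJet b) (hf : StripJet f) (d : D) :
    ContinuousOn (neumannOp φ b f d) Qbar := by
  intro p hp
  have hsub : Qbar ⊆ {q : ℝ × ℝ | 0 ≤ q.2} := fun q hq => hq.2
  have hφd := hφ.decaying 0 d
  exact (((continuousAt_heatP (by simp) hφd.cont hφd.exists_norm_le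
    (Or.inr (Or.inr rfl))).continuousWithinAt.add
    (((continuousWithinAt_layer0 (hb.cont 0 d) hp.2).mono hsub).const_mul _)).add
    ((continuousWithinAt_heatW (by simp) (hf.stripDecaying 0 0 d) hp.2).mono hsub)).const_mul _

/-- If `h` solves the Dirichlet problem with compatible data, then `h_x` solves the Neumann problem
with boundary values `h_xx = h_t - f = a' - f`. -/
theorem hasDerivAt_dirichletOp_space (hφ : SchwartzJet φ) (ha : SmoothJet a) (hf : StripJet f) {d : D}
    (h0 : φ 0 0 d = a 0 0 d) {p : ℝ × ℝ} (hp : p ∈ Q) :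
    HasDerivAt (fun x => dirichletOp φ a f d (x, p.2))
      (neumannOp (fun k => φ (k + 1)) (fun k t => a (k + 1) t - f 0 k (0, t))
        (fun k => f (k + 1)) d p) p.1 := by
  have h1 := hasDerivAt_heatP_space (σ := -1) (by simp) (hφ.decaying 0 d) (hφ.decaying 1 d)
    (hφ.deriv 0 d) p.1 hp.2
  have h2 := hasDerivAt_layer1_space (ha.cont 0 d) (ha.cont 1 d) (ha.deriv 0 d) hp.1 hp.2
  have h3 := hasDerivAt_heatW_space (σ := -1) (by simp) (hf.stripDecaying 0 0 d)
    (hf.stripDecaying 1 0 d) (fun y r => hf.deriv_space 0 0 d y r) hp.1 hp.2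
  refine (((h1.add h2).add h3).const_mul _).congr_deriv ?_
  have hsub : layer0 (fun r => (a 1 r - f 0 0 (0, r)) d) p.1 p.2 =
      layer0 (fun r => a 1 r d) p.1 p.2 - layer0 (fun r => f 0 0 (0, r) d) p.1 p.2 := by
    have := layer0_add (ha.shift.sub hf.boundary |>.cont 0 d) (hf.boundary.cont 0 d) p.1
      (le_of_lt hp.2)
    simp only [LinearMap.sub_apply, sub_add_cancel] at this
    rw [zero_add] at this
    rw [this]
    simp
  simp only [neumannOp, zero_add, hsub, neg_neg, h0, Complex.real_smul]
  push_cast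
  ring

/-- If `h` solves the Neumann problem, then `h_x` solves the Dirichlet problem. -/
theorem hasDerivAt_neumannOp_space (hφ : SchwartzJet φ) (hb : SmoothJet b) (hf : StripJet f) (d : D)
    {p : ℝ × ℝ} (hp : p ∈ Q) :
    HasDerivAt (fun x => neumannOp φ b f d (x, p.2))
      (dirichletOp (fun k => φ (k + 1)) b (fun k => f (k + 1)) d p) p.1 := by
  have h1 := hasDerivAt_heatP_space (σ := 1) (by simp) (hφ.decaying 0 d) (hφ.decaying 1 d)
    (hφ.deriv 0 d) p.1 hp.2
  have h2 := hasDerivAt_layer0_space (hb.cont 0 d) hp.1 hp.2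
  have h3 := hasDerivAt_heatW_space (σ := 1) (by simp) (hf.stripDecaying 0 0 d)
    (hf.stripDecaying 1 0 d) (fun y r => hf.deriv_space 0 0 d y r) hp.1 hp.2
  refine (((h1.add (h2.const_mul _)).add h3).const_mul _).congr_deriv ?_
  simp only [dirichletOp, zero_add, Complex.real_smul]
  push_cast
  ring

/-- If `h` solves the Dirichlet problem with compatible data, then `h_t` solves the Dirichlet problem
with initial values `h_t = h_xx + f = φ'' + f`. -/
theorem hasDerivAt_dirichletOp_time (hφ : SchwartzJet φ) (ha : SmoothJet a) (hf : StripJet f) {d : D}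
    (h0 : φ 0 0 d = a 0 0 d) {p : ℝ × ℝ} (hp : p ∈ Q) :
    HasDerivAt (fun t => dirichletOp φ a f d (p.1, t))
      (dirichletOp (fun k y => φ (k + 2) y + f k 0 (y, 0)) (fun k => a (k + 1))
        (fun k l => f k (l + 1)) d p) p.2 := by
  have h1 := hasDerivAt_heatP_time (σ := -1) (by simp) (hφ.decaying 0 d) (hφ.decaying 1 d)
    (hφ.decaying 2 d) (hφ.deriv 0 d) (hφ.deriv 1 d) p.1 hp.2
  have h2 := hasDerivAt_layer1_time (ha.cont 0 d) (ha.cont 1 d) (ha.deriv 0 d) hp.1 hp.2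
  have h3 := hasDerivAt_heatW_time (σ := -1) (by simp) (hf.stripDecaying 0 0 d)
    (hf.stripDecaying 0 1 d) (fun y r => hf.deriv_time 0 0 d y r) p.1 hp.2
  refine (((h1.add h2).add h3).const_mul _).congr_deriv ?_
  have hadd := heatP_add (σ := -1) (by simp) (hφ.decaying 2 d).cont (hf.initial.decaying 0 d).cont
    (hφ.decaying 2 d).exists_norm_le (hf.initial.decaying 0 d).exists_norm_le p.1 p.2
  simp only [dirichletOp, zero_add, LinearMap.add_apply, hadd, h0, Complex.real_smul]
  push_cast
  ring

variable [IsTopologicalAddGroup D]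

/-- With the compatibility condition of order zero the solution operator of the Dirichlet problem
maps continuously into `C^{(1,0)}`. -/
theorem exists_Ckl_one_zero_map (hφ : SchwartzJet φ) (ha : SmoothJet a) (hf : StripJet f)
    (h0 : ∀ d, φ 0 0 d = a 0 0 d) : ∃ Ψ : D → Ckl 1 0, Continuous Ψ ∧
      ∀ d, Ckl.toFun (Ψ d) = unitSquare.indicator (dirichletOp φ a f d) := by
  have hH := isHeatOp_dirichletOp hφ ha hf
  have hb := ha.shift.sub hf.boundary
  refine exists_Ckl_map (H := dirichletOp φ a f)
    (X := fun
      | 0 => dirichletOp φ a f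
      | _ => neumannOp (fun k => φ (k + 1)) (fun k t => a (k + 1) t - f 0 k (0, t))
        (fun k => f (k + 1)))
    (T := fun _ => dirichletOp φ a f)
    (fun d d' p hp => hH.map_add d d' (unitSquare_subset_Qbar hp))
    (fun c d p _ => hH.map_smul c d p) rfl rfl ?_ ?_ ?_ ?_ ?_ ?_
  · intro i hi d
    interval_cases i
    · exact continuousOn_dirichletOp hφ ha hf (h0 d)
    · exact continuousOn_neumannOp hφ.shift hb hf.shift_space d
  · exact fun _ _ d => continuousOn_dirichletOp hφ ha hf (h0 d)
  · intro i hi d p hp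
    interval_cases i
    exact hasDerivAt_dirichletOp_space hφ ha hf (h0 d) hp
  · exact fun j hj => absurd hj (Nat.not_lt_zero j)
  · intro i hi
    interval_cases i
    · exact squareBounded_dirichletOp hφ ha hf
    · exact squareBounded_neumannOp hφ.shift hb hf.shift_space
  · exact fun _ _ => squareBounded_dirichletOp hφ ha hf

/-- With the compatibility conditions of orders zero and one the solution operator of the Dirichlet
problem maps continuously into `C^{(3,1)}`. The second condition is the compatibility of the data of
the Dirichlet problem for `h_xx`, and also of that for `h_t`. -/
theorem exists_Ckl_three_one_map (hφ : SchwartzJet φ) (ha : SmoothJet a) (hf : StripJet f)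
    (h0 : ∀ d, φ 0 0 d = a 0 0 d) (h1 : ∀ d, a 1 0 d = φ 2 0 d + f 0 0 (0, 0) d) :
    ∃ Ψ : D → Ckl 3 1, Continuous Ψ ∧
      ∀ d, Ckl.toFun (Ψ d) = unitSquare.indicator (dirichletOp φ a f d) := by
  have hH := isHeatOp_dirichletOp hφ ha hf
  have hb := ha.shift.sub hf.boundary
  have hφ2 := hφ.shift.shift
  have hf2 := hf.shift_space.shift_space
  have hφt := hφ2.add hf.initial
  have h0xx : ∀ d, φ 2 0 d = (a 1 0 - f 0 0 (0, 0)) d := fun d => by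
    rw [LinearMap.sub_apply, h1 d, add_sub_cancel_right]
  have h0t : ∀ d, (φ 2 0 + f 0 0 (0, 0)) d = a 1 0 d := fun d => (h1 d).symm
  have hHxx := squareBounded_dirichletOp hφ2 hb hf2
  have hHt := squareBounded_dirichletOp hφt ha.shift hf.shift_time
  refine exists_Ckl_map (H := dirichletOp φ a f)
    (X := fun
      | 0 => dirichletOp φ a f
      | 1 => neumannOp (fun k => φ (k + 1)) (fun k t => a (k + 1) t - f 0 k (0, t))
        (fun k => f (k + 1))
      | 2 => dirichletOp (fun k => φ (k + 2)) (fun k t => a (k + 1) t - f 0 k (0, t))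
        (fun k => f (k + 2))
      | _ => neumannOp (fun k => φ (k + 3))
        (fun k t => a (k + 2) t - f 0 (k + 1) (0, t) - f 2 k (0, t)) (fun k => f (k + 3)))
    (T := fun
      | 0 => dirichletOp φ a f
      | _ => dirichletOp (fun k y => φ (k + 2) y + f k 0 (y, 0)) (fun k => a (k + 1))
        (fun k l => f k (l + 1)))
    (fun d d' p hp => hH.map_add d d' (unitSquare_subset_Qbar hp))
    (fun c d p _ => hH.map_smul c d p) rfl rfl ?_ ?_ ?_ ?_ ?_ ?_
  · intro i hi d
    interval_cases i
    · exact continuousOn_dirichletOp hφ ha hf (h0 d)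
    · exact continuousOn_neumannOp hφ.shift hb hf.shift_space d
    · exact continuousOn_dirichletOp hφ2 hb hf2 (h0xx d)
    · exact continuousOn_neumannOp hφ2.shift (hb.shift.sub hf2.boundary) hf2.shift_space d
  · intro j hj d
    interval_cases j
    · exact continuousOn_dirichletOp hφ ha hf (h0 d)
    · exact continuousOn_dirichletOp hφt ha.shift hf.shift_time (h0t d)
  · intro i hi d p hp
    interval_cases i
    · exact hasDerivAt_dirichletOp_space hφ ha hf (h0 d) hp
    · exact hasDerivAt_neumannOp_space hφ.shift hb hf.shift_space d hp
    · exact hasDerivAt_dirichletOp_space hφ2 hb hf2 (h0xx d) hp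
  · intro j hj d p hp
    interval_cases j
    exact hasDerivAt_dirichletOp_time hφ ha hf (h0 d) hp
  · intro i hi
    interval_cases i
    · exact squareBounded_dirichletOp hφ ha hf
    · exact squareBounded_neumannOp hφ.shift hb hf.shift_space
    · exact hHxx
    · exact squareBounded_neumannOp hφ2.shift (hb.shift.sub hf2.boundary) hf2.shift_space
  · intro j hj
    interval_cases j
    · exact squareBounded_dirichletOp hφ ha hf
    · exact hHt

end Problems

/-! ### Derivatives of the data -/

section Smooth

/-- `u ↦ u^(k)(x)` for `x ≥ 0`, and zero for `x < 0`. -/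
def halfDerivAt (k : ℕ) (x : ℝ) : smoothHalfLine →ₗ[ℂ] ℂ :=
  if hx : 0 ≤ x then halfDeriv k x hx else 0

theorem halfDerivAt_of_nonneg (k : ℕ) {x : ℝ} (hx : 0 ≤ x) : halfDerivAt k x = halfDeriv k x hx :=
  dif_pos hx

theorem halfDerivAt_apply (k : ℕ) {x : ℝ} (hx : 0 ≤ x) (u : smoothHalfLine) :
    halfDerivAt k x u = iteratedDerivWithin k (u : ℝ → ℂ) (Ici 0) x := by
  rw [halfDerivAt_of_nonneg k hx]; rfl

theorem halfDerivAt_zero (u : smoothHalfLine) (x : ℝ) : halfDerivAt 0 x u = (u : ℝ → ℂ) x := by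
  by_cases hx : 0 ≤ x
  · rw [halfDerivAt_apply 0 hx, iteratedDerivWithin_zero]
  · rw [halfDerivAt, dif_neg hx, u.2.2 x hx, LinearMap.zero_apply]

theorem hasDerivWithinAt_halfDerivAt (u : smoothHalfLine) (k : ℕ) {x : ℝ} (hx : 0 ≤ x) :
    HasDerivWithinAt (fun y => halfDerivAt k y u) (halfDerivAt (k + 1) x u) (Ici 0) x := by
  have hd := (u.2.1.differentiableOn_iteratedDerivWithin (m := k) (by exact_mod_cast ENat.natCast_lt_top k)
    (uniqueDiffOn_Ici 0) x hx).hasDerivWithinAt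
  rw [halfDerivAt_apply (k + 1) hx, iteratedDerivWithin_succ]
  exact hd.congr (fun y hy => halfDerivAt_apply k hy u) (halfDerivAt_apply k hx u)

theorem mk_mem_Qbar {y t : ℝ} (hy : 0 ≤ y) (ht : 0 ≤ t) : (y, t) ∈ Qbar := ⟨hy, ht⟩

theorem Q_subset_Qbar : Q ⊆ Qbar := fun _ hp => mk_mem_Qbar (le_of_lt hp.1) (le_of_lt hp.2)

/-- `f ↦ ∂^{k+l} f / ∂x^k ∂t^l (p)` for `p ∈ Q̄`, and zero for `p ∉ Q̄`. -/
def mixedDerivAt (k l : ℕ) (p : ℝ × ℝ) : smoothOn Qbar →ₗ[ℂ] ℂ := by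
  classical exact if hp : p ∈ Qbar then mixedPartialAt uniqueDiffOn_Qbar k l p hp else 0

theorem mixedDerivAt_of_mem (k l : ℕ) {p : ℝ × ℝ} (hp : p ∈ Qbar) :
    mixedDerivAt k l p = mixedPartialAt uniqueDiffOn_Qbar k l p hp := dif_pos hp

theorem mixedDerivAt_apply (k l : ℕ) {p : ℝ × ℝ} (hp : p ∈ Qbar) (f : smoothOn Qbar) :
    mixedDerivAt k l p f = mixedPartial Qbar k l (f : ℝ × ℝ → ℂ) p := by
  rw [mixedDerivAt_of_mem k l hp]; rfl

theorem mixedDerivAt_zero (f : smoothOn Qbar) (p : ℝ × ℝ) :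
    mixedDerivAt 0 0 p f = (f : ℝ × ℝ → ℂ) p := by
  by_cases hp : p ∈ Qbar
  · rw [mixedDerivAt_apply 0 0 hp]; rfl
  · rw [mixedDerivAt, dif_neg hp, f.2.2 p hp, LinearMap.zero_apply]

theorem dirDeriv_comm {h : ℝ × ℝ → ℂ} (hh : ContDiffOn ℝ ∞ h Qbar) (v w : ℝ × ℝ) :
    EqOn (dirDeriv Qbar v (dirDeriv Qbar w h)) (dirDeriv Qbar w (dirDeriv Qbar v h)) Qbar := by
  intro p hp
  have hd : DifferentiableWithinAt ℝ (fderivWithin ℝ h Qbar) Qbar p :=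
    (hh.fderivWithin uniqueDiffOn_Qbar (m := ∞) (by simp)).differentiableOn (by simp) p hp
  have key : ∀ v w : ℝ × ℝ, dirDeriv Qbar v (dirDeriv Qbar w h) p =
      fderivWithin ℝ (fderivWithin ℝ h Qbar) Qbar p v w := fun v w => by
    unfold dirDeriv
    rw [fderivWithin_clm_apply (uniqueDiffOn_Qbar p hp) hd (differentiableWithinAt_const w)]
    simp
  -- the second derivative is symmetric at limits of interior points
  have hcl : p ∈ closure (interior Qbar) := by
    have hQ : Q ⊆ interior Qbar :=
      interior_maximal Q_subset_Qbar isOpen_Q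
    exact closure_mono hQ (closure_Q ▸ hp)
  have hsymm : IsSymmSndFDerivWithinAt ℝ h Qbar p :=
    (hh p hp).isSymmSndFDerivWithinAt (by simpa using WithTop.coe_le_coe.2 (le_top : (2 : ℕ∞) ≤ ⊤)) uniqueDiffOn_Qbar hcl hp
  rw [key, key, hsymm v w]

theorem iterate_dirDeriv_comm (v w : ℝ × ℝ) (k : ℕ) {h : ℝ × ℝ → ℂ} (hh : ContDiffOn ℝ ∞ h Qbar) :
    EqOn ((dirDeriv Qbar v)^[k] (dirDeriv Qbar w h)) (dirDeriv Qbar w ((dirDeriv Qbar v)^[k] h))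
      Qbar := by
  induction k with
  | zero => exact fun p _ => rfl
  | succ k ih =>
    intro p hp
    rw [Function.iterate_succ_apply', Function.iterate_succ_apply',
      ← dirDeriv_comm (contDiffOn_iterate_dirDeriv uniqueDiffOn_Qbar v k hh) v w hp, dirDeriv, dirDeriv,
      fderivWithin_congr ih (ih hp)]

theorem contDiffOn_mixedPartial (k l : ℕ) {h : ℝ × ℝ → ℂ} (hh : ContDiffOn ℝ ∞ h Qbar) :
    ContDiffOn ℝ ∞ (mixedPartial Qbar k l h) Qbar :=
  contDiffOn_iterate_dirDeriv uniqueDiffOn_Qbar _ k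
    (contDiffOn_iterate_dirDeriv uniqueDiffOn_Qbar _ l hh)

theorem hasFDerivWithinAt_mixedPartial (k l : ℕ) {h : ℝ × ℝ → ℂ} (hh : ContDiffOn ℝ ∞ h Qbar)
    {p : ℝ × ℝ} (hp : p ∈ Qbar) : HasFDerivWithinAt (mixedPartial Qbar k l h)
      (fderivWithin ℝ (mixedPartial Qbar k l h) Qbar p) Qbar p :=
  ((contDiffOn_mixedPartial k l hh).differentiableOn (by simp) p hp).hasFDerivWithinAt

theorem hasDerivWithinAt_mixedDerivAt_space (f : smoothOn Qbar) (k l : ℕ) {y t : ℝ} (hy : 0 ≤ y)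
    (ht : 0 ≤ t) : HasDerivWithinAt (fun y => mixedDerivAt k l (y, t) f)
      (mixedDerivAt (k + 1) l (y, t) f) (Ici 0) y := by
  have hd := (hasFDerivWithinAt_mixedPartial k l f.2.1 (p := (y, t)) (mk_mem_Qbar hy ht)).comp_hasDerivWithinAt y
    (((hasDerivAt_id y).prodMk (hasDerivAt_const y t)).hasDerivWithinAt (s := Ici 0))
    fun z hz => mk_mem_Qbar hz ht
  rw [mixedDerivAt_apply (k + 1) l (mk_mem_Qbar hy ht), mixedPartial, Function.iterate_succ_apply']
  exact hd.congr (fun z hz => mixedDerivAt_apply k l (mk_mem_Qbar hz ht) f) (mixedDerivAt_apply k l (mk_mem_Qbar hy ht) f)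

theorem hasDerivWithinAt_mixedDerivAt_time (f : smoothOn Qbar) (k l : ℕ) {y t : ℝ} (hy : 0 ≤ y)
    (ht : 0 ≤ t) : HasDerivWithinAt (fun t => mixedDerivAt k l (y, t) f)
      (mixedDerivAt k (l + 1) (y, t) f) (Ici 0) t := by
  have hd := (hasFDerivWithinAt_mixedPartial k l f.2.1 (p := (y, t)) (mk_mem_Qbar hy ht)).comp_hasDerivWithinAt t
    (((hasDerivAt_const t y).prodMk (hasDerivAt_id t)).hasDerivWithinAt (s := Ici 0))
    fun z hz => mk_mem_Qbar hy hz
  rw [mixedDerivAt_apply k (l + 1) (mk_mem_Qbar hy ht), mixedPartial, Function.iterate_succ_apply',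
    iterate_dirDeriv_comm _ _ k (contDiffOn_iterate_dirDeriv uniqueDiffOn_Qbar _ l f.2.1) (mk_mem_Qbar hy ht)]
  exact hd.congr (fun z hz => mixedDerivAt_apply k l (mk_mem_Qbar hy hz) f) (mixedDerivAt_apply k l (mk_mem_Qbar hy ht) f)

end Smooth

section DataJets

instance {E : Type*} [AddCommGroup E] [Module ℂ E] {κ : Type*} [Nonempty κ] {ι : κ → Type*}
    (L : ∀ n : κ, ι n → E →ₗ[ℂ] ℂ) : IsTopologicalAddGroup (SupSpace L) :=
  (withSeminorms_supSeminorm L).topologicalAddGroup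

theorem continuous_supSeminorm {E : Type*} [AddCommGroup E] [Module ℂ E] {κ : Type*} [Nonempty κ]
    {ι : κ → Type*} (L : ∀ n : κ, ι n → E →ₗ[ℂ] ℂ) (n : κ) : Continuous (supSeminorm L n) :=
  (withSeminorms_supSeminorm L).continuous_seminorm n

theorem norm_le_supSeminorm {E : Type*} [AddCommGroup E] [Module ℂ E] {κ : Type*} {ι : κ → Type*}
    (L : ∀ n : κ, ι n → E →ₗ[ℂ] ℂ) (h : SupSpace L) (n : κ) (a : ι n) :
    ‖L n a (SupSpace.val L h)‖ ≤ supSeminorm L n h :=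
  le_ciSup (f := fun a => ‖L n a (SupSpace.val L h)‖) (SupSpace.bdd L h n) a

variable {D : Type*} [AddCommGroup D] [Module ℂ D] [TopologicalSpace D] {ι : D →ₗ[ℂ] Data}

theorem schwartzJet_uData (hι : Continuous ι) :
    SchwartzJet fun k y => halfDerivAt k y ∘ₗ uData ∘ₗ ι where
  deriv k d y hy := hasDerivWithinAt_halfDerivAt _ k hy
  bound k N := by
    refine ⟨(supSeminorm schwartzFunctional (max k N)).comp (LinearMap.fst ℂ _ _ ∘ₗ ι),
      (continuous_supSeminorm _ _).comp (continuous_fst.comp hι), fun d y hy => ?_⟩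
    have h := norm_le_supSeminorm schwartzFunctional (ι d).1 (max k N) ⟨(k, y), le_max_left _ _, hy⟩
    refine le_trans ?_ h
    show (1 + y) ^ N * ‖halfDerivAt k y (uData (ι d))‖ ≤
      ‖(((1 + y) ^ (max k N) : ℝ) : ℂ) • halfDeriv k y hy (uData (ι d))‖
    rw [norm_smul, Complex.norm_real, Real.norm_of_nonneg (by positivity), halfDerivAt_of_nonneg k hy]
    gcongr
    · linarith
    · exact le_max_right _ _

theorem smoothJet_gData (hι : Continuous ι) :
    SmoothJet fun k t => halfDerivAt k t ∘ₗ gData ∘ₗ ι where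
  deriv k d t ht := hasDerivWithinAt_halfDerivAt _ k ht
  bound k T := by
    refine ⟨(supSeminorm smoothFunctional (⌈T⌉₊.succPNat, k)).comp
      (LinearMap.fst ℂ _ _ ∘ₗ LinearMap.snd ℂ _ _ ∘ₗ ι),
      (continuous_supSeminorm _ _).comp (continuous_fst.comp (continuous_snd.comp hι)),
      fun d t ht htT => ?_⟩
    have hT : t ≤ ((⌈T⌉₊.succPNat : ℕ+) : ℕ) := by
      rw [Nat.succPNat_coe, Nat.cast_succ]
      linarith [Nat.le_ceil T]
    have h := norm_le_supSeminorm smoothFunctional (ι d).2.1 (⌈T⌉₊.succPNat, k) ⟨t, ht, hT⟩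
    refine le_trans (le_of_eq ?_) h
    show ‖halfDerivAt k t (gData (ι d))‖ = ‖halfDeriv k t ht (gData (ι d))‖
    rw [halfDerivAt_of_nonneg k ht]

theorem stripJet_fData (hι : Continuous ι) :
    StripJet fun k l p => mixedDerivAt k l p ∘ₗ fData ∘ₗ ι where
  cont k l d := (contDiffOn_mixedPartial k l (fData (ι d)).2.1).continuousOn.congr
    fun p hp => mixedDerivAt_apply k l hp _
  deriv_space k l d y t hy ht := hasDerivWithinAt_mixedDerivAt_space _ k l hy ht
  deriv_time k l d y t hy ht := hasDerivWithinAt_mixedDerivAt_time _ k l hy ht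
  bound k l N T := by
    set n : ℕ+ := (k + l + N + ⌈T⌉₊).succPNat with hn
    have hnv : (n : ℕ) = k + l + N + ⌈T⌉₊ + 1 := Nat.succPNat_coe _
    refine ⟨(supSeminorm stripBarFunctional n).comp
      (LinearMap.snd ℂ _ _ ∘ₗ LinearMap.snd ℂ _ _ ∘ₗ ι),
      (continuous_supSeminorm _ _).comp (continuous_snd.comp (continuous_snd.comp hι)),
      fun d y t hy ht htT => ?_⟩
    have hT : t ≤ ((n : ℕ) : ℝ) := by
      have : ((⌈T⌉₊ : ℕ) : ℝ) ≤ ((n : ℕ) : ℝ) := by rw [hnv]; exact_mod_cast by omega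
      linarith [Nat.le_ceil T]
    have hp : (y, t) ∈ Qbar := ⟨hy, ht⟩
    have h := norm_le_supSeminorm stripBarFunctional (ι d).2.2 n
      ⟨((k, l), (y, t)), by simp only; omega, hp, hT⟩
    refine le_trans ?_ h
    show (1 + y) ^ N * ‖mixedDerivAt k l (y, t) (fData (ι d))‖ ≤
      ‖(((1 + y) ^ (n : ℕ) : ℝ) : ℂ) • mixedPartialAt uniqueDiffOn_Qbar k l (y, t) hp (fData (ι d))‖
    rw [norm_smul, Complex.norm_real, Real.norm_of_nonneg (by positivity), mixedDerivAt_of_mem k l hp]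
    gcongr
    · linarith
    · omega

theorem continuous_of_norm_le_seminorm [IsTopologicalAddGroup D] {c : D →ₗ[ℂ] ℂ}
    (hc : ∃ p : Seminorm ℂ D, Continuous p ∧ ∀ d, ‖c d‖ ≤ p d) : Continuous c := by
  obtain ⟨p, hp, hpb⟩ := hc
  refine continuous_of_continuousAt_zero c ?_
  rw [ContinuousAt, map_zero]
  refine squeeze_zero_norm hpb ?_
  simpa using hp.tendsto 0

end DataJets

theorem continuous_halfDerivAt_uData (k : ℕ) : Continuous fun d => halfDerivAt k 0 (uData d) :=
  continuous_of_norm_le_seminorm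
    ((schwartzJet_uData (ι := LinearMap.id) continuous_id).functional_bound k)

theorem continuous_halfDerivAt_gData (k : ℕ) : Continuous fun d => halfDerivAt k 0 (gData d) :=
  continuous_of_norm_le_seminorm
    ((smoothJet_gData (ι := LinearMap.id) continuous_id).functional_bound k)

theorem continuous_fData_zero : Continuous fun d => mixedDerivAt 0 0 (0, 0) (fData d) :=
  continuous_of_norm_le_seminorm
    ((stripJet_fData (ι := LinearMap.id) continuous_id).boundary.functional_bound 0)

theorem mem_D0_iff (d : Data) : d ∈ D0 ↔ halfDerivAt 0 0 (uData d) = halfDerivAt 0 0 (gData d) := by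
  rw [halfDerivAt_zero, halfDerivAt_zero]; rfl

theorem mem_D1_iff (d : Data) : d ∈ D1 ↔ halfDerivAt 0 0 (uData d) = halfDerivAt 0 0 (gData d) ∧
    halfDerivAt 1 0 (gData d) = halfDerivAt 2 0 (uData d) + mixedDerivAt 0 0 (0, 0) (fData d) := by
  rw [halfDerivAt_zero, halfDerivAt_zero, halfDerivAt_of_nonneg 1 le_rfl,
    halfDerivAt_of_nonneg 2 le_rfl, mixedDerivAt_zero]
  rfl

theorem isClosed_D0 : IsClosed (D0 : Set Data) := by
  have : (D0 : Set Data) = {d | halfDerivAt 0 0 (uData d) = halfDerivAt 0 0 (gData d)} :=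
    Set.ext mem_D0_iff
  rw [this]
  exact isClosed_eq (continuous_halfDerivAt_uData 0) (continuous_halfDerivAt_gData 0)

theorem isClosed_D1 : IsClosed (D1 : Set Data) := by
  have : (D1 : Set Data) = {d | halfDerivAt 0 0 (uData d) = halfDerivAt 0 0 (gData d) ∧
      halfDerivAt 1 0 (gData d) = halfDerivAt 2 0 (uData d) + mixedDerivAt 0 0 (0, 0) (fData d)} :=
    Set.ext mem_D1_iff
  rw [this]
  exact (isClosed_eq (continuous_halfDerivAt_uData 0) (continuous_halfDerivAt_gData 0)).inter
    (isClosed_eq (continuous_halfDerivAt_gData 1)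
      ((continuous_halfDerivAt_uData 2).add continuous_fData_zero))

/-! ### The solution operator -/

section Solution

variable {D : Type*} [AddCommGroup D] [Module ℂ D]

/-- The solution operator of the Dirichlet problem, as an operator on a space `D` that is mapped to
the space of data. -/
def solutionOp (ι : D →ₗ[ℂ] Data) : D → ℝ × ℝ → ℂ :=
  dirichletOp (fun k y => halfDerivAt k y ∘ₗ uData ∘ₗ ι) (fun k t => halfDerivAt k t ∘ₗ gData ∘ₗ ι)
    (fun k l p => mixedDerivAt k l p ∘ₗ fData ∘ₗ ι)

variable [TopologicalSpace D] {ι : D →ₗ[ℂ] Data}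

/-- The operator `Φ` solves the Dirichlet problem with the given data. -/
theorem Phi_eq_solutionOp (hι : Continuous ι) (d : D) {p : ℝ × ℝ} (hp : p ∈ Q) :
    Phi (ι d) p = solutionOp ι d p := by
  have hu := (schwartzJet_uData hι).decaying 0 d
  have hg := (smoothJet_gData hι).cont 0 d
  have hf := (stripJet_fData hι).stripDecaying 0 0 d
  simp only [LinearMap.comp_apply, halfDerivAt_zero, mixedDerivAt_zero] at hu hg hf
  have e0 := opI0_eq_heatP hu hp.1 hp.2
  have e1 := opI1_eq_layer1 hg hp.1 hp.2
  have e2 := opI2_eq_heatW hf hp.1 hp.2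
  have hc : (1 / (2 * Real.pi) : ℂ) * √Real.pi = ((√(4 * Real.pi))⁻¹ : ℝ) := by
    have h : 1 / (2 * Real.pi) * √Real.pi = (√(4 * Real.pi))⁻¹ := by
      rw [Real.sqrt_mul (by norm_num), show (4 : ℝ) = 2 ^ 2 by norm_num, Real.sqrt_sq (by norm_num)]
      have hpi : √Real.pi ≠ 0 := (Real.sqrt_pos.2 Real.pi_pos).ne'
      field_simp
      rw [Real.sq_sqrt Real.pi_pos.le]
    rw [← h]; push_cast; ring
  simp only [Phi, solutionOp, dirichletOp, LinearMap.comp_apply, halfDerivAt_zero, mixedDerivAt_zero]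
  rw [← hc]
  linear_combination (1 / (2 * Real.pi) : ℂ) * (e0 + e1 + e2)

/-- `extendTo` is a limit along `Q`; the limit at a boundary point exists and is the value of a continuous
extension, and it is unique because `Q` is dense in `Q̄`. -/
theorem extendTo_eq_indicator {S T : Set (ℝ × ℝ)} {F H : ℝ × ℝ → ℂ} (hFH : EqOn F H Q)
    (hH : ContinuousOn H T) (hST : S ⊆ T) (hQT : Q ⊆ T) (hT : T ⊆ Qbar) :
    extendTo S F = S.indicator H := by
  refine Set.indicator_congr fun p hp => ?_
  split_ifs with hpQ
  · exact hFH hpQ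
  · have : (𝓝[Q] p).NeBot := mem_closure_iff_nhdsWithin_neBot.1 (closure_Q ▸ hT (hST hp))
    refine Tendsto.limUnder_eq ?_
    refine Tendsto.congr' ?_ ((hH p (hST hp)).mono hQT)
    filter_upwards [self_mem_nhdsWithin] with q hq using (hFH hq).symm

theorem exists_S1Qpunct_Phi [IsTopologicalAddGroup D] (hι : Continuous ι) :
    ∃ Ψ : D → S1Qpunct, Continuous Ψ ∧
      ∀ d, S1Qpunct.toFun (Ψ d) = extendTo Qpunct (Phi (ι d)) := by
  have hH : IsHeatOp (solutionOp ι) :=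
    isHeatOp_dirichletOp (schwartzJet_uData hι) (smoothJet_gData hι) (stripJet_fData hι)
  obtain ⟨Ψ, hΨ, he⟩ := hH.exists_S1Qpunct_map
  exact ⟨Ψ, hΨ, fun d => (he d).trans (extendTo_eq_indicator
    (fun _ hp => Phi_eq_solutionOp hι d hp) (hH.continuousOn d) Subset.rfl Q_subset_Qpunct
    fun _ hp => hp.1).symm⟩

theorem extendTo_unitSquare_Phi (hι : Continuous ι)
    {d : D} (h0 : halfDerivAt 0 0 (uData (ι d)) = halfDerivAt 0 0 (gData (ι d))) :
    extendTo unitSquare (Phi (ι d)) = unitSquare.indicator (solutionOp ι d) :=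
  extendTo_eq_indicator (T := Qbar) (fun _ hp => Phi_eq_solutionOp hι d hp)
    (continuousOn_dirichletOp (schwartzJet_uData hι) (smoothJet_gData hι) (stripJet_fData hι) h0)
    unitSquare_subset_Qbar Q_subset_Qbar Subset.rfl

theorem exists_Ckl_one_zero_Phi [IsTopologicalAddGroup D] (hι : Continuous ι)
    (h0 : ∀ d, halfDerivAt 0 0 (uData (ι d)) = halfDerivAt 0 0 (gData (ι d))) :
    ∃ Ψ : D → Ckl 1 0, Continuous Ψ ∧
      ∀ d, Ckl.toFun (Ψ d) = extendTo unitSquare (Phi (ι d)) := by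
  obtain ⟨Ψ, hΨ, he⟩ := exists_Ckl_one_zero_map (schwartzJet_uData hι) (smoothJet_gData hι)
    (stripJet_fData hι) h0
  exact ⟨Ψ, hΨ, fun d => (he d).trans (extendTo_unitSquare_Phi hι (h0 d)).symm⟩

theorem exists_Ckl_three_one_Phi [IsTopologicalAddGroup D] (hι : Continuous ι)
    (h0 : ∀ d, halfDerivAt 0 0 (uData (ι d)) = halfDerivAt 0 0 (gData (ι d)))
    (h1 : ∀ d, halfDerivAt 1 0 (gData (ι d)) =
      halfDerivAt 2 0 (uData (ι d)) + mixedDerivAt 0 0 (0, 0) (fData (ι d))) :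
    ∃ Ψ : D → Ckl 3 1, Continuous Ψ ∧
      ∀ d, Ckl.toFun (Ψ d) = extendTo unitSquare (Phi (ι d)) := by
  obtain ⟨Ψ, hΨ, he⟩ := exists_Ckl_three_one_map (schwartzJet_uData hι) (smoothJet_gData hι)
    (stripJet_fData hι) h0 h1
  exact ⟨Ψ, hΨ, fun d => (he d).trans (extendTo_unitSquare_Phi hι (h0 d)).symm⟩

theorem ckl_mono {k k' l l' : ℕ} (hk : k ≤ k') (hl : l ≤ l') : ckl k' l' ≤ ckl k l :=
  fun _ ⟨a, b, c, d, e⟩ => ⟨fun t ht => (a t ht).of_le (by exact_mod_cast hk),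
    fun x hx => (b x hx).of_le (by exact_mod_cast hl), fun i hi => c i (hi.trans hk),
    fun j hj => d j (hj.trans hl), e⟩

theorem Ckl.toFun_mem {k l : ℕ} (h : Ckl k l) : Ckl.toFun h ∈ ckl k l :=
  (SupSpace.val (cklFunctional k l) h).2

end Solution

end HalfLineHeat

end

theorem mainTheorem2 :
    (IsClosed (HalfLineHeat.D0 : Set HalfLineHeat.Data) ∧
      (∃ Ψ : HalfLineHeat.D0 → HalfLineHeat.S1Qpunct, Continuous Ψ ∧
        ∀ d : HalfLineHeat.D0,
          HalfLineHeat.S1Qpunct.toFun (Ψ d) =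
            HalfLineHeat.extendTo HalfLineHeat.Qpunct (HalfLineHeat.Phi d)) ∧
      (∃ Ψ : HalfLineHeat.D0 → HalfLineHeat.Ckl 1 0, Continuous Ψ ∧
        ∀ d : HalfLineHeat.D0,
          HalfLineHeat.Ckl.toFun (Ψ d) =
            HalfLineHeat.extendTo HalfLineHeat.unitSquare (HalfLineHeat.Phi d))) ∧
    (IsClosed (HalfLineHeat.D1 : Set HalfLineHeat.Data) ∧
      (∃ Ψ : HalfLineHeat.D1 → HalfLineHeat.S1Qpunct, Continuous Ψ ∧
        ∀ d : HalfLineHeat.D1,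
          HalfLineHeat.S1Qpunct.toFun (Ψ d) =
            HalfLineHeat.extendTo HalfLineHeat.Qpunct (HalfLineHeat.Phi d)) ∧
      (∀ d : HalfLineHeat.D1,
        HalfLineHeat.extendTo HalfLineHeat.unitSquare (HalfLineHeat.Phi d) ∈ HalfLineHeat.ckl 2 1) ∧
      (∃ Ψ : HalfLineHeat.D1 → HalfLineHeat.Ckl 3 1, Continuous Ψ ∧
        ∀ d : HalfLineHeat.D1,
          HalfLineHeat.Ckl.toFun (Ψ d) =
            HalfLineHeat.extendTo HalfLineHeat.unitSquare (HalfLineHeat.Phi d))) := by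
  have c0 : Continuous HalfLineHeat.D0.subtype := continuous_subtype_val
  have c1 : Continuous HalfLineHeat.D1.subtype := continuous_subtype_val
  have m0 := fun d : HalfLineHeat.D0 => (HalfLineHeat.mem_D0_iff d).1 d.2
  have m1 := fun d : HalfLineHeat.D1 => (HalfLineHeat.mem_D1_iff d).1 d.2
  have s0 := HalfLineHeat.exists_S1Qpunct_Phi c0
  have s1 := HalfLineHeat.exists_S1Qpunct_Phi c1
  have k0 := HalfLineHeat.exists_Ckl_one_zero_Phi c0 m0
  obtain ⟨Ψ, hΨ, he⟩ := HalfLineHeat.exists_Ckl_three_one_Phi c1 (fun d => (m1 d).1)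
    fun d => (m1 d).2
  refine ⟨⟨HalfLineHeat.isClosed_D0, s0, k0⟩, HalfLineHeat.isClosed_D1, s1, fun d => ?_, Ψ, hΨ, he⟩
  have hmem := HalfLineHeat.Ckl.toFun_mem (Ψ d)
  rw [he d] at hmem
  exact HalfLineHeat.ckl_mono (by norm_num) le_rfl hmem
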